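/- For every $\epsilon>0$ there is a constant $C_\epsilon>0$, depending only on $\epsilon$, with the following property. Let $d,M\in\mathbb{N}$ and let $X_1,\dots,X_M$ be independent $d\times d$ real random matrices such that, for each $r$, the entries of $X_r$ are jointly Gaussian (possibly degenerate) and $\mathbb{E}X_r=0$. Then \[\mathbb{E}\left\|\sum_{r=1}^{M}\bigl(X_r^{*}X_r-\mathbb{E}(X_r^{*}X_r)\bigr)\right\|\le C_\epsilon\left(\sum_{r=1}^{M}\Bigl(\|\mathbb{E}(X_r^{*}X_r)\|^{2}+\|\mathbb{E}(X_rX_r^{*})\|^{2}+d^{\epsilon}\,\|\mathbb{E}(X_r\otimes X_r)\|^{2}\Bigr)\right)^{1/2},\] where the expectation on the left is finite, $\|\cdot\|$ denotes the spectral norm (the operator norm with respect to Euclidean norms), and $\mathbb{E}(X_r\otimes X_r)$ is the $d^2\times d^2$ covariance matrix of the entries of $X_r$, whose entry at $((i,j),(k,l))$ is $\mathbb{E}[(X_r)_{ij}(X_r)_{kl}]$; equivalently, it is the linear map $B\mapsto\mathbb{E}[\mathrm{Tr}(X_rB^{*})X_r]$ on the space $M_d(\mathbb{R})$ of $d\times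 d$ real matrices with the inner product $\langle A,B\rangle=\mathrm{Tr}(AB^{*})$. -/

import Mathlib

open MeasureTheory ProbabilityTheory
open scoped Matrix Matrix.Norms.L2Operator

noncomputable section

/-- The family of entries of a `d × d` matrix, as a vector indexed by pairs of positions. -/
def entries {d : ℕ} (A : Matrix (Fin d) (Fin d) ℝ) : Fin d × Fin d → ℝ := fun p => A p.1 p.2

/-- The entrywise expectation `𝔼 Y` of a random real matrix `Y`. -/
def expMatrix {Ω : Type*} [MeasurableSpace Ω] {m n : Type*} (P : Measure Ω)
    (Y : Ω → Matrix m n ℝ) : Matrix m n ℝ :=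
  Matrix.of fun i j => ∫ ω, Y ω i j ∂P

/-- The matrix `𝔼 (X ⊗ X)` of a random matrix `X`, indexed by pairs of positions, with entry
`𝔼 (X i j * X k l)` at `((i, j), (k, l))`. In the orthonormal basis of matrix units of the space
of `d × d` real matrices with the Frobenius inner product, it represents the linear map
`B ↦ 𝔼 (⟪X, B⟫ • X)`. -/
def tensorSecondMoment {Ω : Type*} [MeasurableSpace Ω] {d : ℕ} (P : Measure Ω)
    (X : Ω → Matrix (Fin d) (Fin d) ℝ) :
    Matrix (Fin d × Fin d) (Fin d × Fin d) ℝ :=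
  Matrix.of fun p q => ∫ ω, X ω p.1 p.2 * X ω q.1 q.2 ∂P

/-- `X` is a centered Gaussian random matrix: its entries are jointly Gaussian (possibly
degenerate) and `𝔼 X = 0`. -/
structure IsCenteredGaussianMatrix {Ω : Type*} [MeasurableSpace Ω] {d : ℕ} (P : Measure Ω)
    (X : Ω → Matrix (Fin d) (Fin d) ℝ) : Prop where
  jointly_gaussian : HasGaussianLaw (fun ω => entries (X ω)) P
  mean_zero : expMatrix P X = 0

end

/-!
The sum is a quadratic chaos in a Gaussian vector. Subtracting an independent copy and rotating the
pair of copies by `π / 4` replaces it by the decoupled sum `∑ U_rᵀ V_r`, with `U` and `V`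
independent (`integral_norm_sub_expMatrix_le`). For fixed `U` this is a Gaussian matrix, and so is
each `U_r`. Hence everything reduces to a bound for the operator norm of one Gaussian matrix,
applied twice (`integral_norm_sq_weightedSum_le`).

For a symmetric Gaussian matrix `X` with `𝔼 ‖X x‖² ≤ σ ‖x‖²` and covariance operator at most `κ`,
that bound is `(𝔼 τ(X ^ P)) ^ (2 / P) ≤ 16 σ + P ^ 4 κ`, where `τ` is the normalized trace and `P` is
a power of two (`integral_schattenPow_le`). With `2 ^ P` above the dimension, the moment controls
the operator norm up to a constant, and since such a `P` can be of order `log d`, the factor `P ^ 8`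
in front of `κ ^ 2` costs only `d ^ ε` (`exists_moment_order`). A general matrix is treated through
its symmetric dilation (`integral_norm_sq_le`).

The proof of the moment bound compares `X` with a semicircular variable. Let `Φ(M) = 𝔼 (X M X)`.
Gaussian integration by parts (`integral_ntr_pow_mul_eq`), which is the infinitesimal form of the
rotation invariance of two independent copies, gives
`𝔼 X ^ (k + 2) = ∑ₐ 𝔼 (Φ(X ^ a) X ^ (k - a))`.
If the expectation of each product is replaced by the product of the expectations, this becomes the
Catalan recursion, because `Φ` has norm at most `σ` on all Schatten classes
(`HasSecondMomentBounds.dualBound_expMatrix`). The error of the replacement is a covariance: along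
the interpolation `cos θ • u + sin θ • x` between independent and equal copies, its derivative is,
after a second integration by parts, a sum of terms in which two independent copies of `X` cross
(`abs_integral_ntr_momentMap_sub_le`). A crossing costs a factor `κ σ` instead of `σ ^ 2`: in the
singular bases of the factors it is a sum over four indices, to which Hölder's inequality in Young's
form and a Schur test apply (`HasSecondMomentBounds.abs_crossing_le`). The resulting scalar recursion
`momentMajorant` stays below `1` at `P` when `σ ≤ 1 / 16` and the errors are small, which contradicts
the normalization `𝔼 τ(X ^ P) = 1` unless the bound holds.

Hölder's inequality for the Schatten norms of order `P = 2 ^ (N + 1)` is obtained by repeatedly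
pairing the factors of a product (`abs_ntr_seqProd_pow_le`), and the norms of order `P / k` are
handled by duality (`DualBound`).
-/

/-! ### Normalized Schatten norms and Hölder's inequality -/

section Schatten

variable {n : Type*} [Fintype n]

/-- The normalized trace of a square matrix. -/
noncomputable def ntr (A : Matrix n n ℝ) : ℝ := A.trace / Fintype.card n

lemma ntr_mul_comm (A B : Matrix n n ℝ) : ntr (A * B) = ntr (B * A) := by
  simp [ntr, Matrix.trace_mul_comm A B]

lemma ntr_add (A B : Matrix n n ℝ) : ntr (A + B) = ntr A + ntr B := by
  simp [ntr, add_div]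

lemma ntr_sub (A B : Matrix n n ℝ) : ntr (A - B) = ntr A - ntr B := by
  simp [ntr, sub_div]

lemma ntr_smul (c : ℝ) (A : Matrix n n ℝ) : ntr (c • A) = c * ntr A := by
  simp [ntr, mul_div_assoc]

lemma ntr_zero : ntr (0 : Matrix n n ℝ) = 0 := by simp [ntr]

lemma ntr_sum {ι : Type*} (s : Finset ι) (A : ι → Matrix n n ℝ) :
    ntr (∑ i ∈ s, A i) = ∑ i ∈ s, ntr (A i) := by
  simp [ntr, Matrix.trace_sum, Finset.sum_div]

lemma ntr_one [DecidableEq n] [Nonempty n] : ntr (1 : Matrix n n ℝ) = 1 := by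
  simp [ntr]

lemma trace_mul_transpose_eq_sum (A : Matrix n n ℝ) : (A * Aᵀ).trace = ∑ i, ∑ j, A i j ^ 2 := by
  simp [Matrix.trace, Matrix.mul_apply, sq]

lemma ntr_mul_transpose_nonneg (A : Matrix n n ℝ) : 0 ≤ ntr (A * Aᵀ) := by
  rw [ntr, trace_mul_transpose_eq_sum]
  positivity

lemma sq_ntr_mul_le (A B : Matrix n n ℝ) :
    ntr (A * B) ^ 2 ≤ ntr (A * Aᵀ) * ntr (B * Bᵀ) := by
  have h1 : (A * B).trace = ∑ p : n × n, A p.1 p.2 * B p.2 p.1 := by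
    simp [Matrix.trace, Matrix.mul_apply, Fintype.sum_prod_type]
  have h2 : (A * Aᵀ).trace = ∑ p : n × n, A p.1 p.2 ^ 2 := by
    rw [trace_mul_transpose_eq_sum, Fintype.sum_prod_type]
  have h3 : (B * Bᵀ).trace = ∑ p : n × n, B p.2 p.1 ^ 2 := by
    rw [trace_mul_transpose_eq_sum, Fintype.sum_prod_type, Finset.sum_comm]
  have := Finset.sum_mul_sq_le_sq_mul_sq Finset.univ (fun p : n × n => A p.1 p.2)
    (fun p => B p.2 p.1)
  rw [ntr, ntr, ntr, h1, h2, h3, div_pow, div_mul_div_comm, ← sq]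
  gcongr

variable [DecidableEq n]

/-- The quantity `τ((A Aᵀ) ^ m)` with `τ` the normalized trace: the `2 m`-th power of the normalized
Schatten norm of order `2 m`. -/
noncomputable def schattenPow (m : ℕ) (A : Matrix n n ℝ) : ℝ := ntr ((A * Aᵀ) ^ m)

/-- The trace of a power is invariant under a cyclic shift of the two factors. -/
lemma ntr_mul_pow_comm (A B : Matrix n n ℝ) (m : ℕ) : ntr ((A * B) ^ m) = ntr ((B * A) ^ m) := by
  cases m with
  | zero => simp
  | succ m =>
    have h : (A * B) ^ (m + 1) = A * ((B * A) ^ m * B) := by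
      induction m with
      | zero => simp
      | succ m ih =>
        rw [pow_succ, ih, pow_succ (B * A) m]
        simp only [mul_assoc]
    rw [h, ntr_mul_comm, pow_succ]
    simp only [mul_assoc]

lemma transpose_mul_self_pow (A : Matrix n n ℝ) (m : ℕ) :
    ((A * Aᵀ) ^ m)ᵀ = (A * Aᵀ) ^ m := by
  simp [Matrix.transpose_pow, Matrix.transpose_mul]

lemma schattenPow_nonneg (m : ℕ) (A : Matrix n n ℝ) : 0 ≤ schattenPow m A := by
  rw [schattenPow]
  obtain ⟨k, rfl | rfl⟩ := m.even_or_odd'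
  · have : (A * Aᵀ) ^ (2 * k) = (A * Aᵀ) ^ k * ((A * Aᵀ) ^ k)ᵀ := by
      rw [transpose_mul_self_pow, ← pow_add, two_mul]
    rw [this]
    exact ntr_mul_transpose_nonneg _
  · have : (A * Aᵀ) ^ (2 * k + 1) = ((A * Aᵀ) ^ k * A) * ((A * Aᵀ) ^ k * A)ᵀ := by
      rw [Matrix.transpose_mul, transpose_mul_self_pow, pow_succ, two_mul, pow_add]
      have hc : Commute ((A * Aᵀ) ^ k) (A * Aᵀ) := (Commute.refl _).pow_left k
      calc (A * Aᵀ) ^ k * (A * Aᵀ) ^ k * (A * Aᵀ)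
          = (A * Aᵀ) ^ k * ((A * Aᵀ) ^ k * (A * Aᵀ)) := mul_assoc _ _ _
        _ = (A * Aᵀ) ^ k * ((A * Aᵀ) * (A * Aᵀ) ^ k) := by rw [hc.eq]
        _ = _ := by simp only [mul_assoc]
    rw [this]
    exact ntr_mul_transpose_nonneg _

lemma schattenPow_one [Nonempty n] (m : ℕ) : schattenPow m (1 : Matrix n n ℝ) = 1 := by
  simp [schattenPow, ntr_one]

/-- The ordered product `Y 0 * Y 1 * ⋯ * Y (k - 1)`. -/
def seqProd {M : Type*} [Monoid M] (Y : ℕ → M) (k : ℕ) : M := ((List.range k).map Y).prod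

lemma seqProd_succ {M : Type*} [Monoid M] (Y : ℕ → M) (k : ℕ) :
    seqProd Y (k + 1) = seqProd Y k * Y k := List.prod_range_succ _ _

lemma seqProd_two_mul {M : Type*} [Monoid M] (Y : ℕ → M) (k : ℕ) :
    seqProd Y (2 * k) = seqProd (fun i => Y (2 * i) * Y (2 * i + 1)) k := by
  induction k with
  | zero => simp [seqProd]
  | succ k ih =>
    rw [Nat.mul_succ, seqProd_succ, seqProd_succ, ih, seqProd_succ, mul_assoc]

lemma seqProd_const {M : Type*} [Monoid M] (a : M) (k : ℕ) : seqProd (fun _ => a) k = a ^ k := by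
  simp [seqProd]

lemma prod_range_two_mul {M : Type*} [CommMonoid M] (f : ℕ → M) (k : ℕ) :
    ∏ i ∈ Finset.range (2 * k), f i = ∏ i ∈ Finset.range k, (f (2 * i) * f (2 * i + 1)) := by
  induction k with
  | zero => simp
  | succ k ih => rw [Nat.mul_succ, Finset.prod_range_succ, Finset.prod_range_succ, ih,
      Finset.prod_range_succ, mul_assoc]

lemma list_prod_eq_seqProd {M : Type*} [Monoid M] (l : List M) :
    l.prod = seqProd (fun i => l.getD i 1) l.length := by
  rw [seqProd]
  congr 1
  apply List.ext_getElem
  · simp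
  · intro i h1 h2
    simp [h1]

/-- Hölder's inequality for the normalized trace of a product of `2 ^ (N + 1)` matrices. The proof
is by induction on `N`: grouping the factors in pairs `Y₀ Y₁` halves their number, and the Schatten
norm of a pair is again the trace of an alternating product, to which the inequality for the smaller
`N` applies. -/
theorem abs_ntr_seqProd_pow_le (N : ℕ) : ∀ Y : ℕ → Matrix n n ℝ,
    |ntr (seqProd Y (2 ^ (N + 1)))| ^ 2 ^ (N + 1) ≤
      ∏ i ∈ Finset.range (2 ^ (N + 1)), schattenPow (2 ^ N) (Y i) := by
  induction N with
  | zero =>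
    intro Y
    have h := sq_ntr_mul_le (Y 0) (Y 1)
    simpa [seqProd, List.range_succ, Finset.prod_range_succ, schattenPow] using h
  | succ N ih =>
    intro Y
    have hpair : ∀ A B : Matrix n n ℝ, schattenPow (2 ^ N) (A * B) ^ 2 ≤
        schattenPow (2 ^ (N + 1)) A * schattenPow (2 ^ (N + 1)) B := by
      intro A B
      set W : ℕ → Matrix n n ℝ := fun i => if i % 2 = 0 then Aᵀ * A else B * Bᵀ with hW
      have hW0 : ∀ i, W (2 * i) = Aᵀ * A := fun i => by simp [hW]
      have hW1 : ∀ i, W (2 * i + 1) = B * Bᵀ := fun i => by simp [hW, Nat.add_mod]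
      have h1 : seqProd W (2 ^ (N + 1)) = ((Aᵀ * A) * (B * Bᵀ)) ^ 2 ^ N := by
        rw [pow_succ', seqProd_two_mul]
        simp only [hW0, hW1]
        exact seqProd_const _ _
      have h2 : ntr (seqProd W (2 ^ (N + 1))) = schattenPow (2 ^ N) (A * B) := by
        rw [h1, schattenPow, Matrix.transpose_mul]
        have : A * B * (Bᵀ * Aᵀ) = A * (B * Bᵀ * Aᵀ) := by simp only [mul_assoc]
        rw [this, ntr_mul_pow_comm A, mul_assoc (B * Bᵀ), ntr_mul_pow_comm (B * Bᵀ)]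
      have h3 := ih W
      rw [h2, pow_succ' 2 N, prod_range_two_mul] at h3
      simp only [hW0, hW1] at h3
      rw [abs_of_nonneg (schattenPow_nonneg _ _), Finset.prod_const, Finset.card_range, pow_mul]
        at h3
      have hA : schattenPow (2 ^ N) (Aᵀ * A) = schattenPow (2 ^ (N + 1)) A := by
        rw [schattenPow, schattenPow, Matrix.transpose_mul, Matrix.transpose_transpose, ← sq,
          ← pow_mul, ← pow_succ', ntr_mul_pow_comm]
      have hB : schattenPow (2 ^ N) (B * Bᵀ) = schattenPow (2 ^ (N + 1)) B := by
        rw [schattenPow, schattenPow, Matrix.transpose_mul, Matrix.transpose_transpose, ← sq,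
          ← pow_mul, ← pow_succ']
      rw [hA, hB] at h3
      exact le_of_pow_le_pow_left₀ (by positivity)
        (mul_nonneg (schattenPow_nonneg _ _) (schattenPow_nonneg _ _)) h3
    have h4 := ih (fun i => Y (2 * i) * Y (2 * i + 1))
    rw [← seqProd_two_mul, ← pow_succ'] at h4
    calc |ntr (seqProd Y (2 ^ (N + 1 + 1)))| ^ 2 ^ (N + 1 + 1)
        = (|ntr (seqProd Y (2 ^ (N + 1 + 1)))| ^ 2 ^ (N + 1)) ^ 2 := by
          rw [← pow_mul, ← pow_succ]
      _ ≤ (∏ i ∈ Finset.range (2 ^ (N + 1)),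
            schattenPow (2 ^ N) (Y (2 * i) * Y (2 * i + 1))) ^ 2 := by gcongr
      _ = ∏ i ∈ Finset.range (2 ^ (N + 1)),
            schattenPow (2 ^ N) (Y (2 * i) * Y (2 * i + 1)) ^ 2 := by rw [Finset.prod_pow]
      _ ≤ ∏ i ∈ Finset.range (2 ^ (N + 1)), (schattenPow (2 ^ (N + 1)) (Y (2 * i)) *
            schattenPow (2 ^ (N + 1)) (Y (2 * i + 1))) :=
          Finset.prod_le_prod (fun i _ => by positivity) fun i _ => hpair _ _
      _ = _ := by
          rw [← prod_range_two_mul (fun i => schattenPow (2 ^ (N + 1)) (Y i)), ← pow_succ']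

/-- The additive form of Hölder's inequality for the normalized trace, for a product of at most
`2 ^ (N + 1)` matrices; missing factors count as identity matrices. -/
theorem abs_ntr_list_prod_le [Nonempty n] (N : ℕ) (l : List (Matrix n n ℝ))
    (hl : l.length ≤ 2 ^ (N + 1)) :
    (2 ^ (N + 1) : ℝ) * |ntr l.prod| ≤
      (l.map (schattenPow (2 ^ N))).sum + (2 ^ (N + 1) - l.length) := by
  set P : ℕ := 2 ^ (N + 1) with hP
  have hP0 : 0 < P := by positivity
  set l' := l ++ List.replicate (P - l.length) (1 : Matrix n n ℝ) with hl'
  have hlen : l'.length = P := by simp [hl']; omega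
  have hprod : l'.prod = l.prod := by simp [hl']
  have hsum : (l'.map (schattenPow (2 ^ N))).sum =
      (l.map (schattenPow (2 ^ N))).sum + (2 ^ (N + 1) - l.length) := by
    simp only [hl', List.map_append, List.map_replicate, schattenPow_one, List.sum_append,
      List.sum_replicate, nsmul_eq_mul, mul_one]
    rw [Nat.cast_sub hl, hP]
    push_cast
    ring
  rw [← hsum, ← hprod]
  set Y : ℕ → Matrix n n ℝ := fun i => l'.getD i 1
  have h1 := abs_ntr_seqProd_pow_le N Y
  have h2 : l'.prod = seqProd Y P := by rw [list_prod_eq_seqProd, hlen]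
  have h3 : (l'.map (schattenPow (2 ^ N))).sum =
      ∑ i ∈ Finset.range P, schattenPow (2 ^ N) (Y i) := by
    have hr : ∑ i ∈ Finset.range P, schattenPow (2 ^ N) (Y i) =
        ((List.range P).map fun i => schattenPow (2 ^ N) (Y i)).sum := rfl
    rw [hr]
    congr 1
    apply List.ext_getElem
    · simp [hlen]
    · intro i hi _
      rw [List.length_map] at hi
      simp [Y, hi]
  rw [← hP, ← h2] at h1
  rw [h3]
  set a := |ntr l'.prod|
  have ha : 0 ≤ a := abs_nonneg _
  have h4 := Real.geom_mean_le_arith_mean_weighted (Finset.range P) (fun _ => (P : ℝ)⁻¹)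
    (fun i => schattenPow (2 ^ N) (Y i)) (fun _ _ => by positivity)
    (by simp [hP0.ne']) (fun _ _ => schattenPow_nonneg _ _)
  rw [Real.finsetProd_rpow _ _ (fun _ _ => schattenPow_nonneg _ _), ← Finset.mul_sum] at h4
  have h5 : a ≤ (∏ i ∈ Finset.range P, schattenPow (2 ^ N) (Y i)) ^ ((P : ℝ)⁻¹) := by
    calc a = (a ^ P) ^ ((P : ℝ)⁻¹) := (Real.pow_rpow_inv_natCast ha hP0.ne').symm
      _ ≤ _ := by gcongr
  have h6 := h5.trans h4
  have h7 : (0 : ℝ) < P := by exact_mod_cast hP0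
  rw [inv_mul_eq_div, le_div_iff₀ h7] at h6
  have h8 : (2 ^ (N + 1) : ℝ) = P := by simp [hP]
  rw [h8]
  linarith

end Schatten

/-! ### Singular values -/

section SingularValues

variable {n : Type*} [Fintype n] [DecidableEq n]

lemma of_orthonormalBasis_transpose_mul_self (b : OrthonormalBasis n ℝ (EuclideanSpace ℝ n)) :
    (Matrix.of fun i j => b j i)ᵀ * (Matrix.of fun i j => b j i) = (1 : Matrix n n ℝ) := by
  ext i j
  have h := orthonormal_iff_ite.mp b.orthonormal j i
  rw [PiLp.inner_apply] at h
  simp only [Matrix.mul_apply, Matrix.transpose_apply, Matrix.of_apply, Matrix.one_apply]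
  simp only [RCLike.inner_apply, conj_trivial] at h
  rw [h]
  simp [eq_comm]

/-- The singular value decomposition of a real square matrix. -/
theorem exists_singularValueDecomposition (Y : Matrix n n ℝ) :
    ∃ (U W : Matrix n n ℝ) (s : n → ℝ), Uᵀ * U = 1 ∧ Wᵀ * W = 1 ∧ (∀ i, 0 ≤ s i) ∧
      Y = U * Matrix.diagonal s * Wᵀ := by
  have hA : (Yᵀ * Y).IsHermitian := by
    simpa using Matrix.isHermitian_conjTranspose_mul_self Y
  set b := hA.eigenvectorBasis
  set lam := hA.eigenvalues
  set y : n → EuclideanSpace ℝ n := fun i => WithLp.toLp 2 (Y *ᵥ (b i).ofLp) with hy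
  have hin : ∀ i j, inner ℝ (y i) (y j) = if i = j then lam j else 0 := by
    intro i j
    have h1 : inner ℝ (y i) (y j) = inner ℝ (b i) (lam j • b j) := by
      have h2 : (Yᵀ * Y) *ᵥ (b j).ofLp = lam j • (b j).ofLp := hA.mulVec_eigenvectorBasis j
      rw [EuclideanSpace.inner_eq_star_dotProduct, EuclideanSpace.inner_eq_star_dotProduct]
      simp only [hy, star_trivial, WithLp.ofLp_smul]
      rw [← h2, ← Matrix.mulVec_mulVec, dotProduct_comm, dotProduct_comm _ (b i).ofLp,
        Matrix.dotProduct_mulVec (b i).ofLp, Matrix.vecMul_transpose]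
    rw [h1, inner_smul_right, orthonormal_iff_ite.mp b.orthonormal i j]
    split_ifs <;> simp
  have hlam : ∀ i, 0 ≤ lam i := by
    intro i
    have := hin i i
    rw [if_pos rfl] at this
    rw [← this]
    exact real_inner_self_nonneg
  set S : Set n := {i | lam i ≠ 0}
  have hort : Orthonormal ℝ (S.domRestrict fun i => (√(lam i))⁻¹ • y i) := by
    rw [orthonormal_iff_ite]
    rintro ⟨i, hi⟩ ⟨j, hj⟩
    have hpos : 0 < lam i := lt_of_le_of_ne (hlam i) (Ne.symm hi)
    simp only [Set.domRestrict_apply, inner_smul_left, inner_smul_right, hin, Subtype.mk.injEq]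
    split_ifs with h
    · subst h
      have h3 : √(lam i) ≠ 0 := (Real.sqrt_pos.mpr hpos).ne'
      have h4 := Real.mul_self_sqrt hpos.le
      simp only [conj_trivial]
      field_simp
      linarith
    · simp
  obtain ⟨c, hc⟩ := hort.exists_orthonormalBasis_extension_of_card_eq (by simp)
  have hyc : ∀ i, y i = √(lam i) • c i := by
    intro i
    by_cases h : lam i = 0
    · have h2 := hin i i
      rw [if_pos rfl, h] at h2
      rw [inner_self_eq_zero.mp h2, h]
      simp
    · have hpos : 0 < lam i := lt_of_le_of_ne (hlam i) (Ne.symm h)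
      rw [hc i h, smul_smul, mul_inv_cancel₀ (Real.sqrt_pos.mpr hpos).ne', one_smul]
  refine ⟨Matrix.of fun i j => c j i, Matrix.of fun i j => b j i, fun i => √(lam i),
    of_orthonormalBasis_transpose_mul_self c, of_orthonormalBasis_transpose_mul_self b,
    fun i => Real.sqrt_nonneg _, ?_⟩
  have hYW : Y * (Matrix.of fun i j => b j i) =
      (Matrix.of fun i j => c j i) * Matrix.diagonal fun i => √(lam i) := by
    ext i j
    have h := congrArg (fun z : EuclideanSpace ℝ n => z.ofLp i) (hyc j)
    simp only [hy, PiLp.smul_apply, smul_eq_mul] at h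
    rw [Matrix.mul_diagonal, Matrix.of_apply, mul_comm, ← h]
    rfl
  rw [← hYW, mul_assoc, mul_eq_one_comm.mp (of_orthonormalBasis_transpose_mul_self b), mul_one]

lemma diagonal_pow_conj {U : Matrix n n ℝ} (hU : Uᵀ * U = 1) (t : n → ℝ) (k : ℕ) :
    (U * Matrix.diagonal t * Uᵀ) ^ k = U * Matrix.diagonal (fun i => t i ^ k) * Uᵀ := by
  induction k with
  | zero =>
    simp [mul_eq_one_comm.mp hU]
  | succ k ih =>
    rw [pow_succ, ih]
    calc U * Matrix.diagonal (fun i => t i ^ k) * Uᵀ * (U * Matrix.diagonal t * Uᵀ)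
        = U * Matrix.diagonal (fun i => t i ^ k) * (Uᵀ * U) * Matrix.diagonal t * Uᵀ := by
          simp only [mul_assoc]
      _ = _ := by
          rw [hU, mul_one, mul_assoc U, Matrix.diagonal_mul_diagonal]
          simp only [pow_succ]

lemma ntr_conj_diagonal {U : Matrix n n ℝ} (hU : Uᵀ * U = 1) (t : n → ℝ) :
    ntr (U * Matrix.diagonal t * Uᵀ) = (∑ i, t i) / Fintype.card n := by
  rw [ntr_mul_comm, ← mul_assoc, hU, one_mul, ntr, Matrix.trace_diagonal]

lemma schattenPow_svd {U W : Matrix n n ℝ} (hU : Uᵀ * U = 1) (hW : Wᵀ * W = 1) (t : n → ℝ)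
    (m : ℕ) : schattenPow m (U * Matrix.diagonal t * Wᵀ) =
      (∑ i, t i ^ (2 * m)) / Fintype.card n := by
  have : (U * Matrix.diagonal t * Wᵀ) * (U * Matrix.diagonal t * Wᵀ)ᵀ =
      U * Matrix.diagonal (fun i => t i ^ 2) * Uᵀ := by
    simp only [Matrix.transpose_mul, Matrix.transpose_transpose, Matrix.diagonal_transpose]
    calc U * Matrix.diagonal t * Wᵀ * (W * (Matrix.diagonal t * Uᵀ))
        = U * Matrix.diagonal t * (Wᵀ * W) * Matrix.diagonal t * Uᵀ := by simp only [mul_assoc]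
      _ = _ := by
          rw [hW, mul_one, mul_assoc U, Matrix.diagonal_mul_diagonal]
          simp only [sq]
  rw [schattenPow, this, diagonal_pow_conj hU, ntr_conj_diagonal hU]
  simp only [← pow_mul]

/-- The matrix `W diag(t ^ (k + 1)) Uᵀ` as a product of `k + 1` matrices with singular values `t`. -/
lemma svd_pow_eq_list_prod {U W : Matrix n n ℝ} (hW : Wᵀ * W = 1) (t : n → ℝ) (k : ℕ) :
    (List.replicate k (W * Matrix.diagonal t * Wᵀ) ++ [W * Matrix.diagonal t * Uᵀ]).prod =
      W * Matrix.diagonal (fun i => t i ^ (k + 1)) * Uᵀ := by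
  rw [List.prod_append, List.prod_replicate, List.prod_singleton, diagonal_pow_conj hW]
  calc W * Matrix.diagonal (fun i => t i ^ k) * Wᵀ * (W * Matrix.diagonal t * Uᵀ)
      = W * Matrix.diagonal (fun i => t i ^ k) * (Wᵀ * W) * Matrix.diagonal t * Uᵀ := by
        simp only [mul_assoc]
    _ = _ := by
        rw [hW, mul_one, mul_assoc W, Matrix.diagonal_mul_diagonal]
        simp only [pow_succ]

lemma ntr_svd_mul_svd {U W : Matrix n n ℝ} (hU : Uᵀ * U = 1) (hW : Wᵀ * W = 1) (s t : n → ℝ) :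
    ntr ((U * Matrix.diagonal s * Wᵀ) * (W * Matrix.diagonal t * Uᵀ)) =
      (∑ i, s i * t i) / Fintype.card n := by
  rw [← ntr_conj_diagonal hU]
  congr 1
  calc U * Matrix.diagonal s * Wᵀ * (W * Matrix.diagonal t * Uᵀ)
      = U * Matrix.diagonal s * (Wᵀ * W) * Matrix.diagonal t * Uᵀ := by simp only [mul_assoc]
    _ = _ := by
        rw [hW, mul_one, mul_assoc U, Matrix.diagonal_mul_diagonal]

/-- A product of `m < 2 ^ (N + 1)` matrices has singular values `t ^ m` with `t` controlled by the
Schatten norms of the factors. This is Hölder's inequality, obtained by pairing the product with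
the matrix that has the singular vectors swapped and singular values `t ^ (2 ^ (N + 1) - m)`. -/
theorem exists_svd_list_prod [Nonempty n] (N : ℕ) (l : List (Matrix n n ℝ))
    (hl : l.length < 2 ^ (N + 1)) :
    ∃ (U W : Matrix n n ℝ) (t : n → ℝ), Uᵀ * U = 1 ∧ Wᵀ * W = 1 ∧ (∀ i, 0 ≤ t i) ∧
      l.prod = U * Matrix.diagonal (fun i => t i ^ l.length) * Wᵀ ∧
      l.length * ((∑ i, t i ^ 2 ^ (N + 1)) / Fintype.card n) ≤
        (l.map (schattenPow (2 ^ N))).sum := by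
  rcases Nat.eq_zero_or_pos l.length with h0 | hpos
  · have : l = [] := List.length_eq_zero_iff.mp h0
    subst this
    exact ⟨1, 1, fun _ => 1, by simp, by simp, fun _ => zero_le_one, by simp, by simp⟩
  obtain ⟨U, W, s, hU, hW, hs, hY⟩ := exists_singularValueDecomposition l.prod
  set m := l.length with hm
  have hst : ∀ i, (s i ^ ((m : ℝ)⁻¹)) ^ m = s i := fun i =>
    Real.rpow_inv_natCast_pow (hs i) hpos.ne'
  set t : n → ℝ := fun i => s i ^ ((m : ℝ)⁻¹) with ht
  have ht0 : ∀ i, 0 ≤ t i := fun i => Real.rpow_nonneg (hs i) _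
  refine ⟨U, W, t, hU, hW, ht0, by rw [hY]; simp only [ht, hst], ?_⟩
  set P := 2 ^ (N + 1) with hP
  obtain ⟨k, hk⟩ : ∃ k, P - m = k + 1 := ⟨P - m - 1, by omega⟩
  -- the complementary product: `P - m` factors whose product has the singular vectors swapped
  set l2 := List.replicate k (W * Matrix.diagonal t * Wᵀ) ++ [W * Matrix.diagonal t * Uᵀ] with hl2
  have h1 := abs_ntr_list_prod_le N (l ++ l2) (by simp [hl2]; omega)
  set A := (∑ i, t i ^ P) / Fintype.card n with hA
  have hA0 : 0 ≤ A :=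
    div_nonneg (Finset.sum_nonneg fun i _ => pow_nonneg (ht0 i) _) (Nat.cast_nonneg _)
  have h2 : ntr (l ++ l2).prod = A := by
    rw [List.prod_append, hl2, svd_pow_eq_list_prod hW, hY, ntr_svd_mul_svd hU hW, hA]
    congr 1
    refine Finset.sum_congr rfl fun i _ => ?_
    rw [← hst i, ← pow_add]
    congr 1
    omega
  have h2m : 2 * 2 ^ N = P := by rw [hP, pow_succ']
  have h3 : ((l ++ l2).map (schattenPow (2 ^ N))).sum =
      (l.map (schattenPow (2 ^ N))).sum + (k + 1) * A := by
    rw [List.map_append, List.sum_append, hl2, List.map_append, List.sum_append, List.map_replicate,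
      List.sum_replicate, schattenPow_svd hW hW, List.map_singleton, List.sum_singleton,
      schattenPow_svd hW hU, h2m, nsmul_eq_mul, hA]
    ring
  have h4 : ((l ++ l2).length : ℝ) = P := by
    rw [List.length_append]
    simp only [hl2, List.length_append, List.length_replicate, List.length_singleton, ← hm]
    norm_cast
    omega
  have h5 : (2 ^ (N + 1) : ℝ) = P := by rw [hP]; push_cast; rfl
  have h6 : (P : ℝ) = m + (k + 1) := by norm_cast; omega
  rw [h2, h3, h4, h5, abs_of_nonneg hA0, sub_self, add_zero, h6] at h1
  linarith

end SingularValues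

/-! ### Random matrices with bounded second moments -/

section SecondMoments

variable {n : Type*} [Fintype n]

/-- `Z` is a random symmetric matrix with square integrable entries such that
`𝔼 ‖Z x‖² ≤ σ ‖x‖²` for all vectors `x`, and the covariance operator of `Z` for the Frobenius
inner product is at most `κ`. Here `σ` and `κ` stand for the squares of the usual parameters. -/
structure HasSecondMomentBounds {V : Type*} [MeasurableSpace V] (μ : Measure V)
    (Z : V → Matrix n n ℝ) (σ κ : ℝ) : Prop where
  memLp : ∀ i j, MemLp (fun v => Z v i j) 2 μ
  symm : ∀ v, (Z v)ᵀ = Z v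
  variance_le : ∀ x : n → ℝ, ∫ v, ∑ i, (Z v *ᵥ x) i ^ 2 ∂μ ≤ σ * ∑ i, x i ^ 2
  covariance_le : ∀ B : Matrix n n ℝ, ∫ v, (Z v * B).trace ^ 2 ∂μ ≤ κ * ∑ i, ∑ j, B i j ^ 2

variable {V : Type*} [MeasurableSpace V] {μ : Measure V} {Z : V → Matrix n n ℝ} {σ κ : ℝ}

lemma memLp_mul_mul_entry (hZ : ∀ i j, MemLp (fun v => Z v i j) 2 μ) (Q R : Matrix n n ℝ)
    (i j : n) : MemLp (fun v => (Q * Z v * R) i j) 2 μ := by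
  simp only [Matrix.mul_apply, Finset.sum_mul]
  exact memLp_finsetSum _ fun k _ => memLp_finsetSum _ fun l _ =>
    ((hZ l k).const_mul (Q i l)).mul_const (R k j)

lemma sum_sq_transpose_mul_mul [DecidableEq n] {Q R : Matrix n n ℝ} (hQ : Qᵀ * Q = 1)
    (hR : Rᵀ * R = 1) (B : Matrix n n ℝ) :
    ∑ i, ∑ j, (R * B * Qᵀ) i j ^ 2 = ∑ i, ∑ j, B i j ^ 2 := by
  rw [← trace_mul_transpose_eq_sum, ← trace_mul_transpose_eq_sum]
  simp only [Matrix.transpose_mul, Matrix.transpose_transpose]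
  calc (R * B * Qᵀ * (Q * (Bᵀ * Rᵀ))).trace = (R * (B * (Qᵀ * Q) * Bᵀ) * Rᵀ).trace := by
        simp only [mul_assoc]
    _ = (Rᵀ * (R * (B * (Qᵀ * Q) * Bᵀ))).trace := Matrix.trace_mul_comm _ _
    _ = _ := by rw [← mul_assoc, hR, hQ, one_mul, mul_one]

lemma HasSecondMomentBounds.sum_integral_sq_entry_le [DecidableEq n]
    (h : HasSecondMomentBounds μ Z σ κ)
    {Q R : Matrix n n ℝ} (hQ : Qᵀ * Q = 1) (hR : Rᵀ * R = 1) (j : n) :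
    ∑ i, ∫ v, (Qᵀ * Z v * R) i j ^ 2 ∂μ ≤ σ := by
  rw [← integral_finsetSum _ fun i _ => (memLp_mul_mul_entry h.memLp Qᵀ R i j).integrable_sq]
  have h1 : ∑ i, R i j ^ 2 = 1 := by
    have := congrFun (congrFun hR j) j
    rw [Matrix.mul_apply, Matrix.one_apply_eq] at this
    simpa [sq] using this
  have h2 := h.variance_le (fun i => R i j)
  rw [h1, mul_one] at h2
  refine le_trans (le_of_eq ?_) h2
  congr 1
  ext v
  have h3 : ∀ i, (Qᵀ * Z v * R) i j = (Qᵀ *ᵥ (Z v *ᵥ fun i => R i j)) i := by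
    intro i
    rw [Matrix.mulVec_mulVec]
    simp [Matrix.mul_apply, Matrix.mulVec, dotProduct]
  simp only [h3]
  set y := Z v *ᵥ fun i => R i j
  have h4 : ∀ z : n → ℝ, ∑ i, z i ^ 2 = z ⬝ᵥ z := fun z => by simp [dotProduct, sq]
  rw [h4, h4, Matrix.dotProduct_mulVec, Matrix.vecMul_transpose, Matrix.mulVec_mulVec,
    mul_eq_one_comm.mp hQ, Matrix.one_mulVec]

lemma HasSecondMomentBounds.sum_integral_sq_entry_le' [DecidableEq n]
    (h : HasSecondMomentBounds μ Z σ κ)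
    {Q R : Matrix n n ℝ} (hQ : Qᵀ * Q = 1) (hR : Rᵀ * R = 1) (i : n) :
    ∑ j, ∫ v, (Qᵀ * Z v * R) i j ^ 2 ∂μ ≤ σ := by
  refine le_trans (le_of_eq ?_) (h.sum_integral_sq_entry_le hR hQ i)
  refine Finset.sum_congr rfl fun j _ => ?_
  congr 1
  ext v
  rw [← Matrix.transpose_apply (Qᵀ * Z v * R)]
  simp only [Matrix.transpose_mul, Matrix.transpose_transpose, h.symm, mul_assoc]

/-- Bessel's inequality for the correlations of a random variable `ξ` with the entries of `Z` in
arbitrary orthonormal bases. -/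
lemma HasSecondMomentBounds.sum_sq_integral_mul_le [DecidableEq n]
    (h : HasSecondMomentBounds μ Z σ κ) (hκ : 0 < κ)
    {Q R : Matrix n n ℝ} (hQ : Qᵀ * Q = 1) (hR : Rᵀ * R = 1) {ξ : V → ℝ} (hξ : MemLp ξ 2 μ) :
    ∑ k, ∑ l, (∫ v, ξ v * (Qᵀ * Z v * R) k l ∂μ) ^ 2 ≤ κ * ∫ v, ξ v ^ 2 ∂μ := by
  set β : Matrix n n ℝ := Matrix.of fun k l => ∫ v, ξ v * (Qᵀ * Z v * R) k l ∂μ with hβ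
  set η : V → ℝ := fun v => (Z v * (R * βᵀ * Qᵀ)).trace with hη
  have hηe : ∀ v, η v = ∑ k, ∑ l, β k l * (Qᵀ * Z v * R) k l := by
    intro v
    have h1 : (Z v * (R * βᵀ * Qᵀ)).trace = ((Qᵀ * Z v * R) * βᵀ).trace := by
      rw [← mul_assoc, Matrix.trace_mul_comm]
      simp only [mul_assoc]
    rw [hη]
    simp only [h1]
    generalize Qᵀ * Z v * R = G
    simp [Matrix.trace, Matrix.mul_apply, mul_comm]
  have hmem := fun k l => memLp_mul_mul_entry h.memLp Qᵀ R k l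
  have hηm : MemLp η 2 μ := by
    have : η = fun v => ∑ k, ∑ l, β k l * (Qᵀ * Z v * R) k l := funext hηe
    rw [this]
    exact memLp_finsetSum _ fun k _ => memLp_finsetSum _ fun l _ => (hmem k l).const_mul _
  have hT : ∫ v, ξ v * η v ∂μ = ∑ k, ∑ l, β k l ^ 2 := by
    have hi : ∀ k l, Integrable (fun v => ξ v * (β k l * (Qᵀ * Z v * R) k l)) μ := fun k l =>
      hξ.integrable_mul ((hmem k l).const_mul _)
    simp only [hηe, Finset.mul_sum]
    rw [integral_finsetSum _ fun k _ => integrable_finsetSum _ fun l _ => hi k l]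
    refine Finset.sum_congr rfl fun k _ => ?_
    rw [integral_finsetSum _ fun l _ => hi k l]
    refine Finset.sum_congr rfl fun l _ => ?_
    have : ∀ v, ξ v * (β k l * (Qᵀ * Z v * R) k l) = β k l * (ξ v * (Qᵀ * Z v * R) k l) :=
      fun v => by ring
    simp only [this]
    rw [integral_const_mul, sq]
    rfl
  have hη2 : ∫ v, η v ^ 2 ∂μ ≤ κ * ∑ k, ∑ l, β k l ^ 2 := by
    have h1 := h.covariance_le (R * βᵀ * Qᵀ)
    rw [sum_sq_transpose_mul_mul hQ hR, Finset.sum_comm] at h1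
    exact h1
  -- expanding `𝔼 (κ ξ - η) ^ 2 ≥ 0`, where `𝔼 ξ η` is the left side and bounds `𝔼 η ^ 2 / κ`
  have hpos : 0 ≤ ∫ v, (κ * ξ v - η v) ^ 2 ∂μ := integral_nonneg fun v => sq_nonneg _
  have hexp : ∫ v, (κ * ξ v - η v) ^ 2 ∂μ =
      κ ^ 2 * ∫ v, ξ v ^ 2 ∂μ - 2 * κ * ∫ v, ξ v * η v ∂μ + ∫ v, η v ^ 2 ∂μ := by
    have : ∀ v, (κ * ξ v - η v) ^ 2 = κ ^ 2 * ξ v ^ 2 - 2 * κ * (ξ v * η v) + η v ^ 2 :=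
      fun v => by ring
    simp only [this]
    have i1 := hξ.integrable_sq.const_mul (κ ^ 2)
    have i2 := (hξ.integrable_mul hηm).const_mul (2 * κ)
    rw [integral_add _ hηm.integrable_sq, integral_sub i1, integral_const_mul, integral_const_mul]
    · exact i2
    · exact i1.sub i2
  rw [hexp, hT] at hpos
  have h5 : κ * (∑ k, ∑ l, β k l ^ 2) ≤ κ * (κ * ∫ v, ξ v ^ 2 ∂μ) := by
    nlinarith
  exact le_of_mul_le_mul_left h5 hκ

end SecondMoments

section Weights

/-- Young's inequality for monomials of degree `P`. -/
lemma mul_prod_pow_le {ι : Type*} [Fintype ι] (t : ι → ℝ) (ht : ∀ i, 0 ≤ t i) (m : ι → ℕ) (P : ℕ)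
    (hP : 0 < P) (hm : ∑ i, m i = P) : P * ∏ i, t i ^ m i ≤ ∑ i, m i * t i ^ P := by
  have hP' : (0 : ℝ) < P := by exact_mod_cast hP
  have h := Real.geom_mean_le_arith_mean_weighted Finset.univ (fun i => (m i : ℝ) / P)
    (fun i => t i ^ P) (fun i _ => by positivity)
    (by rw [← Finset.sum_div, ← Nat.cast_sum, hm, div_self hP'.ne'])
    (fun i _ => pow_nonneg (ht i) _)
  have h1 : ∀ i, (t i ^ P) ^ ((m i : ℝ) / P) = t i ^ m i := by
    intro i
    rw [← Real.rpow_natCast (t i) P, ← Real.rpow_mul (ht i), mul_div_cancel₀ _ hP'.ne',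
      Real.rpow_natCast]
  simp only [h1] at h
  calc (P : ℝ) * ∏ i, t i ^ m i ≤ P * ∑ i, (m i : ℝ) / P * t i ^ P := by gcongr
    _ = _ := by
      rw [Finset.mul_sum]
      refine Finset.sum_congr rfl fun i _ => ?_
      field_simp

lemma mul_pow_mul_pow_le {t u : ℝ} (ht : 0 ≤ t) (hu : 0 ≤ u) {m k P : ℕ} (hP : 0 < P)
    (hm : m + k ≤ P) : (P : ℝ) * (t ^ m * u ^ k) ≤ m * t ^ P + k * u ^ P + (P - m - k) := by
  have h := mul_prod_pow_le ![t, u, 1] (by simp [Fin.forall_fin_succ, ht, hu]) ![m, k, P - m - k] P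
    hP (by simp [Fin.sum_univ_succ]; omega)
  simp only [Fin.prod_univ_succ, Fin.sum_univ_succ] at h
  simp at h
  rw [Nat.sub_sub, Nat.cast_sub hm] at h
  push_cast at h
  linarith

lemma mul_pow_four_le {a b c d : ℝ} (ha : 0 ≤ a) (hb : 0 ≤ b) (hc : 0 ≤ c) (hd : 0 ≤ d)
    {i j k l P : ℕ} (hP : 0 < P) (hm : i + j + k + l ≤ P) :
    (P : ℝ) * (a ^ i * b ^ j * c ^ k * d ^ l) ≤
      i * a ^ P + j * b ^ P + k * c ^ P + l * d ^ P + (P - i - j - k - l) := by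
  have h := mul_prod_pow_le ![a, b, c, d, 1] (by simp [Fin.forall_fin_succ, ha, hb, hc, hd])
    ![i, j, k, l, P - (i + j + k + l)] P hP (by simp [Fin.sum_univ_succ]; omega)
  simp only [Fin.prod_univ_succ, Fin.sum_univ_succ] at h
  simp at h
  rw [Nat.cast_sub hm] at h
  push_cast at h
  linarith

variable {n : Type*} [Fintype n]

/-- A Schur test in four indices: if all sums of `G ≥ 0` over three indices are at most `K`, then
summing `G` against functions of a single index costs at most a factor `K`. -/
lemma sum_four_mul_le (G : n → n → n → n → ℝ) (K : ℝ)
    (h1 : ∀ i, ∑ j, ∑ k, ∑ l, G i j k l ≤ K) (h2 : ∀ j, ∑ i, ∑ k, ∑ l, G i j k l ≤ K)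
    (h3 : ∀ k, ∑ i, ∑ j, ∑ l, G i j k l ≤ K) (h4 : ∀ l, ∑ i, ∑ j, ∑ k, G i j k l ≤ K)
    (a b c d : n → ℝ) (e : ℝ) (ha : ∀ i, 0 ≤ a i) (hb : ∀ i, 0 ≤ b i) (hc : ∀ i, 0 ≤ c i)
    (hd : ∀ i, 0 ≤ d i) (he : 0 ≤ e) :
    ∑ i, ∑ j, ∑ k, ∑ l, (a i + b j + c k + d l + e) * G i j k l ≤
      K * (∑ i, a i + ∑ i, b i + ∑ i, c i + ∑ i, d i + e * Fintype.card n) := by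
  have e1 : ∑ i, ∑ j, ∑ k, ∑ l, a i * G i j k l ≤ ∑ i, a i * K := by
    refine Finset.sum_le_sum fun i _ => ?_
    simp only [← Finset.mul_sum]
    exact mul_le_mul_of_nonneg_left (h1 i) (ha i)
  have e2 : ∑ i, ∑ j, ∑ k, ∑ l, b j * G i j k l ≤ ∑ i, b i * K := by
    rw [Finset.sum_comm]
    refine Finset.sum_le_sum fun i _ => ?_
    simp only [← Finset.mul_sum]
    exact mul_le_mul_of_nonneg_left (h2 i) (hb i)
  have e3 : ∑ i, ∑ j, ∑ k, ∑ l, c k * G i j k l ≤ ∑ i, c i * K := by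
    have : ∑ i, ∑ j, ∑ k, ∑ l, c k * G i j k l = ∑ k, ∑ i, ∑ j, ∑ l, c k * G i j k l := by
      rw [Finset.sum_comm]
      simp_rw [Finset.sum_comm (s := Finset.univ) (t := Finset.univ)
        (f := fun i k => ∑ l, c k * G i _ k l)]
      rw [Finset.sum_comm]
      exact Finset.sum_congr rfl fun k _ => Finset.sum_comm
    rw [this]
    refine Finset.sum_le_sum fun i _ => ?_
    simp only [← Finset.mul_sum]
    exact mul_le_mul_of_nonneg_left (h3 i) (hc i)
  have e4 : ∑ i, ∑ j, ∑ k, ∑ l, d l * G i j k l ≤ ∑ i, d i * K := by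
    have : ∑ i, ∑ j, ∑ k, ∑ l, d l * G i j k l = ∑ l, ∑ i, ∑ j, ∑ k, d l * G i j k l := by
      have s1 : ∀ i j, ∑ k, ∑ l, d l * G i j k l = ∑ l, ∑ k, d l * G i j k l :=
        fun i j => Finset.sum_comm
      have s2 : ∀ i, ∑ j, ∑ l, ∑ k, d l * G i j k l = ∑ l, ∑ j, ∑ k, d l * G i j k l :=
        fun i => Finset.sum_comm
      simp only [s1, s2]
      exact Finset.sum_comm
    rw [this]
    refine Finset.sum_le_sum fun i _ => ?_
    simp only [← Finset.mul_sum]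
    exact mul_le_mul_of_nonneg_left (h4 i) (hd i)
  have e5 : ∑ i, ∑ j, ∑ k, ∑ l, e * G i j k l ≤ ∑ _i : n, e * K := by
    refine Finset.sum_le_sum fun i _ => ?_
    simp only [← Finset.mul_sum]
    exact mul_le_mul_of_nonneg_left (h1 i) he
  simp only [add_mul, Finset.sum_add_distrib]
  have e6 : ∑ _i : n, e * K = K * (e * Fintype.card n) := by
    simp; ring
  rw [e6] at e5
  simp only [← Finset.sum_mul] at e1 e2 e3 e4
  nlinarith

end Weights

/-! ### The contribution of a crossing -/

section Crossing

variable {n : Type*} [Fintype n] [DecidableEq n]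
variable {V : Type*} [MeasurableSpace V] {μ : Measure V} {Z : V → Matrix n n ℝ} {σ κ : ℝ}

/-- The squared correlations of the entries of `Z`, taken in four arbitrary orthonormal bases,
satisfy the hypotheses of the Schur test `sum_four_mul_le` with constant `κ σ`. -/
lemma HasSecondMomentBounds.sum_sq_correlation_le (h : HasSecondMomentBounds μ Z σ κ)
    (hκ : 0 < κ) {Q R Q' R' : Matrix n n ℝ} (hQ : Qᵀ * Q = 1) (hR : Rᵀ * R = 1)
    (hQ' : Q'ᵀ * Q' = 1) (hR' : R'ᵀ * R' = 1) (a b c d : n → ℝ) (e : ℝ)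
    (ha : ∀ i, 0 ≤ a i) (hb : ∀ i, 0 ≤ b i) (hc : ∀ i, 0 ≤ c i)
    (hd : ∀ i, 0 ≤ d i) (he : 0 ≤ e) :
    ∑ i, ∑ j, ∑ k, ∑ l, (a i + b j + c k + d l + e) *
        (∫ v, (Qᵀ * Z v * R) i j * (Q'ᵀ * Z v * R') k l ∂μ) ^ 2 ≤
      κ * σ * (∑ i, a i + ∑ i, b i + ∑ i, c i + ∑ i, d i + e * Fintype.card n) := by
  have hm := fun i j => memLp_mul_mul_entry h.memLp Qᵀ R i j
  have hm' := fun i j => memLp_mul_mul_entry h.memLp Q'ᵀ R' i j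
  have hA : ∀ i j, ∑ k, ∑ l, (∫ v, (Qᵀ * Z v * R) i j * (Q'ᵀ * Z v * R') k l ∂μ) ^ 2 ≤
      κ * ∫ v, (Qᵀ * Z v * R) i j ^ 2 ∂μ := fun i j =>
    h.sum_sq_integral_mul_le hκ hQ' hR' (hm i j)
  have hB : ∀ k l, ∑ i, ∑ j, (∫ v, (Qᵀ * Z v * R) i j * (Q'ᵀ * Z v * R') k l ∂μ) ^ 2 ≤
      κ * ∫ v, (Q'ᵀ * Z v * R') k l ^ 2 ∂μ := by
    intro k l
    have := h.sum_sq_integral_mul_le hκ hQ hR (hm' k l)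
    simpa only [mul_comm] using this
  refine sum_four_mul_le _ (κ * σ) (fun i => ?_) (fun j => ?_) (fun k => ?_) (fun l => ?_)
    a b c d e ha hb hc hd he
  · refine (Finset.sum_le_sum fun j _ => hA i j).trans ?_
    rw [← Finset.mul_sum]
    exact mul_le_mul_of_nonneg_left (h.sum_integral_sq_entry_le' hQ hR i) hκ.le
  · refine (Finset.sum_le_sum fun i _ => hA i j).trans ?_
    rw [← Finset.mul_sum]
    exact mul_le_mul_of_nonneg_left (h.sum_integral_sq_entry_le hQ hR j) hκ.le
  · have : ∀ i, ∑ j, ∑ l, (∫ v, (Qᵀ * Z v * R) i j * (Q'ᵀ * Z v * R') k l ∂μ) ^ 2 =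
        ∑ l, ∑ j, (∫ v, (Qᵀ * Z v * R) i j * (Q'ᵀ * Z v * R') k l ∂μ) ^ 2 :=
      fun i => Finset.sum_comm
    simp only [this]
    rw [Finset.sum_comm]
    refine (Finset.sum_le_sum fun l _ => hB k l).trans ?_
    rw [← Finset.mul_sum]
    exact mul_le_mul_of_nonneg_left (h.sum_integral_sq_entry_le' hQ' hR' k) hκ.le
  · have : ∀ i, ∑ j, ∑ k, (∫ v, (Qᵀ * Z v * R) i j * (Q'ᵀ * Z v * R') k l ∂μ) ^ 2 =
        ∑ k, ∑ j, (∫ v, (Qᵀ * Z v * R) i j * (Q'ᵀ * Z v * R') k l ∂μ) ^ 2 :=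
      fun i => Finset.sum_comm
    simp only [this]
    rw [Finset.sum_comm]
    refine (Finset.sum_le_sum fun k _ => hB k l).trans ?_
    rw [← Finset.mul_sum]
    exact mul_le_mul_of_nonneg_left (h.sum_integral_sq_entry_le hQ' hR' l) hκ.le

lemma trace_four_diagonal (A B C D : Matrix n n ℝ) (a b c d : n → ℝ) :
    (D * Matrix.diagonal a * A * Matrix.diagonal b * B * Matrix.diagonal c * C *
      Matrix.diagonal d).trace =
      ∑ i, ∑ j, ∑ k, ∑ l, (a i * b j * c k * d l) * ((D l i * B j k) * (A i j * C k l)) := by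
  have h1 : (D * Matrix.diagonal a * A * Matrix.diagonal b * B * Matrix.diagonal c * C *
      Matrix.diagonal d).trace = ∑ l, ∑ k, ∑ j, ∑ i,
        (a i * b j * c k * d l) * ((D l i * B j k) * (A i j * C k l)) := by
    simp only [Matrix.trace, Matrix.diag_apply, Matrix.mul_diagonal]
    refine Finset.sum_congr rfl fun l _ => ?_
    rw [Matrix.mul_apply, Finset.sum_mul]
    refine Finset.sum_congr rfl fun k _ => ?_
    rw [Matrix.mul_diagonal, Matrix.mul_apply, Finset.sum_mul, Finset.sum_mul, Finset.sum_mul]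
    refine Finset.sum_congr rfl fun j _ => ?_
    rw [Matrix.mul_diagonal, Matrix.mul_apply]
    simp only [Finset.sum_mul, Matrix.mul_diagonal]
    exact Finset.sum_congr rfl fun i _ => by ring
  rw [h1]
  have s1 : ∀ f : n → n → n → n → ℝ, ∑ l, ∑ k, ∑ j, ∑ i, f i j k l =
      ∑ i, ∑ j, ∑ k, ∑ l, f i j k l := by
    intro f
    have s2 : ∀ l, ∑ k, ∑ j, ∑ i, f i j k l = ∑ i, ∑ j, ∑ k, f i j k l := by
      intro l
      rw [Finset.sum_comm]
      simp_rw [fun j => Finset.sum_comm (s := Finset.univ) (t := Finset.univ)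
        (f := fun k i => f i j k l)]
      exact Finset.sum_comm
    simp only [s2]
    rw [Finset.sum_comm]
    refine Finset.sum_congr rfl fun i _ => ?_
    rw [Finset.sum_comm]
    refine Finset.sum_congr rfl fun j _ => ?_
    exact Finset.sum_comm
  exact s1 _

lemma ntr_four_svd (X Y U₁ W₁ U₂ W₂ U₃ W₃ U₄ W₄ : Matrix n n ℝ) (a b c d : n → ℝ) :
    ntr (X * (U₁ * Matrix.diagonal a * W₁ᵀ) * Y * (U₂ * Matrix.diagonal b * W₂ᵀ) * X *
      (U₃ * Matrix.diagonal c * W₃ᵀ) * Y * (U₄ * Matrix.diagonal d * W₄ᵀ)) =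
      (∑ i, ∑ j, ∑ k, ∑ l, (a i * b j * c k * d l) * (((W₄ᵀ * X * U₁) l i *
        (W₂ᵀ * X * U₃) j k) * ((W₁ᵀ * Y * U₂) i j * (W₃ᵀ * Y * U₄) k l))) / Fintype.card n := by
  rw [← trace_four_diagonal, ntr, ← mul_assoc _ _ W₄ᵀ, Matrix.trace_mul_comm _ W₄ᵀ]
  simp only [mul_assoc]

omit [DecidableEq n] in
lemma integral_sum_four (f : n → n → n → n → V → ℝ) (hf : ∀ i j k l, Integrable (f i j k l) μ) :
    ∫ v, ∑ i, ∑ j, ∑ k, ∑ l, f i j k l v ∂μ = ∑ i, ∑ j, ∑ k, ∑ l, ∫ v, f i j k l v ∂μ := by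
  rw [integral_finsetSum _ fun i _ => integrable_finsetSum _ fun j _ =>
    integrable_finsetSum _ fun k _ => integrable_finsetSum _ fun l _ => hf i j k l]
  refine Finset.sum_congr rfl fun i _ => ?_
  rw [integral_finsetSum _ fun j _ =>
    integrable_finsetSum _ fun k _ => integrable_finsetSum _ fun l _ => hf i j k l]
  refine Finset.sum_congr rfl fun j _ => ?_
  rw [integral_finsetSum _ fun k _ => integrable_finsetSum _ fun l _ => hf i j k l]
  refine Finset.sum_congr rfl fun k _ => ?_
  rw [integral_finsetSum _ fun l _ => hf i j k l]

omit [DecidableEq n] in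
/-- Weighted form of `2 |F G| ≤ F² + G²`, summed over four indices. -/
lemma mul_abs_sum_four_le (D F G : n → n → n → n → ℝ) (hD : ∀ i j k l, 0 ≤ D i j k l)
    (T₁ T₂ T₃ T₄ : n → ℝ) (e K : ℝ) (P : ℕ)
    (hY : ∀ i j k l, P * D i j k l ≤ T₁ i + T₂ j + T₃ k + T₄ l + e)
    (hG : ∑ i, ∑ j, ∑ k, ∑ l, (T₁ i + T₂ j + T₃ k + T₄ l + e) * G i j k l ^ 2 ≤ K)
    (hF : ∑ l, ∑ i, ∑ j, ∑ k, (T₄ l + T₁ i + T₂ j + T₃ k + e) * F l i j k ^ 2 ≤ K) :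
    P * |∑ i, ∑ j, ∑ k, ∑ l, D i j k l * (F l i j k * G i j k l)| ≤ K := by
  have hterm : ∀ i j k l, P * |D i j k l * (F l i j k * G i j k l)| ≤
      ((T₁ i + T₂ j + T₃ k + T₄ l + e) * G i j k l ^ 2) / 2 +
      ((T₄ l + T₁ i + T₂ j + T₃ k + e) * F l i j k ^ 2) / 2 := by
    intro i j k l
    have h1 : |F l i j k * G i j k l| ≤ (F l i j k ^ 2 + G i j k l ^ 2) / 2 := by
      rw [abs_le]
      constructor <;> nlinarith [sq_nonneg (F l i j k - G i j k l),
        sq_nonneg (F l i j k + G i j k l)]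
    have h2 : 0 ≤ P * D i j k l := mul_nonneg (Nat.cast_nonneg _) (hD i j k l)
    have h3 : 0 ≤ (F l i j k ^ 2 + G i j k l ^ 2) / 2 := by positivity
    rw [abs_mul, abs_of_nonneg (hD i j k l), ← mul_assoc]
    calc P * D i j k l * |F l i j k * G i j k l|
        ≤ P * D i j k l * ((F l i j k ^ 2 + G i j k l ^ 2) / 2) := by gcongr
      _ ≤ (T₁ i + T₂ j + T₃ k + T₄ l + e) * ((F l i j k ^ 2 + G i j k l ^ 2) / 2) := by
          gcongr
          exact hY i j k l
      _ = _ := by ring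
  have habs : P * |∑ i, ∑ j, ∑ k, ∑ l, D i j k l * (F l i j k * G i j k l)| ≤
      ∑ i, ∑ j, ∑ k, ∑ l, (((T₁ i + T₂ j + T₃ k + T₄ l + e) * G i j k l ^ 2) / 2 +
      ((T₄ l + T₁ i + T₂ j + T₃ k + e) * F l i j k ^ 2) / 2) := by
    rw [← Nat.abs_cast P, ← abs_mul]
    simp only [Finset.mul_sum]
    refine (Finset.abs_sum_le_sum_abs _ _).trans (Finset.sum_le_sum fun i _ => ?_)
    refine (Finset.abs_sum_le_sum_abs _ _).trans (Finset.sum_le_sum fun j _ => ?_)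
    refine (Finset.abs_sum_le_sum_abs _ _).trans (Finset.sum_le_sum fun k _ => ?_)
    refine (Finset.abs_sum_le_sum_abs _ _).trans (Finset.sum_le_sum fun l _ => ?_)
    rw [abs_mul, Nat.abs_cast]
    exact hterm i j k l
  have s0 : ∀ f : n → n → n → n → ℝ, ∑ i, ∑ j, ∑ k, ∑ l, f l i j k =
      ∑ l, ∑ i, ∑ j, ∑ k, f l i j k := by
    intro f
    have s1 : ∀ i j, ∑ k, ∑ l, f l i j k = ∑ l, ∑ k, f l i j k := fun i j => Finset.sum_comm
    have s2 : ∀ i, ∑ j, ∑ l, ∑ k, f l i j k = ∑ l, ∑ j, ∑ k, f l i j k :=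
      fun i => Finset.sum_comm
    simp only [s1, s2]
    exact Finset.sum_comm
  have hrot := s0 fun l i j k => (T₄ l + T₁ i + T₂ j + T₃ k + e) * F l i j k ^ 2
  rw [← hrot] at hF
  have hsplit : ∀ f g : n → n → n → n → ℝ, ∑ i, ∑ j, ∑ k, ∑ l, (f i j k l / 2 + g i j k l / 2) =
      (∑ i, ∑ j, ∑ k, ∑ l, f i j k l) / 2 + (∑ i, ∑ j, ∑ k, ∑ l, g i j k l) / 2 := by
    intro f g
    simp only [Finset.sum_add_distrib, Finset.sum_div]
  rw [hsplit] at habs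
  linarith

/-- The contribution of a crossing. If `Z, W` are independent with the same law, the expectation of
`τ(Z M₁ W M₂ Z M₃ W M₄)`, where each `Mᵢ` is a product of matrices, is at most `κ σ` times the Young
form of Hölder's bound for the trace of the product of all the factors. -/
theorem HasSecondMomentBounds.abs_crossing_le [Nonempty n] (h : HasSecondMomentBounds μ Z σ κ)
    (hκ : 0 < κ) (N : ℕ) (l₁ l₂ l₃ l₄ : List (Matrix n n ℝ))
    (hl : l₁.length + l₂.length + l₃.length + l₄.length < 2 ^ (N + 1)) :
    (2 ^ (N + 1) : ℝ) * |∫ v, ∫ w, ntr (Z v * l₁.prod * Z w * l₂.prod * Z v * l₃.prod * Z w *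
        l₄.prod) ∂μ ∂μ| ≤
      κ * σ * (((l₁ ++ l₂ ++ l₃ ++ l₄).map (schattenPow (2 ^ N))).sum +
        (2 ^ (N + 1) - (l₁ ++ l₂ ++ l₃ ++ l₄).length)) := by
  obtain ⟨U₁, W₁, t₁, hU₁, hW₁, ht₁, e₁, b₁⟩ := exists_svd_list_prod N l₁ (by omega)
  obtain ⟨U₂, W₂, t₂, hU₂, hW₂, ht₂, e₂, b₂⟩ := exists_svd_list_prod N l₂ (by omega)
  obtain ⟨U₃, W₃, t₃, hU₃, hW₃, ht₃, e₃, b₃⟩ := exists_svd_list_prod N l₃ (by omega)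
  obtain ⟨U₄, W₄, t₄, hU₄, hW₄, ht₄, e₄, b₄⟩ := exists_svd_list_prod N l₄ (by omega)
  set P : ℕ := 2 ^ (N + 1) with hP
  have hP0 : 0 < P := by positivity
  have hPr : (2 ^ (N + 1) : ℝ) = P := by rw [hP]; push_cast; rfl
  set m₁ := l₁.length
  set m₂ := l₂.length
  set m₃ := l₃.length
  set m₄ := l₄.length
  set c : ℝ := (Fintype.card n : ℝ) with hc
  have hc0 : 0 < c := by rw [hc]; exact_mod_cast Fintype.card_pos
  set D : n → n → n → n → ℝ := fun i j k l => t₁ i ^ m₁ * t₂ j ^ m₂ * t₃ k ^ m₃ * t₄ l ^ m₄ with hD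
  have hD0 : ∀ i j k l, 0 ≤ D i j k l := fun i j k l => by
    have := ht₁ i; have := ht₂ j; have := ht₃ k; have := ht₄ l
    positivity
  -- the correlations of the entries of the two copies, in the bases of singular vectors
  set F : n → n → n → n → ℝ := fun l i j k =>
    ∫ v, (W₄ᵀ * Z v * U₁) l i * (W₂ᵀ * Z v * U₃) j k ∂μ with hF
  set G : n → n → n → n → ℝ := fun i j k l =>
    ∫ w, (W₁ᵀ * Z w * U₂) i j * (W₃ᵀ * Z w * U₄) k l ∂μ with hG
  have htr : ∀ v w, ntr (Z v * l₁.prod * Z w * l₂.prod * Z v * l₃.prod * Z w * l₄.prod) =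
      (∑ i, ∑ j, ∑ k, ∑ l, D i j k l * (((W₄ᵀ * Z v * U₁) l i * (W₂ᵀ * Z v * U₃) j k) *
        ((W₁ᵀ * Z w * U₂) i j * (W₃ᵀ * Z w * U₄) k l))) / c := by
    intro v w
    rw [e₁, e₂, e₃, e₄]
    exact ntr_four_svd _ _ _ _ _ _ _ _ _ _ _ _ _ _
  have hint : ∀ (Q R Q' R' : Matrix n n ℝ) (i j k l : n),
      Integrable (fun v => (Q * Z v * R) i j * (Q' * Z v * R') k l) μ := fun Q R Q' R' i j k l =>
    (memLp_mul_mul_entry h.memLp Q R i j).integrable_mul (memLp_mul_mul_entry h.memLp Q' R' k l)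
  have hE : ∫ v, ∫ w, ntr (Z v * l₁.prod * Z w * l₂.prod * Z v * l₃.prod * Z w *
        l₄.prod) ∂μ ∂μ = (∑ i, ∑ j, ∑ k, ∑ l, D i j k l * (F l i j k * G i j k l)) / c := by
    simp only [htr, integral_div]
    congr 1
    have hw : ∀ v, ∫ w, (∑ i, ∑ j, ∑ k, ∑ l, D i j k l *
        (((W₄ᵀ * Z v * U₁) l i * (W₂ᵀ * Z v * U₃) j k) *
        ((W₁ᵀ * Z w * U₂) i j * (W₃ᵀ * Z w * U₄) k l))) ∂μ =
        ∑ i, ∑ j, ∑ k, ∑ l, D i j k l *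
        (((W₄ᵀ * Z v * U₁) l i * (W₂ᵀ * Z v * U₃) j k) * G i j k l) := by
      intro v
      rw [integral_sum_four _ fun i j k l => ((hint _ _ _ _ i j k l).const_mul _).const_mul _]
      simp only [integral_const_mul]
      rfl
    simp only [hw]
    rw [integral_sum_four _ fun i j k l => ((hint _ _ _ _ l i j k).mul_const _).const_mul _]
    simp only [integral_const_mul, integral_mul_const]
    rfl
  rw [hPr, hE]
  set T₁ : n → ℝ := fun i => m₁ * t₁ i ^ P with hT₁
  set T₂ : n → ℝ := fun i => m₂ * t₂ i ^ P with hT₂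
  set T₃ : n → ℝ := fun i => m₃ * t₃ i ^ P with hT₃
  set T₄ : n → ℝ := fun i => m₄ * t₄ i ^ P with hT₄
  have p₁ : ∀ i, 0 ≤ T₁ i := fun i => by have := ht₁ i; positivity
  have p₂ : ∀ i, 0 ≤ T₂ i := fun i => by have := ht₂ i; positivity
  have p₃ : ∀ i, 0 ≤ T₃ i := fun i => by have := ht₃ i; positivity
  have p₄ : ∀ i, 0 ≤ T₄ i := fun i => by have := ht₄ i; positivity
  set e : ℝ := P - m₁ - m₂ - m₃ - m₄ with he
  have he0 : 0 ≤ e := by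
    have : (m₁ + m₂ + m₃ + m₄ : ℝ) ≤ P := by exact_mod_cast hl.le
    rw [he]; linarith
  have hYoung : ∀ i j k l, P * D i j k l ≤ T₁ i + T₂ j + T₃ k + T₄ l + e := fun i j k l =>
    mul_pow_four_le (ht₁ i) (ht₂ j) (ht₃ k) (ht₄ l) hP0 hl.le
  have hsG := h.sum_sq_correlation_le hκ hW₁ hU₂ hW₃ hU₄ T₁ T₂ T₃ T₄ e p₁ p₂ p₃ p₄ he0
  have hsF := h.sum_sq_correlation_le hκ hW₄ hU₁ hW₂ hU₃ T₄ T₁ T₂ T₃ e p₄ p₁ p₂ p₃ he0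
  have hκσ : 0 ≤ κ * σ := by
    obtain ⟨x⟩ := ‹Nonempty n›
    have h1 := h.sum_integral_sq_entry_le hU₁ hU₁ x
    have h2 : 0 ≤ ∑ i, ∫ v, (U₁ᵀ * Z v * U₁) i x ^ 2 ∂μ :=
      Finset.sum_nonneg fun i _ => integral_nonneg fun v => sq_nonneg _
    exact mul_nonneg hκ.le (h2.trans h1)
  have hT : ∀ (m : ℕ) (t : n → ℝ), ∑ i, (m : ℝ) * t i ^ P = c * (m * ((∑ i, t i ^ P) / c)) := by
    intro m t
    rw [← Finset.mul_sum]
    field_simp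
  have hfin : P * |∑ i, ∑ j, ∑ k, ∑ l, D i j k l * (F l i j k * G i j k l)| ≤
      κ * σ * (∑ i, T₁ i + ∑ i, T₂ i + ∑ i, T₃ i + ∑ i, T₄ i + e * c) :=
    mul_abs_sum_four_le D F G hD0 T₁ T₂ T₃ T₄ e _ P hYoung hsG (hsF.trans (le_of_eq (by ring)))
  rw [abs_div, abs_of_pos hc0, mul_div_assoc', div_le_iff₀ hc0]
  refine hfin.trans ?_
  rw [mul_assoc _ _ c]
  refine mul_le_mul_of_nonneg_left ?_ hκσ
  simp only [hT₁, hT₂, hT₃, hT₄, hT, List.map_append, List.sum_append, List.length_append]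
  push_cast
  have : c * (m₁ * ((∑ i, t₁ i ^ P) / c)) + c * (m₂ * ((∑ i, t₂ i ^ P) / c)) +
      c * (m₃ * ((∑ i, t₃ i ^ P) / c)) + c * (m₄ * ((∑ i, t₄ i ^ P) / c)) + e * c =
      ((m₁ * ((∑ i, t₁ i ^ P) / c)) + (m₂ * ((∑ i, t₂ i ^ P) / c)) +
      (m₃ * ((∑ i, t₃ i ^ P) / c)) + (m₄ * ((∑ i, t₄ i ^ P) / c)) + e) * c := by ring
  rw [this]
  refine mul_le_mul_of_nonneg_right ?_ hc0.le
  linarith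

end Crossing

/-! ### Schatten norms by duality, and the scalar recursion -/

section DualBound

variable {n : Type*} [Fintype n] [DecidableEq n]

/-- `DualBound N k F f` says that, with `P = 2 ^ (N + 1)`, the normalized Schatten norm of `F` of
order `P / k` is at most `f`, expressed by duality against products of at most `P - k` matrices
from the unit ball of the normalized Schatten norm of order `P`. -/
def DualBound (N k : ℕ) (F : Matrix n n ℝ) (f : ℝ) : Prop :=
  ∀ l : List (Matrix n n ℝ), l.length + k ≤ 2 ^ (N + 1) →
    (∀ Y ∈ l, schattenPow (2 ^ N) Y ≤ 1) → |ntr (F * l.prod)| ≤ f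

lemma sum_map_schattenPow_le {m : ℕ} {l : List (Matrix n n ℝ)}
    (h : ∀ Y ∈ l, schattenPow m Y ≤ 1) : (l.map (schattenPow m)).sum ≤ l.length := by
  have := List.sum_le_card_nsmul (l.map (schattenPow m)) 1 (by simpa using h)
  simpa using this

lemma DualBound.mono {N k k' : ℕ} {F : Matrix n n ℝ} {f : ℝ} (h : DualBound N k F f)
    (hk : k ≤ k') : DualBound N k' F f := fun l hl hY => h l (by omega) hY

lemma dualBound_one [Nonempty n] (N : ℕ) : DualBound N 0 (1 : Matrix n n ℝ) 1 := by
  intro l hl hY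
  have h1 := abs_ntr_list_prod_le N l (by omega)
  have h2 := sum_map_schattenPow_le hY
  have h3 : (0 : ℝ) < 2 ^ (N + 1) := by positivity
  rw [one_mul]
  nlinarith

/-- The singular values of a matrix with a dual bound: the dual bound is attained by the product
of matrices that has the same singular vectors. -/
lemma DualBound.exists_svd [Nonempty n] {N m : ℕ} {F : Matrix n n ℝ} {f : ℝ}
    (h : DualBound N m F f) (hf : 0 < f) (hm : 1 ≤ m) (hmP : m < 2 ^ (N + 1)) :
    ∃ (U W : Matrix n n ℝ) (t : n → ℝ), Uᵀ * U = 1 ∧ Wᵀ * W = 1 ∧ (∀ i, 0 ≤ t i) ∧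
      F = f • (U * Matrix.diagonal (fun i => t i ^ m) * Wᵀ) ∧
      (∑ i, t i ^ 2 ^ (N + 1)) / Fintype.card n ≤ 1 := by
  obtain ⟨U, W, s, hU, hW, hs, hY⟩ := exists_singularValueDecomposition (f⁻¹ • F)
  have hst : ∀ i, (s i ^ ((m : ℝ)⁻¹)) ^ m = s i := fun i =>
    Real.rpow_inv_natCast_pow (hs i) (by omega)
  set t : n → ℝ := fun i => s i ^ ((m : ℝ)⁻¹) with ht
  have ht0 : ∀ i, 0 ≤ t i := fun i => Real.rpow_nonneg (hs i) _
  have hF : F = f • (U * Matrix.diagonal s * Wᵀ) := by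
    rw [← hY, smul_smul, mul_inv_cancel₀ hf.ne', one_smul]
  refine ⟨U, W, t, hU, hW, ht0, by rw [hF]; simp only [ht, hst], ?_⟩
  set P := 2 ^ (N + 1) with hP
  -- if the average `A` exceeded `1`, the factors with singular values `c * t`, normalized to
  -- Schatten norm `1`, would violate the dual bound
  by_contra! hA
  set A := (∑ i, t i ^ P) / Fintype.card n with hAdef
  have hP0 : P ≠ 0 := by positivity
  have hA0 : 0 < A := by linarith
  set c : ℝ := (A⁻¹) ^ ((P : ℝ)⁻¹) with hc
  have hcP : c ^ P = A⁻¹ := Real.rpow_inv_natCast_pow (by positivity) hP0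
  have hc0 : 0 < c := by positivity
  have hc1 : c < 1 := by
    by_contra! h1
    have h2 : 1 ≤ c ^ P := one_le_pow₀ h1
    rw [hcP] at h2
    exact absurd (inv_lt_one_of_one_lt₀ hA) (not_lt.mpr h2)
  set u : n → ℝ := fun i => c * t i with hu
  obtain ⟨k, hk⟩ : ∃ k, P - m = k + 1 := ⟨P - m - 1, by omega⟩
  set l := List.replicate k (W * Matrix.diagonal u * Wᵀ) ++ [W * Matrix.diagonal u * Uᵀ] with hl
  have h2m : 2 * 2 ^ N = P := by rw [hP, pow_succ']
  have hS : (∑ i, u i ^ P) / Fintype.card n = 1 := by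
    simp only [hu, mul_pow]
    rw [← Finset.mul_sum, mul_div_assoc, ← hAdef, hcP, inv_mul_cancel₀ hA0.ne']
  have h1 := h l (by simp [hl]; omega) (by
    intro Y hYl
    rw [hl, List.mem_append, List.mem_singleton] at hYl
    rcases hYl with h1 | h1
    · rw [(List.mem_replicate.mp h1).2, schattenPow_svd hW hW, h2m, hS]
    · rw [h1, schattenPow_svd hW hU, h2m, hS])
  rw [hl, svd_pow_eq_list_prod hW, hF, Matrix.smul_mul, ntr_smul, ntr_svd_mul_svd hU hW] at h1
  have h3 : (∑ i, s i * u i ^ (k + 1)) / Fintype.card n = c ^ (k + 1) * A := by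
    rw [hAdef, ← mul_div_assoc, Finset.mul_sum]
    congr 1
    refine Finset.sum_congr rfl fun i _ => ?_
    have e : t i ^ P = s i * t i ^ (k + 1) := by
      rw [← hst i, ← pow_add]
      congr 1
      omega
    rw [e]
    simp only [hu, mul_pow]
    ring
  rw [h3, abs_of_pos (by positivity)] at h1
  have h4 : c ^ (k + 1) * A ≤ 1 := by
    have : f * (c ^ (k + 1) * A) ≤ f * 1 := by linarith
    exact le_of_mul_le_mul_left this hf
  have h5 : c ^ m * c ^ (k + 1) * A = 1 := by
    rw [← pow_add, show m + (k + 1) = P by omega, hcP, inv_mul_cancel₀ hA0.ne']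
  have h6 : c ^ m < 1 := pow_lt_one₀ hc0.le hc1 (by omega)
  nlinarith [pow_pos hc0 m]

/-- Submultiplicativity: Hölder's inequality for the Schatten norms of different orders. -/
lemma DualBound.mul [Nonempty n] {N m k : ℕ} {F G : Matrix n n ℝ} {f g : ℝ}
    (hF : DualBound N m F f) (hG : DualBound N k G g) (hf : 0 < f) (hm : 1 ≤ m)
    (hmP : m < 2 ^ (N + 1)) : DualBound N (m + k) (F * G) (f * g) := by
  obtain ⟨U, W, t, hU, hW, ht, hFe, hA⟩ := hF.exists_svd hf hm hmP
  intro l hl hY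
  obtain ⟨q, rfl⟩ : ∃ q, m = q + 1 := ⟨m - 1, by omega⟩
  rw [← svd_pow_eq_list_prod hU] at hFe
  set L := List.replicate q (U * Matrix.diagonal t * Uᵀ) ++ [U * Matrix.diagonal t * Wᵀ] with hL
  have h2m : 2 * 2 ^ N = 2 ^ (N + 1) := by rw [pow_succ']
  have h1 := hG (l ++ L) (by simp [hL]; omega) (by
    intro Y hYl
    rw [List.mem_append] at hYl
    rcases hYl with h0 | h0
    · exact hY Y h0
    · rw [hL, List.mem_append, List.mem_singleton] at h0
      rcases h0 with h1 | h1
      · rw [(List.mem_replicate.mp h1).2, schattenPow_svd hU hU, h2m]; exact hA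
      · rw [h1, schattenPow_svd hU hW, h2m]; exact hA)
  rw [List.prod_append, ← mul_assoc] at h1
  rw [mul_assoc, hFe, Matrix.smul_mul, ntr_smul, ntr_mul_comm, abs_mul, abs_of_pos hf]
  gcongr

end DualBound

section CompletelyPositive

variable {n : Type*} [Fintype n]
variable {V : Type*} [MeasurableSpace V] {μ : Measure V} {Z : V → Matrix n n ℝ} {σ κ : ℝ}

lemma ntr_expMatrix_mul {Y : V → Matrix n n ℝ} (hY : ∀ i j, Integrable (fun v => Y v i j) μ)
    (B : Matrix n n ℝ) : ntr (expMatrix μ Y * B) = ∫ v, ntr (Y v * B) ∂μ := by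
  simp only [ntr, Matrix.trace, Matrix.diag_apply, Matrix.mul_apply, expMatrix, Matrix.of_apply]
  rw [integral_div, integral_finsetSum _ fun i _ => integrable_finsetSum _ fun j _ =>
    (hY i j).mul_const _]
  congr 1
  refine Finset.sum_congr rfl fun i _ => ?_
  rw [integral_finsetSum _ fun j _ => (hY i j).mul_const _]
  exact Finset.sum_congr rfl fun j _ => (integral_mul_const _ _).symm

lemma integrable_mul_mul_self_entry (hZ : ∀ i j, MemLp (fun v => Z v i j) 2 μ)
    (F : Matrix n n ℝ) (i j : n) : Integrable (fun v => (Z v * F * Z v) i j) μ := by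
  simp only [Matrix.mul_apply, Finset.sum_mul]
  exact integrable_finsetSum _ fun k _ => integrable_finsetSum _ fun l _ =>
    ((hZ i l).mul_const (F l k)).integrable_mul (hZ k j)

variable [DecidableEq n]

/-- The map `F ↦ 𝔼 (Z F Z)` has norm at most `σ` for all the Schatten norms. -/
theorem HasSecondMomentBounds.dualBound_expMatrix [Nonempty n]
    (h : HasSecondMomentBounds μ Z σ κ) {N m : ℕ} {F : Matrix n n ℝ} {f : ℝ}
    (hF : DualBound N m F f) (hf : 0 < f) (hm : 1 ≤ m) (hmP : m < 2 ^ (N + 1)) :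
    DualBound N m (expMatrix μ fun v => Z v * F * Z v) (σ * f) := by
  obtain ⟨U, W, t, hU, hW, ht, hFe, hA⟩ := hF.exists_svd hf hm hmP
  intro l hl hY
  obtain ⟨U', W', u, hU', hW', hu, hle, hB⟩ := exists_svd_list_prod N l (by omega)
  have hB' := hB.trans (sum_map_schattenPow_le hY)
  rw [ntr_expMatrix_mul (integrable_mul_mul_self_entry h.memLp F)]
  set P : ℕ := 2 ^ (N + 1) with hP
  set k := l.length
  set c : ℝ := (Fintype.card n : ℝ) with hc
  have hc0 : 0 < c := by rw [hc]; exact_mod_cast Fintype.card_pos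
  have hP0 : (0 : ℝ) < P := by rw [hP]; positivity
  have htr : ∀ v, ntr (Z v * F * Z v * l.prod) = ∑ i, ∑ j, (f / c * (t i ^ m * u j ^ k)) *
      ((W'ᵀ * Z v * U) j i * (Wᵀ * Z v * U') i j) := by
    intro v
    have h1 : (Z v * F * Z v * l.prod).trace = f * ((Wᵀ * Z v * U') *
        Matrix.diagonal (fun j => u j ^ k) * (W'ᵀ * Z v * U) *
          Matrix.diagonal (fun i => t i ^ m)).trace := by
      rw [hFe, hle, Matrix.mul_smul, Matrix.smul_mul, Matrix.smul_mul, Matrix.trace_smul,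
        smul_eq_mul, Matrix.trace_mul_comm]
      congr 1
      have : U' * Matrix.diagonal (fun i => u i ^ k) * W'ᵀ *
          (Z v * (U * Matrix.diagonal (fun i => t i ^ m) * Wᵀ) * Z v) =
          (U' * Matrix.diagonal (fun i => u i ^ k) * W'ᵀ * Z v * U *
            Matrix.diagonal (fun i => t i ^ m)) * (Wᵀ * Z v) := by simp only [mul_assoc]
      rw [this, Matrix.trace_mul_comm]
      simp only [mul_assoc]
    rw [ntr, h1, Matrix.trace, Finset.mul_sum, Finset.sum_div]
    refine Finset.sum_congr rfl fun i _ => ?_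
    rw [Matrix.diag_apply, Matrix.mul_diagonal, Matrix.mul_apply, Finset.sum_mul, Finset.mul_sum,
      Finset.sum_div]
    refine Finset.sum_congr rfl fun j _ => ?_
    rw [Matrix.mul_diagonal]
    ring
  have hm1 := fun i j => memLp_mul_mul_entry h.memLp W'ᵀ U i j
  have hm2 := fun i j => memLp_mul_mul_entry h.memLp Wᵀ U' i j
  simp only [htr]
  have hint : ∀ i j, Integrable (fun v => (f / c * (t i ^ m * u j ^ k)) *
      ((W'ᵀ * Z v * U) j i * (Wᵀ * Z v * U') i j)) μ := fun i j =>
    ((hm1 j i).integrable_mul (hm2 i j)).const_mul _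
  rw [integral_finsetSum _ fun i _ => integrable_finsetSum _ fun j _ => hint i j]
  have hterm : ∀ i j, |∫ v, (f / c * (t i ^ m * u j ^ k)) *
      ((W'ᵀ * Z v * U) j i * (Wᵀ * Z v * U') i j) ∂μ| ≤
      f / c / P * ((m * t i ^ P + k * u j ^ P + (P - m - k)) *
        ((∫ v, (W'ᵀ * Z v * U) j i ^ 2 ∂μ + ∫ v, (Wᵀ * Z v * U') i j ^ 2 ∂μ) / 2)) := by
    intro i j
    have h1 : |∫ v, (W'ᵀ * Z v * U) j i * (Wᵀ * Z v * U') i j ∂μ| ≤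
        (∫ v, (W'ᵀ * Z v * U) j i ^ 2 ∂μ + ∫ v, (Wᵀ * Z v * U') i j ^ 2 ∂μ) / 2 := by
      rw [← integral_add (hm1 j i).integrable_sq (hm2 i j).integrable_sq, ← integral_div]
      refine abs_integral_le_integral_abs.trans ?_
      refine integral_mono ((hm1 j i).integrable_mul (hm2 i j)).abs
        (((hm1 j i).integrable_sq.add (hm2 i j).integrable_sq).div_const 2) fun v => ?_
      refine abs_le.mpr ⟨?_, ?_⟩ <;>
        nlinarith [sq_nonneg ((W'ᵀ * Z v * U) j i - (Wᵀ * Z v * U') i j),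
        sq_nonneg ((W'ᵀ * Z v * U) j i + (Wᵀ * Z v * U') i j)]
    have h2 : t i ^ m * u j ^ k ≤ (m * t i ^ P + k * u j ^ P + (P - m - k)) / P := by
      rw [le_div_iff₀ hP0, mul_comm]
      exact mul_pow_mul_pow_le (ht i) (hu j) (by rw [hP]; positivity) (by omega)
    have h0 : 0 ≤ t i ^ m * u j ^ k := mul_nonneg (pow_nonneg (ht i) _) (pow_nonneg (hu j) _)
    rw [integral_const_mul, abs_mul, abs_of_nonneg (by positivity)]
    calc f / c * (t i ^ m * u j ^ k) * |∫ v, (W'ᵀ * Z v * U) j i * (Wᵀ * Z v * U') i j ∂μ|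
        ≤ f / c * ((m * t i ^ P + k * u j ^ P + (P - m - k)) / P) *
          ((∫ v, (W'ᵀ * Z v * U) j i ^ 2 ∂μ + ∫ v, (Wᵀ * Z v * U') i j ^ 2 ∂μ) / 2) := by
          have h3 := h0.trans h2
          have h4 : 0 ≤ f / c := by positivity
          gcongr
      _ = _ := by ring
  have hsum : ∑ i, ∑ j, (m * t i ^ P + k * u j ^ P + (P - m - k)) *
        ((∫ v, (W'ᵀ * Z v * U) j i ^ 2 ∂μ + ∫ v, (Wᵀ * Z v * U') i j ^ 2 ∂μ) / 2) ≤
        σ * (m * ∑ i, t i ^ P + k * ∑ j, u j ^ P + (P - m - k) * c) := by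
    set K : n → n → ℝ := fun i j =>
      (∫ v, (W'ᵀ * Z v * U) j i ^ 2 ∂μ + ∫ v, (Wᵀ * Z v * U') i j ^ 2 ∂μ) / 2 with hK
    have hr : ∀ i, ∑ j, K i j ≤ σ := by
      intro i
      have h1 := h.sum_integral_sq_entry_le hW' hU i
      have h2 := h.sum_integral_sq_entry_le' hW hU' i
      simp only [hK]
      rw [← Finset.sum_div, Finset.sum_add_distrib]
      linarith
    have hcol : ∀ j, ∑ i, K i j ≤ σ := by
      intro j
      have h1 := h.sum_integral_sq_entry_le' hW' hU j
      have h2 := h.sum_integral_sq_entry_le hW hU' j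
      simp only [hK]
      rw [← Finset.sum_div, Finset.sum_add_distrib]
      linarith
    have e1 : ∑ i, ∑ j, (m * t i ^ P) * K i j ≤ ∑ i, (m * t i ^ P) * σ := by
      refine Finset.sum_le_sum fun i _ => ?_
      rw [← Finset.mul_sum]
      exact mul_le_mul_of_nonneg_left (hr i) (by have := ht i; positivity)
    have e2 : ∑ i, ∑ j, (k * u j ^ P) * K i j ≤ ∑ j, (k * u j ^ P) * σ := by
      rw [Finset.sum_comm]
      refine Finset.sum_le_sum fun j _ => ?_
      rw [← Finset.mul_sum]
      exact mul_le_mul_of_nonneg_left (hcol j) (by have := hu j; positivity)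
    have e3 : ∑ i, ∑ j, (P - m - k : ℝ) * K i j ≤ ∑ _i : n, (P - m - k : ℝ) * σ := by
      refine Finset.sum_le_sum fun i _ => ?_
      rw [← Finset.mul_sum]
      refine mul_le_mul_of_nonneg_left (hr i) ?_
      have : (k + m : ℝ) ≤ P := by exact_mod_cast hl
      linarith
    have e4 : ∑ i, ∑ j, (m * t i ^ P + k * u j ^ P + (P - m - k)) * K i j =
        ∑ i, ∑ j, (m * t i ^ P) * K i j + ∑ i, ∑ j, (k * u j ^ P) * K i j +
          ∑ i, ∑ j, (P - m - k : ℝ) * K i j := by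
      simp only [add_mul, Finset.sum_add_distrib]
    have e5 : ∑ _i : n, (P - m - k : ℝ) * σ = σ * ((P - m - k) * c) := by
      simp [hc]; ring
    rw [e4]
    rw [e5] at e3
    rw [← Finset.sum_mul, ← Finset.mul_sum] at e1 e2
    linarith
  calc |∑ i, ∫ v, ∑ j, (f / c * (t i ^ m * u j ^ k)) *
      ((W'ᵀ * Z v * U) j i * (Wᵀ * Z v * U') i j) ∂μ|
      ≤ ∑ i, ∑ j, f / c / P * ((m * t i ^ P + k * u j ^ P + (P - m - k)) *
        ((∫ v, (W'ᵀ * Z v * U) j i ^ 2 ∂μ + ∫ v, (Wᵀ * Z v * U') i j ^ 2 ∂μ) / 2)) := by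
        refine (Finset.abs_sum_le_sum_abs _ _).trans (Finset.sum_le_sum fun i _ => ?_)
        rw [integral_finsetSum _ fun j _ => hint i j]
        exact (Finset.abs_sum_le_sum_abs _ _).trans (Finset.sum_le_sum fun j _ => hterm i j)
    _ = f / c / P * ∑ i, ∑ j, ((m * t i ^ P + k * u j ^ P + (P - m - k)) *
        ((∫ v, (W'ᵀ * Z v * U) j i ^ 2 ∂μ + ∫ v, (Wᵀ * Z v * U') i j ^ 2 ∂μ) / 2)) := by
        simp only [Finset.mul_sum]
    _ ≤ f / c / P * (σ * (m * ∑ i, t i ^ P + k * ∑ j, u j ^ P + (P - m - k) * c)) := by gcongr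
    _ ≤ f / c / P * (σ * (P * c)) := by
        have hσ : 0 ≤ σ := by
          obtain ⟨x⟩ := ‹Nonempty n›
          exact (Finset.sum_nonneg fun i _ => integral_nonneg fun v => sq_nonneg _).trans
            (h.sum_integral_sq_entry_le hU hU x)
        have h1 : ∑ i, t i ^ P ≤ c := by rwa [div_le_one hc0] at hA
        have h2 : k * ∑ i, u i ^ P ≤ k * c := by
          rwa [mul_div_assoc', div_le_iff₀ hc0] at hB'
        gcongr
        nlinarith [mul_le_mul_of_nonneg_left h1 (Nat.cast_nonneg m : (0 : ℝ) ≤ m)]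
    _ = σ * f := by
        field_simp

end CompletelyPositive

section Recursion

/-- The majorant of the normalized moments: the recursion of the Catalan numbers, scaled by `r`,
with an additional error `δ` at each step. -/
noncomputable def momentMajorant (r δ : ℝ) : ℕ → ℝ
  | 0 => 1
  | 1 => δ
  | k + 2 => r * ∑ j : Fin (k + 1), momentMajorant r δ j * momentMajorant r δ (k - j) + δ

lemma momentMajorant_add_two (r δ : ℝ) (k : ℕ) : momentMajorant r δ (k + 2) =
    r * ∑ j ∈ Finset.range (k + 1), momentMajorant r δ j * momentMajorant r δ (k - j) + δ := by
  rw [momentMajorant, Finset.sum_range]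

lemma momentMajorant_pos {r δ : ℝ} (hr : 0 ≤ r) (hδ : 0 < δ) (k : ℕ) :
    0 < momentMajorant r δ k := by
  induction k using Nat.strong_induction_on with
  | _ k ih =>
    match k, ih with
    | 0, _ => simp [momentMajorant]
    | 1, _ => simpa [momentMajorant] using hδ
    | k + 2, ih =>
      rw [momentMajorant_add_two]
      have : 0 ≤ ∑ j ∈ Finset.range (k + 1), momentMajorant r δ j * momentMajorant r δ (k - j) :=
        Finset.sum_nonneg fun j hj => by
          rw [Finset.mem_range] at hj
          exact mul_nonneg (ih j (by omega)).le (ih (k - j) (by omega)).le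
      positivity

lemma sum_range_sum_range_sub_le (x : ℕ → ℝ) (hx : ∀ k, 0 ≤ x k) (K : ℕ) :
    ∑ k ∈ Finset.range K, ∑ j ∈ Finset.range (k + 1), x j * x (k - j) ≤
      (∑ k ∈ Finset.range K, x k) ^ 2 := by
  have h1 : ∑ k ∈ Finset.range K, ∑ j ∈ Finset.range (k + 1), x j * x (k - j) =
      ∑ j ∈ Finset.range K, ∑ k ∈ Finset.Ico j K, x j * x (k - j) := by
    simp only [Finset.range_eq_Ico]
    exact (Finset.sum_Ico_Ico_comm 0 K fun j k => x j * x (k - j)).symm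
  rw [h1, sq, Finset.sum_mul]
  refine Finset.sum_le_sum fun j _ => ?_
  rw [← Finset.mul_sum]
  refine mul_le_mul_of_nonneg_left ?_ (hx j)
  rw [Finset.sum_Ico_eq_sum_range]
  have : ∀ k, x (j + k - j) = x k := fun k => by rw [Nat.add_sub_cancel_left]
  simp only [this]
  exact Finset.sum_le_sum_of_subset_of_nonneg (Finset.range_mono (by omega)) fun _ _ _ => hx _

lemma sum_momentMajorant_le {r δ : ℝ} (hr : 0 ≤ r) (hr' : r ≤ 1 / 16) (hδ : 0 < δ) (K : ℕ)
    (hK : K * δ ≤ 1 / 2) : ∑ k ∈ Finset.range (K + 1), momentMajorant r δ k ≤ 2 := by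
  induction K using Nat.strong_induction_on with
  | _ K ih =>
    match K, ih, hK with
    | 0, _, _ => simp [momentMajorant]
    | 1, _, hK =>
      simp [Finset.sum_range_succ, momentMajorant] at hK ⊢
      linarith
    | K + 2, ih, hK =>
      have h1 := ih K (by omega) (by push_cast at hK; nlinarith)
      have h0 : 0 ≤ ∑ k ∈ Finset.range (K + 1), momentMajorant r δ k :=
        Finset.sum_nonneg fun k _ => (momentMajorant_pos hr hδ k).le
      have h2 := sum_range_sum_range_sub_le (momentMajorant r δ)
        (fun k => (momentMajorant_pos hr hδ k).le) (K + 1)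
      rw [Finset.sum_range_succ', Finset.sum_range_succ']
      simp only [momentMajorant_add_two, Finset.sum_add_distrib, ← Finset.mul_sum]
      simp only [zero_add, Finset.sum_const, Finset.card_range, nsmul_eq_mul]
      have e0 : momentMajorant r δ 0 = 1 := by simp [momentMajorant]
      have e1 : momentMajorant r δ 1 = δ := by simp [momentMajorant]
      rw [e0, e1]
      push_cast at hK ⊢
      have h3 : r * ∑ k ∈ Finset.range (K + 1), ∑ j ∈ Finset.range (k + 1),
          momentMajorant r δ j * momentMajorant r δ (k - j) ≤ 1 / 16 * 2 ^ 2 := by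
        calc _ ≤ r * (∑ k ∈ Finset.range (K + 1), momentMajorant r δ k) ^ 2 := by gcongr
          _ ≤ _ := by gcongr
      linarith

/-- Since all terms of the majorant up to order `P` sum to at most `2`, the last one is less
than `1`. -/
lemma momentMajorant_lt_one {r δ : ℝ} (hr : 0 ≤ r) (hr' : r ≤ 1 / 16) (hδ : 0 < δ) (P : ℕ)
    (hP2 : 2 ≤ P) (hP : P * δ ≤ 1 / 2) : momentMajorant r δ P < 1 := by
  obtain ⟨K, rfl⟩ : ∃ K, P = K + 2 := ⟨P - 2, by omega⟩
  rw [momentMajorant_add_two]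
  push_cast at hP
  have hK : (K : ℝ) * δ ≤ 1 / 2 := by nlinarith
  have hx := fun k => (momentMajorant_pos hr hδ k).le
  have h1 := sum_momentMajorant_le hr hr' hδ K hK
  have h0 : 0 ≤ ∑ k ∈ Finset.range (K + 1), momentMajorant r δ k :=
    Finset.sum_nonneg fun k _ => hx k
  have h2 : ∑ j ∈ Finset.range (K + 1), momentMajorant r δ j * momentMajorant r δ (K - j) ≤
      2 ^ 2 := by
    refine le_trans ?_ (pow_le_pow_left₀ h0 h1 2)
    refine le_trans ?_ (sum_range_sum_range_sub_le _ hx (K + 1))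
    exact Finset.single_le_sum (f := fun k => ∑ j ∈ Finset.range (k + 1),
      momentMajorant r δ j * momentMajorant r δ (k - j))
      (fun k _ => Finset.sum_nonneg fun j _ => mul_nonneg (hx _) (hx _))
      (Finset.mem_range.mpr (Nat.lt_succ_self K))
  have h3 : 0 ≤ (K : ℝ) * δ := by positivity
  nlinarith

end Recursion

/-! ### Functions of polynomial growth under a Gaussian measure -/

section PolynomialGrowth

variable {E F G : Type*} [NormedAddCommGroup E] [NormedAddCommGroup F] [NormedAddCommGroup G]

/-- A continuous map bounded by a polynomial in the norm. -/
def PolyGrowth (f : E → F) : Prop :=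
  Continuous f ∧ ∃ (C : ℝ) (k : ℕ), 0 ≤ C ∧ ∀ x, ‖f x‖ ≤ C * (1 + ‖x‖) ^ k

lemma PolyGrowth.of_le {f : E → F} (hf : Continuous f) {g : E → G} (hg : PolyGrowth g)
    (C : ℝ) (hC : 0 ≤ C) (h : ∀ x, ‖f x‖ ≤ C * ‖g x‖) : PolyGrowth f := by
  obtain ⟨-, D, k, hD, hk⟩ := hg
  refine ⟨hf, C * D, k, by positivity, fun x => (h x).trans ?_⟩
  rw [mul_assoc]
  exact mul_le_mul_of_nonneg_left (hk x) hC

lemma PolyGrowth.const (c : F) : PolyGrowth fun _ : E => c :=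
  ⟨continuous_const, ‖c‖, 0, norm_nonneg _, fun x => by simp⟩

lemma PolyGrowth.id : PolyGrowth fun x : E => x :=
  ⟨continuous_id, 1, 1, zero_le_one, fun x => by simp⟩

lemma PolyGrowth.add {f g : E → F} (hf : PolyGrowth f) (hg : PolyGrowth g) :
    PolyGrowth fun x => f x + g x := by
  obtain ⟨cf, C, k, hC, hk⟩ := hf
  obtain ⟨cg, D, l, hD, hl⟩ := hg
  refine ⟨cf.add cg, C + D, k + l, by positivity, fun x => (norm_add_le _ _).trans ?_⟩
  have h1 : 1 ≤ 1 + ‖x‖ := by linarith [norm_nonneg x]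
  have h2 : (1 + ‖x‖) ^ k ≤ (1 + ‖x‖) ^ (k + l) := pow_le_pow_right₀ h1 (by omega)
  have h3 : (1 + ‖x‖) ^ l ≤ (1 + ‖x‖) ^ (k + l) := pow_le_pow_right₀ h1 (by omega)
  nlinarith [hk x, hl x, mul_le_mul_of_nonneg_left h2 hC, mul_le_mul_of_nonneg_left h3 hD]

lemma PolyGrowth.sum {ι : Type*} (s : Finset ι) {f : ι → E → F} (hf : ∀ i ∈ s, PolyGrowth (f i)) :
    PolyGrowth fun x => ∑ i ∈ s, f i x := by
  classical
  induction s using Finset.induction_on with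
  | empty => simpa using PolyGrowth.const (E := E) (0 : F)
  | insert a s ha ih =>
    simp only [Finset.sum_insert ha]
    exact (hf a (Finset.mem_insert_self _ _)).add
      (ih fun i hi => hf i (Finset.mem_insert_of_mem hi))

lemma PolyGrowth.mul_bound {H : Type*} [NormedAddCommGroup H] {f : E → F} {g : E → G} {h : E → H}
    (hf : PolyGrowth f) (hg : PolyGrowth g) (hc : Continuous h)
    (hle : ∀ x, ‖h x‖ ≤ ‖f x‖ * ‖g x‖) : PolyGrowth h := by
  obtain ⟨cf, C, k, hC, hk⟩ := hf
  obtain ⟨cg, D, l, hD, hl⟩ := hg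
  refine ⟨hc, C * D, k + l, by positivity, fun x => (hle x).trans ?_⟩
  calc ‖f x‖ * ‖g x‖ ≤ (C * (1 + ‖x‖) ^ k) * (D * (1 + ‖x‖) ^ l) :=
        mul_le_mul (hk x) (hl x) (norm_nonneg _) (by positivity)
    _ = _ := by ring

lemma PolyGrowth.mul {R : Type*} [NormedRing R] {f g : E → R} (hf : PolyGrowth f)
    (hg : PolyGrowth g) : PolyGrowth fun x => f x * g x :=
  hf.mul_bound hg (hf.1.mul hg.1) fun _ => norm_mul_le _ _

lemma PolyGrowth.smul [NormedSpace ℝ F] {f : E → ℝ} {g : E → F} (hf : PolyGrowth f)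
    (hg : PolyGrowth g) : PolyGrowth fun x => f x • g x :=
  hf.mul_bound hg (hf.1.smul hg.1) fun _ => (norm_smul _ _).le

lemma PolyGrowth.pow {R : Type*} [NormedRing R] {f : E → R} (hf : PolyGrowth f)
    (k : ℕ) : PolyGrowth fun x => f x ^ k := by
  induction k with
  | zero => simpa using PolyGrowth.const (E := E) (1 : R)
  | succ k ih => simpa only [pow_succ] using ih.mul hf

lemma PolyGrowth.comp {f : F → G} (hf : PolyGrowth f) {g : E → F} (hg : PolyGrowth g) :
    PolyGrowth fun x => f (g x) := by
  obtain ⟨cf, C, k, hC, hk⟩ := hf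
  obtain ⟨cg, D, l, hD, hl⟩ := hg
  refine ⟨cf.comp cg, C * (1 + D) ^ k, l * k, by positivity, fun x => (hk _).trans ?_⟩
  have h1 : 1 ≤ (1 + ‖x‖) ^ l := one_le_pow₀ (by linarith [norm_nonneg x])
  rw [mul_assoc, pow_mul, ← mul_pow]
  gcongr
  nlinarith [hl x]

lemma PolyGrowth.clm [NormedSpace ℝ E] [NormedSpace ℝ F] (L : E →L[ℝ] F) :
    PolyGrowth fun x => L x :=
  PolyGrowth.id.of_le L.continuous ‖L‖ (norm_nonneg _) L.le_opNorm

lemma PolyGrowth.clm_comp [NormedSpace ℝ F] [NormedSpace ℝ G] (L : F →L[ℝ] G) {f : E → F}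
    (hf : PolyGrowth f) : PolyGrowth fun x => L (f x) :=
  (PolyGrowth.clm L).comp hf

lemma PolyGrowth.fst : PolyGrowth fun p : E × F => p.1 :=
  PolyGrowth.id.of_le continuous_fst 1 zero_le_one fun p => by
    rw [one_mul]; exact norm_fst_le p

lemma PolyGrowth.snd : PolyGrowth fun p : E × F => p.2 :=
  PolyGrowth.id.of_le continuous_snd 1 zero_le_one fun p => by
    rw [one_mul]; exact norm_snd_le p

lemma PolyGrowth.norm {f : E → F} (hf : PolyGrowth f) : PolyGrowth fun x => ‖f x‖ :=
  hf.of_le hf.1.norm 1 zero_le_one fun x => by simp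

lemma polyGrowth_cos : PolyGrowth Real.cos :=
  (PolyGrowth.const (1 : ℝ)).of_le Real.continuous_cos 1 zero_le_one fun x => by
    simpa using Real.abs_cos_le_one x

lemma polyGrowth_sin : PolyGrowth Real.sin :=
  (PolyGrowth.const (1 : ℝ)).of_le Real.continuous_sin 1 zero_le_one fun x => by
    simpa using Real.abs_sin_le_one x

variable [NormedSpace ℝ E] [MeasurableSpace E] [BorelSpace E] [CompleteSpace E]
  [SecondCountableTopology E] {ν : Measure E} [IsGaussian ν]

lemma PolyGrowth.integrable {f : E → F} (hf : PolyGrowth f) : Integrable f ν := by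
  obtain ⟨cf, C, k, hC, hk⟩ := hf
  have h1 : Integrable (fun x : E => ‖x‖ ^ k) ν := by
    rcases Nat.eq_zero_or_pos k with rfl | hk0
    · simp
    · exact (IsGaussian.memLp_id ν k (by simp)).integrable_norm_pow (by omega)
  have h2 : Integrable (fun x : E => C * (2 ^ k * (1 + ‖x‖ ^ k))) ν :=
    (((integrable_const (1 : ℝ)).add h1).const_mul _).const_mul _
  refine h2.mono' cf.aestronglyMeasurable (Filter.Eventually.of_forall fun x => (hk x).trans ?_)
  gcongr
  have h3 : 1 + ‖x‖ ≤ 2 * max 1 ‖x‖ := by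
    have := le_max_left 1 ‖x‖
    have := le_max_right 1 ‖x‖
    linarith
  calc (1 + ‖x‖) ^ k ≤ (2 * max 1 ‖x‖) ^ k := by gcongr
    _ = 2 ^ k * (max 1 ‖x‖) ^ k := mul_pow _ _ _
    _ ≤ 2 ^ k * (1 + ‖x‖ ^ k) := by
      gcongr
      rcases max_choice 1 ‖x‖ with h | h <;> rw [h]
      · simp
      · linarith

lemma PolyGrowth.memLp_two {f : E → ℝ} (hf : PolyGrowth f) : MemLp f 2 ν :=
  (memLp_two_iff_integrable_sq hf.1.aestronglyMeasurable).mpr (hf.pow 2).integrable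

/-- Differentiation under a Gaussian expectation, for functions of polynomial growth. -/
lemma hasDerivAt_integral_of_polyGrowth {H H' : ℝ × E → ℝ} (hH : PolyGrowth H)
    (hH' : PolyGrowth H')
    (hd : ∀ x θ, HasDerivAt (fun θ => H (θ, x)) (H' (θ, x)) θ) (θ : ℝ) :
    HasDerivAt (fun θ => ∫ x, H (θ, x) ∂ν) (∫ x, H' (θ, x) ∂ν) θ := by
  obtain ⟨cH', C, k, hC, hk⟩ := id hH'
  have hslice : ∀ {f : ℝ × E → ℝ}, PolyGrowth f → ∀ θ, PolyGrowth fun x => f (θ, x) := by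
    intro f hf θ
    refine hf.comp (g := fun x : E => (θ, x)) ?_
    refine ((PolyGrowth.const |θ|).add PolyGrowth.id.norm).of_le (by fun_prop) 1 zero_le_one ?_
    intro x
    rw [one_mul, Prod.norm_def, Real.norm_eq_abs, Real.norm_eq_abs,
      abs_of_nonneg (by positivity : (0 : ℝ) ≤ |θ| + ‖x‖)]
    exact max_le (by linarith [norm_nonneg x]) (by linarith [abs_nonneg θ])
  have hb : PolyGrowth fun x : E => C * (1 + (|θ| + 1 + ‖x‖)) ^ k :=
    (PolyGrowth.const C).mul (((PolyGrowth.const 1).add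
      ((PolyGrowth.const (|θ| + 1)).add PolyGrowth.id.norm)).pow k)
  refine (hasDerivAt_integral_of_dominated_loc_of_deriv_le (Metric.ball_mem_nhds θ one_pos)
    (Filter.Eventually.of_forall fun η => (hslice hH η).1.aestronglyMeasurable)
    (hslice hH θ).integrable (hslice hH' θ).1.aestronglyMeasurable
    (Filter.Eventually.of_forall fun x η hη => ?_) hb.integrable
    (Filter.Eventually.of_forall fun x η _ => hd x η)).2
  refine (hk (η, x)).trans ?_
  gcongr
  rw [Metric.mem_ball, Real.dist_eq] at hη
  rw [Prod.norm_def]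
  have h2 : |η| ≤ |θ| + 1 := by
    have := abs_add_le (η - θ) θ
    rw [sub_add_cancel] at this
    linarith
  exact max_le (by rw [Real.norm_eq_abs]; linarith [norm_nonneg x])
    (by linarith [abs_nonneg θ])

/-- Two independent copies of a centered Gaussian vector are jointly invariant under rotations. -/
lemma integral_rotation (hν : ∫ x, id x ∂ν = 0) (θ : ℝ) {f : E × E → ℝ} (hf : Continuous f) :
    ∫ p, f (Real.cos θ • p.1 + Real.sin θ • p.2, -Real.sin θ • p.1 + Real.cos θ • p.2)
      ∂(ν.prod ν) = ∫ p, f p ∂(ν.prod ν) := by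
  have h := IsGaussian.map_rotation_eq_self hν θ
  conv_rhs => rw [← h]
  rw [integral_map (by fun_prop) (by fun_prop)]
  rfl

lemma integral_rotation_fst (hν : ∫ x, id x ∂ν = 0) (θ : ℝ) {f : E → ℝ} (hf : Continuous f) :
    ∫ p : E × E, f (Real.cos θ • p.1 + Real.sin θ • p.2) ∂(ν.prod ν) = ∫ x, f x ∂ν := by
  rw [integral_rotation hν θ (f := fun p => f p.1) (by fun_prop), integral_fun_fst]
  simp

end PolynomialGrowth

/-! ### Gaussian integration by parts -/

section IntegrationByParts

variable {n : Type*} [Fintype n] [DecidableEq n]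

/-- The normalized trace as a continuous linear functional. -/
noncomputable def ntrCLM : Matrix n n ℝ →L[ℝ] ℝ :=
  LinearMap.toContinuousLinearMap
    { toFun := ntr, map_add' := ntr_add, map_smul' := fun c A => ntr_smul c A }

lemma PolyGrowth.ntr {E : Type*} [NormedAddCommGroup E] {f : E → Matrix n n ℝ}
    (hf : PolyGrowth f) : PolyGrowth fun x => ntr (f x) :=
  hf.clm_comp ntrCLM

/-- The derivative of a power in a noncommutative algebra. -/
lemma HasDerivAt.noncomm_pow {A : Type*} [NormedRing A] [NormedAlgebra ℝ A] {f : ℝ → A} {D : A}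
    {θ : ℝ} (hf : HasDerivAt f D θ) (k : ℕ) :
    HasDerivAt (fun θ => f θ ^ k)
      (∑ a ∈ Finset.range k, f θ ^ a * D * f θ ^ (k - 1 - a)) θ := by
  induction k with
  | zero => simpa using hasDerivAt_const θ (1 : A)
  | succ k ih =>
    have h := ih.mul hf
    have e : (fun θ => f θ ^ (k + 1)) = (fun θ => f θ ^ k) * f := by
      ext θ
      simp [pow_succ]
    rw [e]
    convert h using 1
    rw [Finset.sum_range_succ, Finset.sum_mul]
    congr 1
    · refine Finset.sum_congr rfl fun a ha => ?_
      rw [Finset.mem_range] at ha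
      rw [mul_assoc _ _ (f θ), ← pow_succ]
      congr 2
      omega
    · simp

lemma hasDerivAt_ntr_pow_mul {f g : ℝ → Matrix n n ℝ} {f' g' : Matrix n n ℝ} {θ : ℝ}
    (hf : HasDerivAt f f' θ) (hg : HasDerivAt g g' θ) (Ψ : Matrix n n ℝ →L[ℝ] Matrix n n ℝ)
    (C D : Matrix n n ℝ) (k : ℕ) :
    HasDerivAt (fun θ => ntr (Ψ (f θ ^ k) * C * g θ * D))
      (ntr ((Ψ (∑ a ∈ Finset.range k, f θ ^ a * f' * f θ ^ (k - 1 - a)) * C * g θ +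
        Ψ (f θ ^ k) * C * g') * D)) θ := by
  have d3 := Ψ.hasFDerivAt.comp_hasDerivAt θ (hf.noncomm_pow k)
  exact (ntrCLM (n := n)).hasFDerivAt.comp_hasDerivAt θ (((d3.mul_const C).mul hg).mul_const D)

lemma polyGrowth_ntr_pow_mul {E : Type*} [NormedAddCommGroup E] {f g : E → Matrix n n ℝ}
    (hf : PolyGrowth f) (hg : PolyGrowth g) (Ψ : Matrix n n ℝ →L[ℝ] Matrix n n ℝ)
    (C D : Matrix n n ℝ) (k : ℕ) : PolyGrowth fun x => ntr (Ψ (f x ^ k) * C * g x * D) :=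
  (((((hf.pow k).clm_comp Ψ).mul (PolyGrowth.const C)).mul hg).mul (PolyGrowth.const D)).ntr

lemma polyGrowth_sum_pow_mul_pow {E : Type*} [NormedAddCommGroup E] {f f' : E → Matrix n n ℝ}
    (hf : PolyGrowth f) (hf' : PolyGrowth f') (k : ℕ) :
    PolyGrowth fun x => ∑ a ∈ Finset.range k, f x ^ a * f' x * f x ^ (k - 1 - a) :=
  PolyGrowth.sum _ fun a _ => ((hf.pow a).mul hf').mul (hf.pow _)

lemma polyGrowth_deriv_ntr_pow_mul {E : Type*} [NormedAddCommGroup E]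
    {f g f' g' : E → Matrix n n ℝ}
    (hf : PolyGrowth f) (hg : PolyGrowth g) (hf' : PolyGrowth f') (hg' : PolyGrowth g')
    (Ψ : Matrix n n ℝ →L[ℝ] Matrix n n ℝ) (C D : Matrix n n ℝ) (k : ℕ) :
    PolyGrowth fun x =>
      ntr ((Ψ (∑ a ∈ Finset.range k, f x ^ a * f' x * f x ^ (k - 1 - a)) * C * g x +
        Ψ (f x ^ k) * C * g' x) * D) :=
  ((((((polyGrowth_sum_pow_mul_pow hf hf' k).clm_comp Ψ).mul (PolyGrowth.const C)).mul hg).add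
    ((((hf.pow k).clm_comp Ψ).mul (PolyGrowth.const C)).mul hg')).mul (PolyGrowth.const D)).ntr

variable {V : Type*} [NormedAddCommGroup V] [NormedSpace ℝ V]

lemma hasDerivAt_rotation (a b : V) (θ : ℝ) :
    HasDerivAt (fun θ => Real.cos θ • a + Real.sin θ • b)
      (-Real.sin θ • a + Real.cos θ • b) θ :=
  ((Real.hasDerivAt_cos θ).smul_const a).add ((Real.hasDerivAt_sin θ).smul_const b)

lemma hasDerivAt_rotation' (a b : V) (θ : ℝ) :
    HasDerivAt (fun θ => -Real.sin θ • a + Real.cos θ • b)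
      (-(Real.cos θ • a + Real.sin θ • b)) θ := by
  have := ((Real.hasDerivAt_sin θ).fun_neg.smul_const a).fun_add
    ((Real.hasDerivAt_cos θ).smul_const b)
  convert this using 1
  simp only [neg_smul, neg_add]

lemma polyGrowth_rotation :
    PolyGrowth fun q : ℝ × V × V => Real.cos q.1 • q.2.1 + Real.sin q.1 • q.2.2 :=
  ((polyGrowth_cos.comp PolyGrowth.fst).smul (PolyGrowth.fst.comp PolyGrowth.snd)).add
    ((polyGrowth_sin.comp PolyGrowth.fst).smul (PolyGrowth.snd.comp PolyGrowth.snd))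

lemma polyGrowth_rotation' :
    PolyGrowth fun q : ℝ × V × V => -Real.sin q.1 • q.2.1 + Real.cos q.1 • q.2.2 := by
  have h : PolyGrowth fun q : ℝ × V × V => (-1 : ℝ) • Real.sin q.1 :=
    (PolyGrowth.const (-1 : ℝ)).smul (polyGrowth_sin.comp PolyGrowth.fst)
  refine PolyGrowth.add ?_
    ((polyGrowth_cos.comp PolyGrowth.fst).smul (PolyGrowth.snd.comp PolyGrowth.snd))
  simpa using h.smul (PolyGrowth.fst.comp (PolyGrowth.snd (E := ℝ) (F := V × V)))

variable [MeasurableSpace V] [BorelSpace V] [CompleteSpace V]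
  [SecondCountableTopology V] {μ : Measure V} [IsGaussian μ]

/-- Gaussian integration by parts for matrix polynomials. The derivative in the direction of the
Gaussian vector is expressed through an independent copy `p.2` of it; the identity is the derivative
at `θ = 0` of the invariance of the law of two independent copies under rotation by `θ`. -/
theorem integral_ntr_pow_mul_eq (hμ : ∫ x, id x ∂μ = 0) (L : V →L[ℝ] Matrix n n ℝ)
    (Ψ : Matrix n n ℝ →L[ℝ] Matrix n n ℝ) (S C D : Matrix n n ℝ) (c : ℝ) (k : ℕ) :
    ∫ t, ntr (Ψ ((S + c • L t) ^ k) * C * L t * D) ∂μ =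
      c * ∑ a ∈ Finset.range k, ∫ p : V × V, ntr (Ψ ((S + c • L p.1) ^ a * L p.2 *
        (S + c • L p.1) ^ (k - 1 - a)) * C * L p.2 * D) ∂(μ.prod μ) := by
  set x : ℝ → V × V → V := fun θ p => Real.cos θ • p.1 + Real.sin θ • p.2 with hx
  set x' : ℝ → V × V → V := fun θ p => -Real.sin θ • p.1 + Real.cos θ • p.2 with hx'
  set X : ℝ → V × V → Matrix n n ℝ := fun θ p => S + c • L (x θ p) with hX
  set H : ℝ × V × V → ℝ := fun q => ntr (Ψ (X q.1 q.2 ^ k) * C * L (x' q.1 q.2) * D) with hH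
  set H' : ℝ × V × V → ℝ := fun q =>
    ntr ((Ψ (∑ a ∈ Finset.range k, X q.1 q.2 ^ a * (c • L (x' q.1 q.2)) *
      X q.1 q.2 ^ (k - 1 - a)) * C * L (x' q.1 q.2) +
      Ψ (X q.1 q.2 ^ k) * C * L (-(x q.1 q.2))) * D) with hH'
  have px : PolyGrowth fun q : ℝ × V × V => x q.1 q.2 := polyGrowth_rotation
  have px' : PolyGrowth fun q : ℝ × V × V => x' q.1 q.2 := polyGrowth_rotation'
  have pX : PolyGrowth fun q : ℝ × V × V => X q.1 q.2 :=
    (PolyGrowth.const S).add ((px.clm_comp L).clm_comp (c • ContinuousLinearMap.id ℝ _))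
  have pN : PolyGrowth fun q : ℝ × V × V => L (-(x q.1 q.2)) :=
    (px.clm_comp (-(ContinuousLinearMap.id ℝ V))).clm_comp L
  have pX' : PolyGrowth fun q : ℝ × V × V => c • L (x' q.1 q.2) :=
    (px'.clm_comp L).clm_comp (c • ContinuousLinearMap.id ℝ _)
  have pH : PolyGrowth H := polyGrowth_ntr_pow_mul pX (px'.clm_comp L) Ψ C D k
  have pH' : PolyGrowth H' := polyGrowth_deriv_ntr_pow_mul pX (px'.clm_comp L) pX' pN Ψ C D k
  have hder : ∀ p θ, HasDerivAt (fun θ => H (θ, p)) (H' (θ, p)) θ := by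
    intro p θ
    have d1 : HasDerivAt (fun θ => X θ p) (c • L (x' θ p)) θ :=
      ((L.hasFDerivAt.comp_hasDerivAt θ (hasDerivAt_rotation p.1 p.2 θ)).const_smul c).const_add S
    have d2 : HasDerivAt (fun θ => L (x' θ p)) (L (-(x θ p))) θ :=
      L.hasFDerivAt.comp_hasDerivAt θ (hasDerivAt_rotation' p.1 p.2 θ)
    exact hasDerivAt_ntr_pow_mul d1 d2 Ψ C D k
  have hconst : ∀ θ, ∫ p, H (θ, p) ∂(μ.prod μ) =
      ∫ p : V × V, ntr (Ψ ((S + c • L p.1) ^ k) * C * L p.2 * D) ∂(μ.prod μ) := by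
    intro θ
    refine integral_rotation hμ θ
      (f := fun p => ntr (Ψ ((S + c • L p.1) ^ k) * C * L p.2 * D)) ?_
    have h1 : Continuous fun p : V × V => Ψ ((S + c • L p.1) ^ k) * C * L p.2 * D := by fun_prop
    exact (ntrCLM (n := n)).continuous.comp h1
  have h1 := hasDerivAt_integral_of_polyGrowth (ν := μ.prod μ) pH pH' hder 0
  have h2 : HasDerivAt (fun θ => ∫ p, H (θ, p) ∂(μ.prod μ)) 0 0 := by
    simp only [hconst]
    exact hasDerivAt_const _ _
  have h3 := h1.unique h2
  have hX0 : ∀ p, X 0 p = S + c • L p.1 := fun p => by simp [hX, hx]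
  have hx0 : ∀ p, x 0 p = p.1 := fun p => by simp [hx]
  have hx'0 : ∀ p, x' 0 p = p.2 := fun p => by simp [hx']
  simp only [hH', hX0, hx0, hx'0] at h3
  have pA : PolyGrowth fun t : V => S + c • L t :=
    (PolyGrowth.const S).add ((PolyGrowth.clm L).clm_comp (c • ContinuousLinearMap.id ℝ _))
  have i1 : ∀ a, Integrable (fun p : V × V => ntr (Ψ ((S + c • L p.1) ^ a * L p.2 *
        (S + c • L p.1) ^ (k - 1 - a)) * C * L p.2 * D)) (μ.prod μ) := by
    intro a
    have q1 : PolyGrowth fun p : V × V => S + c • L p.1 := pA.comp PolyGrowth.fst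
    have q2 : PolyGrowth fun p : V × V => L p.2 := (PolyGrowth.snd).clm_comp L
    have q3 : PolyGrowth fun p : V × V => (S + c • L p.1) ^ a * L p.2 *
        (S + c • L p.1) ^ (k - 1 - a) := ((q1.pow a).mul q2).mul (q1.pow _)
    exact ((((q3.clm_comp Ψ).mul (PolyGrowth.const C)).mul q2).mul
      (PolyGrowth.const D)).ntr.integrable
  have i2 : Integrable (fun t : V => ntr (Ψ ((S + c • L t) ^ k) * C * L t * D)) μ :=
    (polyGrowth_ntr_pow_mul pA (PolyGrowth.clm L) Ψ C D k).integrable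
  have i2' : Integrable (fun p : V × V => ntr (Ψ ((S + c • L p.1) ^ k) * C * L p.1 * D))
      (μ.prod μ) := i2.comp_fst μ
  have e : ∀ p : V × V, ntr ((Ψ (∑ a ∈ Finset.range k, (S + c • L p.1) ^ a * (c • L p.2) *
      (S + c • L p.1) ^ (k - 1 - a)) * C * L p.2 +
      Ψ ((S + c • L p.1) ^ k) * C * L (-p.1)) * D) =
      c * ∑ a ∈ Finset.range k, ntr (Ψ ((S + c • L p.1) ^ a * L p.2 *
        (S + c • L p.1) ^ (k - 1 - a)) * C * L p.2 * D) -
      ntr (Ψ ((S + c • L p.1) ^ k) * C * L p.1 * D) := by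
    intro p
    simp only [map_sum, map_neg, mul_neg, Finset.sum_mul, add_mul, neg_mul, Matrix.mul_smul,
      Matrix.smul_mul, map_smul, ← Finset.smul_sum]
    rw [← sub_eq_add_neg, ntr_sub, ntr_smul, ntr_sum]
  simp only [e] at h3
  rw [integral_sub ((integrable_finsetSum _ fun a _ => i1 a).const_mul c) i2', integral_const_mul,
    integral_finsetSum _ fun a _ => i1 a,
    integral_fun_fst (fun t => ntr (Ψ ((S + c • L t) ^ k) * C * L t * D))] at h3
  simp only [probReal_univ, one_smul] at h3
  linarith

end IntegrationByParts

/-! ### Covariance of powers of a Gaussian matrix -/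

lemma abs_integral_le_integral_of_le {V : Type*} [MeasurableSpace V] {μ : Measure V} {f g : V → ℝ}
    (hg : Integrable g μ) (h : ∀ x, |f x| ≤ g x) : |∫ x, f x ∂μ| ≤ ∫ x, g x ∂μ := by
  rw [← Real.norm_eq_abs]
  exact norm_integral_le_of_norm_le hg (Filter.Eventually.of_forall h)

section MomentMap

variable {n : Type*} [Fintype n] [DecidableEq n]
variable {V : Type*} [MeasurableSpace V] {μ : Measure V}

lemma integral_apply_eq_apply_expMatrix {f : Matrix n n ℝ → ℝ} (hf : IsLinearMap ℝ f)
    {Y : V → Matrix n n ℝ} (hY : ∀ i j, Integrable (fun v => Y v i j) μ) :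
    ∫ v, f (Y v) ∂μ = f (expMatrix μ Y) := by
  have h : ∀ M, f M = ∑ i, ∑ j, M i j * f (Matrix.single i j 1) := by
    intro M
    conv_lhs => rw [Matrix.matrix_eq_sum_single M]
    have h1 := map_sum (hf.mk' f) (fun i => ∑ j, Matrix.single i j (M i j)) Finset.univ
    have h2 := fun i => map_sum (hf.mk' f) (fun j => Matrix.single i j (M i j)) Finset.univ
    simp only [h2, IsLinearMap.mk'_apply] at h1
    rw [h1]
    refine Finset.sum_congr rfl fun i _ => Finset.sum_congr rfl fun j _ => ?_
    rw [← smul_eq_mul, ← hf.map_smul, Matrix.smul_single, smul_eq_mul, mul_one]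
  simp only [h (Y _)]
  rw [h (expMatrix μ Y), integral_finsetSum _ fun i _ => integrable_finsetSum _ fun j _ =>
    (hY i j).mul_const _]
  refine Finset.sum_congr rfl fun i _ => ?_
  rw [integral_finsetSum _ fun j _ => (hY i j).mul_const _]
  exact Finset.sum_congr rfl fun j _ => integral_mul_const _ _

/-- The completely positive map `M ↦ 𝔼 (Z M Z)` of a random matrix `Z`, written out in entries so
that it is linear by definition. -/
noncomputable def momentMap (μ : Measure V) (Z : V → Matrix n n ℝ) :
    Matrix n n ℝ →L[ℝ] Matrix n n ℝ :=
  LinearMap.toContinuousLinearMap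
    { toFun := fun M => Matrix.of fun i j => ∑ k, ∑ l, M k l * ∫ v, Z v i k * Z v l j ∂μ
      map_add' := fun M M' => by
        ext i j
        simp [add_mul, Finset.sum_add_distrib]
      map_smul' := fun c M => by
        ext i j
        simp [mul_assoc, Finset.mul_sum] }

omit [DecidableEq n] in
lemma momentMap_apply {Z : V → Matrix n n ℝ} (hZ : ∀ i j, MemLp (fun v => Z v i j) 2 μ)
    (M : Matrix n n ℝ) : momentMap μ Z M = expMatrix μ fun v => Z v * M * Z v := by
  ext i j
  have h1 : ∀ v, (Z v * M * Z v) i j = ∑ k, ∑ l, M k l * (Z v i k * Z v l j) := by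
    intro v
    simp only [Matrix.mul_apply, Finset.sum_mul]
    rw [Finset.sum_comm]
    exact Finset.sum_congr rfl fun k _ => Finset.sum_congr rfl fun l _ => by ring
  have hi : ∀ k l, Integrable (fun v => M k l * (Z v i k * Z v l j)) μ := fun k l =>
    ((hZ i k).integrable_mul (hZ l j)).const_mul _
  simp only [expMatrix, Matrix.of_apply, h1]
  rw [integral_finsetSum _ fun k _ => integrable_finsetSum _ fun l _ => hi k l]
  change ∑ k, ∑ l, M k l * ∫ v, Z v i k * Z v l j ∂μ = _
  refine Finset.sum_congr rfl fun k _ => ?_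
  rw [integral_finsetSum _ fun l _ => hi k l]
  exact Finset.sum_congr rfl fun l _ => (integral_const_mul _ _).symm

omit [DecidableEq n] in
lemma ntr_momentMap_mul {Z : V → Matrix n n ℝ} (hZ : ∀ i j, MemLp (fun v => Z v i j) 2 μ)
    (M B : Matrix n n ℝ) : ntr (momentMap μ Z M * B) = ∫ v, ntr (Z v * M * Z v * B) ∂μ := by
  rw [momentMap_apply hZ, ntr_expMatrix_mul (integrable_mul_mul_self_entry hZ M)]

end MomentMap

section Covariance

variable {n : Type*} [Fintype n] [DecidableEq n]
variable {V : Type*} [NormedAddCommGroup V] [NormedSpace ℝ V]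

lemma PolyGrowth.matrix_entry {E : Type*} [NormedAddCommGroup E] {f : E → Matrix n n ℝ}
    (hf : PolyGrowth f) (i j : n) : PolyGrowth fun x => f x i j :=
  hf.clm_comp (LinearMap.toContinuousLinearMap (Matrix.entryLinearMap ℝ ℝ i j))

lemma PolyGrowth.transpose {E : Type*} [NormedAddCommGroup E] {f : E → Matrix n n ℝ}
    (hf : PolyGrowth f) : PolyGrowth fun x => (f x)ᵀ :=
  hf.clm_comp (LinearMap.toContinuousLinearMap (Matrix.transposeLinearEquiv n n ℝ ℝ).toLinearMap)

lemma PolyGrowth.schattenPow {E : Type*} [NormedAddCommGroup E] {f : E → Matrix n n ℝ}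
    (hf : PolyGrowth f) (m : ℕ) : PolyGrowth fun x => schattenPow m (f x) :=
  ((hf.mul hf.transpose).pow m).ntr

variable [MeasurableSpace V] [BorelSpace V] [CompleteSpace V]
  [SecondCountableTopology V] {μ : Measure V} [IsGaussian μ] {σ κ : ℝ}

/-- The crossing term that bounds the derivative of the covariance along the interpolation
`cos θ • u + sin θ • x`. -/
lemma abs_integral_crossing_le [Nonempty n] (hμ : ∫ x, id x ∂μ = 0) (L : V →L[ℝ] Matrix n n ℝ)
    (h : HasSecondMomentBounds μ (fun v => L v) σ κ) (hκ : 0 < κ) {N : ℕ}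
    (hL : ∫ v, schattenPow (2 ^ N) (L v) ∂μ ≤ 1) {l : List (Matrix n n ℝ)}
    (hl : ∀ Y ∈ l, schattenPow (2 ^ N) Y ≤ 1) (θ : ℝ) (j c e : ℕ)
    (hlen : j + c + e + l.length < 2 ^ (N + 1)) :
    |∫ p : V × V, ntr (momentMap μ (fun v => L v) (L (Real.sin θ • p.1 + Real.cos θ • p.2) ^ j) *
      L p.1 ^ c * L p.2 * (L p.1 ^ e * l.prod)) ∂(μ.prod μ)| ≤ j * (κ * σ) := by
  set Φ := momentMap μ (fun v => L v) with hΦ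
  set P : ℕ := 2 ^ (N + 1) with hP
  have hP0 : (0 : ℝ) < P := by rw [hP]; positivity
  have hPr : (2 ^ (N + 1) : ℝ) = P := by rw [hP]; push_cast; rfl
  have hκσ : 0 ≤ κ * σ := by
    obtain ⟨x⟩ := ‹Nonempty n›
    have h1 := h.sum_integral_sq_entry_le (Q := 1) (R := 1) (by simp) (by simp) x
    exact mul_nonneg hκ.le ((Finset.sum_nonneg fun i _ => integral_nonneg fun v =>
      sq_nonneg _).trans h1)
  set X : V × V → Matrix n n ℝ := fun p => L (Real.sin θ • p.1 + Real.cos θ • p.2) with hX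
  have pX : PolyGrowth X := PolyGrowth.clm_comp L
    (((PolyGrowth.const (Real.sin θ)).smul PolyGrowth.fst).add
      ((PolyGrowth.const (Real.cos θ)).smul PolyGrowth.snd))
  have pL : PolyGrowth fun v : V => L v := PolyGrowth.clm L
  set bound : V × V → ℝ := fun p => κ * σ / P * ((j - 1 : ℕ) * schattenPow (2 ^ N) (X p) +
    (c + e) * schattenPow (2 ^ N) (L p.1) + (P - (j - 1 : ℕ) - c - e)) with hbound
  have pbound : PolyGrowth bound := (PolyGrowth.const _).mul
    ((((PolyGrowth.const _).mul (pX.schattenPow _)).add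
      ((PolyGrowth.const _).mul ((pL.comp PolyGrowth.fst).schattenPow _))).add
      (PolyGrowth.const _))
  have hEX : ∫ p, schattenPow (2 ^ N) (X p) ∂(μ.prod μ) ≤ 1 := by
    have h1 := integral_rotation_fst hμ (Real.pi / 2 - θ)
      (f := fun v => schattenPow (2 ^ N) (L v)) (pL.schattenPow _).1
    rw [Real.cos_pi_div_two_sub, Real.sin_pi_div_two_sub] at h1
    exact h1.le.trans hL
  have hES : ∫ p : V × V, schattenPow (2 ^ N) (L p.1) ∂(μ.prod μ) ≤ 1 := by
    rw [integral_fun_fst (fun v => schattenPow (2 ^ N) (L v))]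
    simpa using hL
  have hEbound : ∫ p, bound p ∂(μ.prod μ) ≤ κ * σ := by
    have i1 := ((pX.schattenPow (2 ^ N)).integrable (ν := μ.prod μ)).const_mul ((j - 1 : ℕ) : ℝ)
    have i2 := (((pL.comp PolyGrowth.fst).schattenPow (2 ^ N)).integrable
      (ν := μ.prod μ)).const_mul ((c + e : ℕ) : ℝ)
    push_cast at i2
    have i12 : Integrable (fun p : V × V => ((j - 1 : ℕ) : ℝ) * schattenPow (2 ^ N) (X p) +
        (c + e) * schattenPow (2 ^ N) (L p.1)) (μ.prod μ) := i1.add i2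
    simp only [hbound]
    rw [integral_const_mul, integral_add i12 (integrable_const _), integral_add i1 i2,
      integral_const_mul, integral_const_mul, integral_const]
    simp only [probReal_univ, one_smul]
    calc κ * σ / P * ((j - 1 : ℕ) * ∫ p, schattenPow (2 ^ N) (X p) ∂(μ.prod μ) +
          (c + e) * ∫ p : V × V, schattenPow (2 ^ N) (L p.1) ∂(μ.prod μ) +
          (P - (j - 1 : ℕ) - c - e))
        ≤ κ * σ / P * ((j - 1 : ℕ) * 1 + (c + e) * 1 + (P - (j - 1 : ℕ) - c - e)) := by gcongr
      _ = κ * σ := by field_simp; ring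
  -- the inner expectation over the copies of the Gaussian vector is a crossing
  have hcross : ∀ a < j, ∀ s t : V, |∫ w, ntr (Φ (X (s, t) ^ a * L w * X (s, t) ^ (j - 1 - a)) *
      L s ^ c * L w * (L s ^ e * l.prod)) ∂μ| ≤ bound (s, t) := by
    intro a ha s t
    have h1 := h.abs_crossing_le hκ N (List.replicate (j - 1 - a) (X (s, t)))
      (List.replicate c (L s)) (List.replicate e (L s) ++ l) (List.replicate a (X (s, t)))
      (by simp; omega)
    have h2 : ∀ w, ntr (Φ (X (s, t) ^ a * L w * X (s, t) ^ (j - 1 - a)) *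
        L s ^ c * L w * (L s ^ e * l.prod)) = ∫ z, ntr (L w *
          (List.replicate (j - 1 - a) (X (s, t))).prod * L z * (List.replicate c (L s)).prod *
          L w * (List.replicate e (L s) ++ l).prod * L z *
          (List.replicate a (X (s, t))).prod) ∂μ := by
      intro w
      simp only [List.prod_replicate, List.prod_append]
      rw [mul_assoc (Φ _), mul_assoc (Φ _), hΦ, ntr_momentMap_mul h.memLp]
      congr 1
      ext z
      have := ntr_mul_comm (L z * X (s, t) ^ a) (L w * X (s, t) ^ (j - 1 - a) * L z * L s ^ c *
        L w * (L s ^ e * l.prod))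
      simp only [mul_assoc] at this ⊢
      exact this
    simp only [h2]
    rw [hPr] at h1
    rw [hbound]
    simp only
    rw [div_mul_eq_mul_div, le_div_iff₀ hP0, mul_comm _ (P : ℝ)]
    refine h1.trans (mul_le_mul_of_nonneg_left ?_ hκσ)
    have h3 := sum_map_schattenPow_le hl
    simp only [List.map_append, List.map_replicate, List.sum_append, List.sum_replicate,
      List.length_append, List.length_replicate, nsmul_eq_mul]
    have h4 : j - 1 = (j - 1 - a) + a := by omega
    have h5 : ((j - 1 : ℕ) : ℝ) = ((j - 1 - a : ℕ) : ℝ) + a := by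
      conv_lhs => rw [h4]
      push_cast
      rfl
    rw [h5]
    push_cast
    nlinarith
  have pF : PolyGrowth fun p : V × V => ntr (Φ (X p ^ j) * L p.1 ^ c * L p.2 *
      (L p.1 ^ e * l.prod)) :=
    (((((pX.pow j).clm_comp Φ).mul ((pL.comp PolyGrowth.fst).pow c)).mul
      (pL.comp PolyGrowth.snd)).mul (((pL.comp PolyGrowth.fst).pow e).mul
        (PolyGrowth.const _))).ntr
  rw [integral_prod _ pF.integrable]
  have hinner : ∀ s, |∫ t, ntr (Φ (X (s, t) ^ j) * L s ^ c * L t * (L s ^ e * l.prod)) ∂μ| ≤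
      j * ∫ t, bound (s, t) ∂μ := by
    intro s
    have hXs : ∀ t, X (s, t) = Real.sin θ • L s + Real.cos θ • L t := fun t => by simp [hX]
    have h1 := integral_ntr_pow_mul_eq hμ L Φ (Real.sin θ • L s) (L s ^ c) (L s ^ e * l.prod)
      (Real.cos θ) j
    simp only [← hXs] at h1
    rw [h1, abs_mul]
    have pXs : PolyGrowth fun t => X (s, t) := by
      simp only [hXs]
      exact (PolyGrowth.const _).add ((PolyGrowth.const (Real.cos θ)).smul pL)
    have hslice : Integrable (fun t => bound (s, t)) μ := by
      have hs : PolyGrowth fun t => κ * σ / P * ((j - 1 : ℕ) * schattenPow (2 ^ N) (X (s, t)) +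
          (c + e) * schattenPow (2 ^ N) (L s) + (P - (j - 1 : ℕ) - c - e)) :=
        (PolyGrowth.const _).mul ((((PolyGrowth.const _).mul (pXs.schattenPow _)).add
          (PolyGrowth.const _)).add (PolyGrowth.const _))
      exact hs.integrable
    have h2 : ∀ a ∈ Finset.range j, |∫ p : V × V, ntr (Φ (X (s, p.1) ^ a * L p.2 *
        X (s, p.1) ^ (j - 1 - a)) * L s ^ c * L p.2 * (L s ^ e * l.prod)) ∂(μ.prod μ)| ≤
        ∫ t, bound (s, t) ∂μ := by
      intro a ha
      have q1 : PolyGrowth fun p : V × V => X (s, p.1) := pXs.comp PolyGrowth.fst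
      have q2 : PolyGrowth fun p : V × V => L p.2 := pL.comp PolyGrowth.snd
      have q3 : PolyGrowth fun p : V × V => X (s, p.1) ^ a * L p.2 * X (s, p.1) ^ (j - 1 - a) :=
        ((q1.pow a).mul q2).mul (q1.pow _)
      have q4 := ((((q3.clm_comp Φ).mul (PolyGrowth.const (L s ^ c))).mul q2).mul
        (PolyGrowth.const (L s ^ e * l.prod))).ntr.integrable (ν := μ.prod μ)
      rw [integral_prod _ q4]
      exact abs_integral_le_integral_of_le hslice fun t =>
        hcross a (Finset.mem_range.mp ha) s t
    have h3 : 0 ≤ ∑ a ∈ Finset.range j, ∫ t, bound (s, t) ∂μ :=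
      Finset.sum_nonneg fun a ha => (abs_nonneg _).trans (h2 a ha)
    calc _ ≤ 1 * ∑ a ∈ Finset.range j, ∫ t, bound (s, t) ∂μ :=
          mul_le_mul (Real.abs_cos_le_one θ) ((Finset.abs_sum_le_sum_abs _ _).trans
            (Finset.sum_le_sum h2)) (abs_nonneg _) zero_le_one
      _ = _ := by simp
  calc _ ≤ ∫ s, j * ∫ t, bound (s, t) ∂μ ∂μ :=
        abs_integral_le_integral_of_le (pbound.integrable.integral_prod_left.const_mul _) hinner
    _ = j * ∫ p, bound p ∂(μ.prod μ) := by
        rw [integral_const_mul, integral_prod _ pbound.integrable]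
    _ ≤ _ := by gcongr

end Covariance

/-! ### Moments of a symmetric Gaussian matrix -/

section Moments

variable {n : Type*} [Fintype n] [DecidableEq n] [Nonempty n]
variable {V : Type*} [NormedAddCommGroup V] [NormedSpace ℝ V]
  [MeasurableSpace V] [BorelSpace V] [CompleteSpace V]
  [SecondCountableTopology V] {μ : Measure V} [IsGaussian μ] {σ κ : ℝ}

/-- Asymptotic freeness of the powers of a Gaussian matrix, in quantitative form: replacing the two
powers in `𝔼 τ(Z X ^ j Z X ^ k B)` by their expectations costs an error of order `κ σ`. -/
theorem abs_integral_ntr_momentMap_sub_le (hμ : ∫ x, id x ∂μ = 0) (L : V →L[ℝ] Matrix n n ℝ)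
    (h : HasSecondMomentBounds μ (fun v => L v) σ κ) (hκ : 0 < κ) {N : ℕ}
    (hL : ∫ v, schattenPow (2 ^ N) (L v) ∂μ ≤ 1) {l : List (Matrix n n ℝ)}
    (hl : ∀ Y ∈ l, schattenPow (2 ^ N) Y ≤ 1) (j k : ℕ)
    (hlen : j + k + l.length ≤ 2 ^ (N + 1)) :
    |∫ x, ntr (momentMap μ (fun v => L v) (L x ^ j) * L x ^ k * l.prod) ∂μ -
      ntr (momentMap μ (fun v => L v) (expMatrix μ fun v => L v ^ j) *
        (expMatrix μ fun v => L v ^ k) * l.prod)| ≤ 2 * (j * k * (κ * σ)) := by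
  set Φ := momentMap μ (fun v => L v) with hΦ
  have hκσ : 0 ≤ κ * σ := by
    obtain ⟨x⟩ := ‹Nonempty n›
    have h1 := h.sum_integral_sq_entry_le (Q := 1) (R := 1) (by simp) (by simp) x
    exact mul_nonneg hκ.le ((Finset.sum_nonneg fun i _ => integral_nonneg fun v =>
      sq_nonneg _).trans h1)
  set x : ℝ → V × V → V := fun θ p => Real.cos θ • p.1 + Real.sin θ • p.2 with hx
  set x' : ℝ → V × V → V := fun θ p => -Real.sin θ • p.1 + Real.cos θ • p.2 with hx'
  set H : ℝ × V × V → ℝ := fun q => ntr (Φ (L q.2.2 ^ j) * L (x q.1 q.2) ^ k * l.prod) with hH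
  set H' : ℝ × V × V → ℝ := fun q => ntr (Φ (L q.2.2 ^ j) * (∑ c ∈ Finset.range k,
    L (x q.1 q.2) ^ c * L (x' q.1 q.2) * L (x q.1 q.2) ^ (k - 1 - c)) * l.prod) with hH'
  have pL : PolyGrowth fun v : V => L v := PolyGrowth.clm L
  have px : PolyGrowth fun q : ℝ × V × V => L (x q.1 q.2) := polyGrowth_rotation.clm_comp L
  have px' : PolyGrowth fun q : ℝ × V × V => L (x' q.1 q.2) := polyGrowth_rotation'.clm_comp L
  have p2 : PolyGrowth fun q : ℝ × V × V => Φ (L q.2.2 ^ j) :=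
    ((pL.comp (PolyGrowth.snd.comp PolyGrowth.snd)).pow j).clm_comp Φ
  have pH : PolyGrowth H := ((p2.mul (px.pow k)).mul (PolyGrowth.const l.prod)).ntr
  have pH' : PolyGrowth H' :=
    ((p2.mul (polyGrowth_sum_pow_mul_pow px px' k)).mul (PolyGrowth.const l.prod)).ntr
  have hder : ∀ p θ, HasDerivAt (fun θ => H (θ, p)) (H' (θ, p)) θ := by
    intro p θ
    have d1 : HasDerivAt (fun θ => L (x θ p)) (L (x' θ p)) θ :=
      L.hasFDerivAt.comp_hasDerivAt θ (hasDerivAt_rotation p.1 p.2 θ)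
    exact (ntrCLM (n := n)).hasFDerivAt.comp_hasDerivAt θ
      (((d1.noncomm_pow k).const_mul (Φ (L p.2 ^ j))).mul_const l.prod)
  have hφ := hasDerivAt_integral_of_polyGrowth (ν := μ.prod μ) pH pH' hder
  have hbound : ∀ θ, |∫ p, H' (θ, p) ∂(μ.prod μ)| ≤ j * k * (κ * σ) := by
    intro θ
    set f : ℕ → V × V → ℝ := fun c p =>
      ntr (Φ (L (Real.sin θ • p.1 + Real.cos θ • p.2) ^ j) * L p.1 ^ c * L p.2 *
        (L p.1 ^ (k - 1 - c) * l.prod)) with hf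
    have q1 : PolyGrowth fun p : V × V => L p.1 := pL.comp PolyGrowth.fst
    have q2 : PolyGrowth fun p : V × V => L p.2 := pL.comp PolyGrowth.snd
    have q3 : PolyGrowth fun p : V × V => L (Real.sin θ • p.1 + Real.cos θ • p.2) :=
      PolyGrowth.clm_comp L (((PolyGrowth.const (Real.sin θ)).smul PolyGrowth.fst).add
      ((PolyGrowth.const (Real.cos θ)).smul PolyGrowth.snd))
    have pf : ∀ c, PolyGrowth (f c) := fun c =>
      (((((q3.pow j).clm_comp Φ).mul (q1.pow c)).mul q2).mul
        ((q1.pow (k - 1 - c)).mul (PolyGrowth.const l.prod))).ntr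
    have h1 : ∀ p, H' (θ, p) = ∑ c ∈ Finset.range k, f c (x θ p, x' θ p) := by
      intro p
      have e : Real.sin θ • x θ p + Real.cos θ • x' θ p = p.2 := by
        simp only [hx, hx', smul_add, smul_smul]
        have e1 : Real.sin θ * Real.cos θ + Real.cos θ * -Real.sin θ = 0 := by ring
        have e2 : Real.sin θ * Real.sin θ + Real.cos θ * Real.cos θ = 1 := by
          rw [← sq, ← sq, Real.sin_sq_add_cos_sq]
        rw [add_add_add_comm, ← add_smul, ← add_smul, e1, e2, zero_smul, one_smul, zero_add]
      simp only [hH', hf, e]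
      rw [Finset.mul_sum, Finset.sum_mul, ntr_sum]
      refine Finset.sum_congr rfl fun c _ => ?_
      simp only [mul_assoc]
    have h2 : ∫ p, H' (θ, p) ∂(μ.prod μ) = ∑ c ∈ Finset.range k, ∫ p, f c p ∂(μ.prod μ) := by
      simp only [h1]
      rw [← integral_finsetSum _ fun c _ => (pf c).integrable]
      exact integral_rotation hμ θ (f := fun p => ∑ c ∈ Finset.range k, f c p)
        (continuous_finsetSum _ fun c _ => (pf c).1)
    rw [h2]
    refine (Finset.abs_sum_le_sum_abs _ _).trans ?_
    have h3 : ∀ c ∈ Finset.range k, |∫ p, f c p ∂(μ.prod μ)| ≤ j * (κ * σ) := by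
      intro c hc
      rw [Finset.mem_range] at hc
      exact abs_integral_crossing_le hμ L h hκ hL hl θ j c (k - 1 - c) (by omega)
    refine (Finset.sum_le_sum h3).trans (le_of_eq ?_)
    simp
    ring
  -- the two copies are independent at `θ = 0` and equal at `θ = π / 2`
  have hmv := Convex.norm_image_sub_le_of_norm_hasDerivWithin_le (s := Set.univ)
    (f := fun θ => ∫ p, H (θ, p) ∂(μ.prod μ)) (x := 0) (y := Real.pi / 2)
    (fun θ _ => (hφ θ).hasDerivWithinAt) (fun θ _ => hbound θ) convex_univ (Set.mem_univ _)
    (Set.mem_univ _)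
  have e1 : ∫ p, H (Real.pi / 2, p) ∂(μ.prod μ) = ∫ x, ntr (Φ (L x ^ j) * L x ^ k * l.prod) ∂μ := by
    have : ∀ p : V × V, H (Real.pi / 2, p) = ntr (Φ (L p.2 ^ j) * L p.2 ^ k * l.prod) :=
      fun p => by simp [hH, hx]
    simp only [this]
    rw [integral_fun_snd (fun t => ntr (Φ (L t ^ j) * L t ^ k * l.prod))]
    simp
  have e0 : ∫ p, H (0, p) ∂(μ.prod μ) = ntr (Φ (expMatrix μ fun v => L v ^ j) *
        (expMatrix μ fun v => L v ^ k) * l.prod) := by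
    have h0 : ∀ p : V × V, H (0, p) = ntr (Φ (L p.2 ^ j) * L p.1 ^ k * l.prod) :=
      fun p => by simp [hH, hx]
    have pp : PolyGrowth fun p : V × V => ntr (Φ (L p.2 ^ j) * L p.1 ^ k * l.prod) :=
      (((((pL.comp PolyGrowth.snd).pow j).clm_comp Φ).mul ((pL.comp PolyGrowth.fst).pow k)).mul
        (PolyGrowth.const l.prod)).ntr
    simp only [h0]
    rw [integral_prod _ pp.integrable]
    have hi : ∀ k, ∀ i j, Integrable (fun v => (L v ^ k) i j) μ := fun k i j =>
      ((pL.pow k).matrix_entry i j).integrable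
    have l1 : ∀ C : Matrix n n ℝ, IsLinearMap ℝ fun M => ntr (Φ M * C * l.prod) := fun C =>
      ⟨fun M M' => by simp only [map_add, add_mul, ntr_add],
        fun c M => by simp only [map_smul, Matrix.smul_mul, ntr_smul, smul_eq_mul]⟩
    have l2 : ∀ C : Matrix n n ℝ, IsLinearMap ℝ fun M => ntr (C * M * l.prod) := fun C =>
      ⟨fun M M' => by simp only [mul_add, add_mul, ntr_add],
        fun c M => by simp only [Matrix.mul_smul, Matrix.smul_mul, ntr_smul, smul_eq_mul]⟩
    have s1 : ∀ u : V, ∫ y, ntr (Φ (L y ^ j) * L u ^ k * l.prod) ∂μ =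
        ntr (Φ (expMatrix μ fun v => L v ^ j) * L u ^ k * l.prod) := fun u =>
      integral_apply_eq_apply_expMatrix (l1 (L u ^ k)) (hi j)
    simp only [s1]
    exact integral_apply_eq_apply_expMatrix (l2 _) (hi k)
  rw [e1, e0, Real.norm_eq_abs, Real.norm_eq_abs, sub_zero,
    abs_of_pos (by positivity : (0 : ℝ) < Real.pi / 2)] at hmv
  refine hmv.trans ?_
  rw [mul_comm]
  have : Real.pi / 2 ≤ 2 := by linarith [Real.pi_le_four]
  gcongr

/-- The normalized moments `𝔼 X ^ k` obey the recursion of `momentMajorant` in the Schatten norms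
of order `P / k`. -/
theorem dualBound_expMatrix_pow (hμ : ∫ x, id x ∂μ = 0) (L : V →L[ℝ] Matrix n n ℝ)
    (h : HasSecondMomentBounds μ (fun v => L v) σ κ) (hσ : 0 < σ) (hκ : 0 < κ) {N : ℕ}
    (hL : ∫ v, schattenPow (2 ^ N) (L v) ∂μ ≤ 1) (k : ℕ) (hk : k ≤ 2 ^ (N + 1)) :
    DualBound N k (expMatrix μ fun v => L v ^ k)
      (momentMajorant σ (2 * (2 ^ (N + 1)) ^ 3 * (κ * σ)) k) := by
  set P : ℕ := 2 ^ (N + 1) with hP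
  have hPr : (2 ^ (N + 1) : ℝ) = P := by rw [hP]; push_cast; rfl
  rw [hPr]
  set δ : ℝ := 2 * (P : ℝ) ^ 3 * (κ * σ) with hδ
  have hP0 : (0 : ℝ) < P := by rw [hP]; positivity
  have hδ0 : 0 < δ := by positivity
  have pL : PolyGrowth fun v : V => L v := PolyGrowth.clm L
  induction k using Nat.strong_induction_on with
  | _ k ih =>
  match k, ih, hk with
  | 0, _, _ =>
    have e : (expMatrix μ fun v => L v ^ 0) = 1 := by
      ext i j
      simp [expMatrix]
    rw [e, momentMajorant]
    exact dualBound_one N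
  | 1, _, _ =>
    have e : (expMatrix μ fun v => L v ^ 1) = 0 := by
      ext i j
      have h1 := ContinuousLinearMap.integral_comp_comm
        ((LinearMap.toContinuousLinearMap (Matrix.entryLinearMap ℝ ℝ i j)).comp L)
        (IsGaussian.integrable_id (μ := μ))
      rw [hμ, map_zero] at h1
      simpa [expMatrix] using h1
    intro l _ _
    rw [e, zero_mul, ntr_zero, abs_zero, momentMajorant]
    exact hδ0.le
  | k + 2, ih, hk =>
    intro l hlen hl
    set x := momentMajorant σ δ with hx
    have hxpos := fun k => momentMajorant_pos hσ.le hδ0 k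
    set Φ := momentMap μ (fun v => L v) with hΦ
    have hi : ∀ k, ∀ i j, Integrable (fun v => (L v ^ k) i j) μ := fun k i j =>
      ((pL.pow k).matrix_entry i j).integrable
    have e1 : ntr ((expMatrix μ fun v => L v ^ (k + 2)) * l.prod) =
        ∑ a ∈ Finset.range (k + 1), ∫ t, ntr (Φ (L t ^ a) * L t ^ (k - a) * l.prod) ∂μ := by
      rw [ntr_expMatrix_mul (hi _)]
      have h1 := integral_ntr_pow_mul_eq hμ L (ContinuousLinearMap.id ℝ _) 0 l.prod 1 1 (k + 1)
      simp only [zero_add, one_smul, one_mul, mul_one, ContinuousLinearMap.id_apply,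
        Nat.add_sub_cancel] at h1
      have h2 : ∀ v, ntr (L v ^ (k + 2) * l.prod) = ntr (L v ^ (k + 1) * l.prod * L v) := by
        intro v
        rw [ntr_mul_comm _ (L v), pow_succ', mul_assoc]
      simp only [h2]
      rw [h1]
      refine Finset.sum_congr rfl fun a _ => ?_
      have q1 : PolyGrowth fun p : V × V => L p.1 := pL.comp PolyGrowth.fst
      have q2 : PolyGrowth fun p : V × V => L p.2 := pL.comp PolyGrowth.snd
      have q3 := (((((q1.pow a).mul q2).mul (q1.pow (k - a))).mul
        (PolyGrowth.const l.prod)).mul q2).ntr.integrable (ν := μ.prod μ)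
      rw [integral_prod _ q3]
      congr 1
      ext t
      rw [mul_assoc, ntr_momentMap_mul h.memLp]
      congr 1
      ext w
      rw [ntr_mul_comm]
      simp only [mul_assoc]
    have h2 : ∀ a ∈ Finset.range (k + 1),
        |∫ t, ntr (Φ (L t ^ a) * L t ^ (k - a) * l.prod) ∂μ| ≤
          σ * (x a * x (k - a)) + 2 * ((P : ℝ) ^ 2 * (κ * σ)) := by
      intro a ha
      rw [Finset.mem_range] at ha
      have f1 := abs_integral_ntr_momentMap_sub_le hμ L h hκ hL hl a (k - a) (by omega)
      -- the order `a + 1` instead of `a`, since the bound for `Φ` requires a positive order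
      have d1 : DualBound N (a + 1) (expMatrix μ fun v => L v ^ a) (x a) :=
        (ih a (by omega) (by omega)).mono (by omega)
      have d2 := h.dualBound_expMatrix d1 (hxpos a) (by omega) (by omega)
      rw [← momentMap_apply h.memLp] at d2
      have d3 := d2.mul (ih (k - a) (by omega) (by omega)) (mul_pos hσ (hxpos a)) (by omega)
        (by omega)
      have d4 := d3 l (by omega) hl
      have f2 : (a : ℝ) * ((k - a : ℕ) : ℝ) * (κ * σ) ≤ (P : ℝ) ^ 2 * (κ * σ) := by
        have g1 : (a : ℝ) ≤ P := by exact_mod_cast (by omega : a ≤ P)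
        have g2 : ((k - a : ℕ) : ℝ) ≤ P := by exact_mod_cast (by omega : k - a ≤ P)
        rw [sq]
        gcongr
      have f3 := abs_sub_abs_le_abs_sub
        (∫ t, ntr (Φ (L t ^ a) * L t ^ (k - a) * l.prod) ∂μ)
        (ntr (Φ (expMatrix μ fun v => L v ^ a) * (expMatrix μ fun v => L v ^ (k - a)) * l.prod))
      rw [mul_assoc σ] at d4
      linarith
    rw [e1, hx, momentMajorant_add_two]
    refine (Finset.abs_sum_le_sum_abs _ _).trans ((Finset.sum_le_sum h2).trans ?_)
    rw [Finset.sum_add_distrib, ← Finset.mul_sum, Finset.sum_const, Finset.card_range,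
      nsmul_eq_mul]
    have h3 : ((k + 1 : ℕ) : ℝ) ≤ P := by exact_mod_cast (by omega : k + 1 ≤ P)
    have h4 : ((k + 1 : ℕ) : ℝ) * (2 * ((P : ℝ) ^ 2 * (κ * σ))) ≤ δ := by
      calc _ ≤ (P : ℝ) * (2 * ((P : ℝ) ^ 2 * (κ * σ))) := by gcongr
        _ = δ := by rw [hδ]; ring
    linarith

omit [Nonempty n] in
lemma schattenPow_eq_ntr_pow {A : Matrix n n ℝ} (hA : Aᵀ = A) (N : ℕ) :
    schattenPow (2 ^ N) A = ntr (A ^ 2 ^ (N + 1)) := by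
  rw [schattenPow, hA, ← sq, ← pow_mul, pow_succ']

omit [DecidableEq n] [Nonempty n] in
lemma HasSecondMomentBounds.const_smul {V : Type*} [MeasurableSpace V] {μ : Measure V}
    {Z : V → Matrix n n ℝ} (h : HasSecondMomentBounds μ Z σ κ)
    (c : ℝ) : HasSecondMomentBounds μ (fun v => c • Z v) (c ^ 2 * σ) (c ^ 2 * κ) where
  memLp i j := (h.memLp i j).const_mul c
  symm v := by rw [Matrix.transpose_smul, h.symm]
  variance_le x := by
    simp only [Matrix.smul_mulVec, Pi.smul_apply, smul_eq_mul, mul_pow, ← Finset.mul_sum]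
    rw [integral_const_mul, mul_assoc]
    exact mul_le_mul_of_nonneg_left (h.variance_le x) (sq_nonneg c)
  covariance_le B := by
    simp only [Matrix.smul_mul, Matrix.trace_smul, smul_eq_mul, mul_pow]
    rw [integral_const_mul, mul_assoc]
    exact mul_le_mul_of_nonneg_left (h.covariance_le B) (sq_nonneg c)

/-- The moment bound for symmetric Gaussian matrices: with `P = 2 ^ (N + 1)`, the `P`-th moment is
at most `(16 σ + P ^ 4 κ) ^ (P / 2)`. -/
theorem integral_schattenPow_le (hμ : ∫ x, id x ∂μ = 0) (L : V →L[ℝ] Matrix n n ℝ)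
    (h : HasSecondMomentBounds μ (fun v => L v) σ κ) (hσ : 0 < σ) (hκ : 0 < κ) (N : ℕ) :
    ∫ v, schattenPow (2 ^ N) (L v) ∂μ ≤ (16 * σ + (2 ^ (N + 1)) ^ 4 * κ) ^ 2 ^ N := by
  by_contra! hlt
  set P : ℕ := 2 ^ (N + 1) with hP
  have hPr : (2 ^ (N + 1) : ℝ) = P := by rw [hP]; push_cast; rfl
  rw [hPr] at hlt
  have hP0 : (0 : ℝ) < P := by rw [hP]; positivity
  set I := ∫ v, schattenPow (2 ^ N) (L v) ∂μ with hI
  set ρ : ℝ := 16 * σ + (P : ℝ) ^ 4 * κ with hρ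
  have hρ0 : 0 < ρ := by positivity
  have hI0 : 0 < I := lt_trans (by positivity) hlt
  -- the matrix is normalized by the square root `s` of `R`, so that its `P`-th moment is `1`
  set R : ℝ := I ^ (((2 ^ N : ℕ) : ℝ)⁻¹) with hR
  have hRpow : R ^ 2 ^ N = I := Real.rpow_inv_natCast_pow hI0.le (by positivity)
  have hR0 : 0 < R := by positivity
  have hρR : ρ < R := by
    by_contra! hle
    have : R ^ 2 ^ N ≤ ρ ^ 2 ^ N := pow_le_pow_left₀ hR0.le hle _
    rw [hRpow] at this
    exact absurd this (not_le.mpr hlt)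
  set s : ℝ := (√R)⁻¹ with hs
  have hs2 : s ^ 2 = R⁻¹ := by rw [hs, inv_pow, Real.sq_sqrt hR0.le]
  have hsym : ∀ v, (s • L v)ᵀ = s • L v := (h.const_smul s).symm
  have h' : HasSecondMomentBounds μ (fun v => (s • L) v) (R⁻¹ * σ) (R⁻¹ * κ) := by
    have := h.const_smul s
    rw [hs2] at this
    exact this
  have hint : ∫ v, schattenPow (2 ^ N) ((s • L) v) ∂μ = 1 := by
    have : ∀ v, schattenPow (2 ^ N) ((s • L) v) = I⁻¹ * schattenPow (2 ^ N) (L v) := by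
      intro v
      rw [schattenPow, schattenPow, _root_.smul_apply, Matrix.transpose_smul,
        Matrix.smul_mul, Matrix.mul_smul, smul_smul, smul_pow, ntr_smul, ← sq, hs2, inv_pow, hRpow]
    simp only [this]
    rw [integral_const_mul, inv_mul_cancel₀ hI0.ne']
  have hd := dualBound_expMatrix_pow hμ (s • L) h' (by positivity) (by positivity) hint.le P le_rfl
    [] (by simp [hP]) (by simp)
  rw [hPr] at hd
  have hone : ntr ((expMatrix μ fun v => (s • L) v ^ P) * ([] : List (Matrix n n ℝ)).prod) = 1 := by
    rw [ntr_expMatrix_mul fun i j =>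
      (((PolyGrowth.clm (s • L)).pow P).matrix_entry i j).integrable, ← hint]
    congr 1
    ext v
    rw [List.prod_nil, mul_one, schattenPow_eq_ntr_pow (h'.symm v)]
  rw [hone, abs_one] at hd
  refine absurd hd (not_le.mpr (momentMajorant_lt_one (by positivity) ?_ (by positivity) P ?_ ?_))
  · rw [inv_mul_le_iff₀ hR0]
    have : 0 < (P : ℝ) ^ 4 * κ := by positivity
    linarith
  · rw [hP, pow_succ]
    have := Nat.one_le_two_pow (n := N)
    omega
  · have h1 : 4 * ((P : ℝ) ^ 4 * κ * σ) ≤ R ^ 2 := by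
      have h2 : ρ ^ 2 ≤ R ^ 2 := pow_le_pow_left₀ hρ0.le hρR.le 2
      have h3 : 0 < (P : ℝ) ^ 4 * κ := by positivity
      nlinarith [mul_pos h3 hσ, sq_nonneg (16 * σ - (P : ℝ) ^ 4 * κ)]
    have h4 : (P : ℝ) * (2 * (P : ℝ) ^ 3 * (R⁻¹ * κ * (R⁻¹ * σ))) =
        2 * ((P : ℝ) ^ 4 * κ * σ) / R ^ 2 := by
      field_simp
    rw [h4, div_le_iff₀ (by positivity)]
    linarith

end Moments

/-! ### The operator norm of a Gaussian matrix -/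

section OperatorNorm

variable {m n : Type*} [Fintype m] [Fintype n] [DecidableEq n]

lemma sum_sq_mulVec_le (A : Matrix m n ℝ) (x : n → ℝ) :
    ∑ i, (A *ᵥ x) i ^ 2 ≤ ‖A‖ ^ 2 * ∑ i, x i ^ 2 := by
  have h := Matrix.l2_opNorm_mulVec A (WithLp.toLp 2 x)
  have h2 := pow_le_pow_left₀ (norm_nonneg _) h 2
  rw [mul_pow, EuclideanSpace.norm_sq_eq, EuclideanSpace.norm_sq_eq] at h2
  simpa using h2

lemma opNorm_sq_le_of_sum_sq_mulVec_le (A : Matrix m n ℝ) {c : ℝ} (hc : 0 ≤ c)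
    (h : ∀ x : n → ℝ, ∑ i, (A *ᵥ x) i ^ 2 ≤ c * ∑ i, x i ^ 2) : ‖A‖ ^ 2 ≤ c := by
  have h1 : ‖A‖ ≤ √c := by
    rw [Matrix.l2_opNorm_def]
    refine ContinuousLinearMap.opNorm_le_bound _ (Real.sqrt_nonneg _) fun x => ?_
    rw [EuclideanSpace.norm_eq, EuclideanSpace.norm_eq, ← Real.sqrt_mul hc]
    refine Real.sqrt_le_sqrt ?_
    simpa using h x.ofLp
  calc ‖A‖ ^ 2 ≤ √c ^ 2 := by gcongr
    _ = c := Real.sq_sqrt hc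

lemma opNorm_sq_le_sum_sq (A : Matrix m n ℝ) : ‖A‖ ^ 2 ≤ ∑ i, ∑ j, A i j ^ 2 := by
  refine opNorm_sq_le_of_sum_sq_mulVec_le A (by positivity) fun x => ?_
  rw [Finset.sum_mul]
  exact Finset.sum_le_sum fun i _ => Finset.sum_mul_sq_le_sq_mul_sq _ _ _

lemma dotProduct_mulVec_le (A : Matrix n n ℝ) (x : n → ℝ) :
    x ⬝ᵥ (A *ᵥ x) ≤ ‖A‖ * ∑ i, x i ^ 2 := by
  have h1 := Finset.sum_mul_sq_le_sq_mul_sq Finset.univ x (A *ᵥ x)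
  have h2 := sum_sq_mulVec_le A x
  have h0 : 0 ≤ ∑ i, x i ^ 2 := by positivity
  refine abs_le_of_sq_le_sq' ?_ (by positivity) |>.2
  calc (x ⬝ᵥ (A *ᵥ x)) ^ 2 ≤ (∑ i, x i ^ 2) * ∑ i, (A *ᵥ x) i ^ 2 := h1
    _ ≤ (∑ i, x i ^ 2) * (‖A‖ ^ 2 * ∑ i, x i ^ 2) := by gcongr
    _ = _ := by ring

/-- The operator norm of a symmetric matrix is controlled by its normalized Schatten norms. -/
lemma norm_pow_le_card_mul_schattenPow [Nonempty n] {A : Matrix n n ℝ} (hA : Aᵀ = A) (N : ℕ) :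
    (‖A‖ ^ 2) ^ 2 ^ N ≤ Fintype.card n * schattenPow (2 ^ N) A := by
  have hsa : IsSelfAdjoint A := by
    rw [IsSelfAdjoint, Matrix.star_eq_conjTranspose, Matrix.conjTranspose_eq_transpose_of_trivial,
      hA]
  have h1 : ‖A ^ 2 ^ N‖ = ‖A‖ ^ 2 ^ N := by
    have := congrArg NNReal.toReal (hsa.nnnorm_pow_two_pow N)
    simpa using this
  have h2 := opNorm_sq_le_sum_sq (A ^ 2 ^ N)
  rw [← trace_mul_transpose_eq_sum, Matrix.transpose_pow, hA, h1] at h2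
  have h3 : (Fintype.card n : ℝ) ≠ 0 := by exact_mod_cast Fintype.card_ne_zero
  rw [schattenPow, ntr, mul_div_cancel₀ _ h3, hA, ← pow_mul, mul_comm 2, pow_mul,
    (Commute.refl A).mul_pow]
  exact h2

end OperatorNorm

section GaussianNorm

variable {V : Type*} [NormedAddCommGroup V] [NormedSpace ℝ V]
  [MeasurableSpace V] [BorelSpace V] [CompleteSpace V]
  [SecondCountableTopology V] {μ : Measure V} [IsGaussian μ]

lemma pow_integral_le_integral_pow {V : Type*} [MeasurableSpace V] {μ : Measure V}
    [IsProbabilityMeasure μ] {f : V → ℝ} (hf : ∀ x, 0 ≤ f x) (k : ℕ) (h1 : Integrable f μ)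
    (hk : Integrable (fun x => f x ^ k) μ) : (∫ x, f x ∂μ) ^ k ≤ ∫ x, f x ^ k ∂μ :=
  (convexOn_pow k).map_integral_le (continuous_pow k).continuousOn isClosed_Ici
    (Filter.Eventually.of_forall hf) h1 hk

/-- The second moment of the operator norm of a symmetric Gaussian matrix, of size at most
`2 ^ P` with `P = 2 ^ (N + 1)`. -/
theorem integral_norm_sq_le_of_symm {n : Type*} [Fintype n] [DecidableEq n]
    [Nonempty n] (hμ : ∫ x, id x ∂μ = 0) (L : V →L[ℝ] Matrix n n ℝ) {σ κ : ℝ}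
    (h : HasSecondMomentBounds μ (fun v => L v) σ κ) (hσ : 0 ≤ σ) (hκ : 0 ≤ κ) (N : ℕ)
    (hn : Fintype.card n ≤ 4 ^ 2 ^ N) :
    ∫ v, ‖L v‖ ^ 2 ∂μ ≤ 4 * (16 * σ + (2 ^ (N + 1)) ^ 4 * κ) := by
  -- the moment bound requires positive parameters, so both are increased by `η`
  have key : ∀ η : ℝ, 0 < η →
      ∫ v, ‖L v‖ ^ 2 ∂μ ≤ 4 * (16 * (σ + η) + (2 ^ (N + 1)) ^ 4 * (κ + η)) := by
    intro η hη
    have h' : HasSecondMomentBounds μ (fun v => L v) (σ + η) (κ + η) :=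
      ⟨h.memLp, h.symm,
        fun x => (h.variance_le x).trans (mul_le_mul_of_nonneg_right (by linarith) (by positivity)),
        fun B => (h.covariance_le B).trans
          (mul_le_mul_of_nonneg_right (by linarith) (by positivity))⟩
    have h1 := integral_schattenPow_le hμ L h' (by linarith) (by linarith) N
    set ρ : ℝ := 16 * (σ + η) + (2 ^ (N + 1)) ^ 4 * (κ + η) with hρ
    have hρ0 : 0 < ρ := by positivity
    have pL : PolyGrowth fun v : V => L v := PolyGrowth.clm L
    have h2 := pow_integral_le_integral_pow (μ := μ) (f := fun v => ‖L v‖ ^ 2)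
      (fun v => by positivity) (2 ^ N) (pL.norm.pow 2).integrable
      ((pL.norm.pow 2).pow (2 ^ N)).integrable
    have h3 : ∫ v, (‖L v‖ ^ 2) ^ 2 ^ N ∂μ ≤
        ∫ v, Fintype.card n * schattenPow (2 ^ N) (L v) ∂μ :=
      integral_mono ((pL.norm.pow 2).pow (2 ^ N)).integrable
        ((pL.schattenPow (2 ^ N)).integrable.const_mul _)
        fun v => norm_pow_le_card_mul_schattenPow (h.symm v) N
    rw [integral_const_mul] at h3
    have h4 : (Fintype.card n : ℝ) ≤ 4 ^ 2 ^ N := by exact_mod_cast hn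
    have h5 : (∫ v, ‖L v‖ ^ 2 ∂μ) ^ 2 ^ N ≤ (4 * ρ) ^ 2 ^ N := by
      calc _ ≤ (Fintype.card n : ℝ) * ∫ v, schattenPow (2 ^ N) (L v) ∂μ := h2.trans h3
        _ ≤ 4 ^ 2 ^ N * ρ ^ 2 ^ N :=
          mul_le_mul h4 h1 (integral_nonneg fun v => schattenPow_nonneg _ _) (by positivity)
        _ = _ := (mul_pow _ _ _).symm
    exact le_of_pow_le_pow_left₀ (by positivity) (by positivity) h5
  refine le_of_forall_pos_le_add fun η hη => ?_
  set c : ℝ := 4 * (16 + (2 ^ (N + 1)) ^ 4) with hc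
  have hc0 : 0 < c := by positivity
  refine (key (η / c) (by positivity)).trans (le_of_eq ?_)
  have : η = c * (η / c) := by field_simp
  conv_rhs => rw [this]
  rw [hc]
  ring

/-- The symmetric dilation of a square matrix. -/
noncomputable def dilation {m : Type*} : Matrix m m ℝ →ₗ[ℝ] Matrix (m ⊕ m) (m ⊕ m) ℝ where
  toFun A := Matrix.fromBlocks 0 A Aᵀ 0
  map_add' A B := by simp [Matrix.fromBlocks_add]
  map_smul' c A := by simp [Matrix.fromBlocks_smul]

lemma dilation_apply {m : Type*} (A : Matrix m m ℝ) :
    dilation A = Matrix.fromBlocks 0 A Aᵀ 0 := rfl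

lemma norm_le_norm_dilation {m : Type*} [Fintype m] [DecidableEq m] (A : Matrix m m ℝ) :
    ‖A‖ ≤ ‖dilation A‖ := by
  have h : ‖A‖ ^ 2 ≤ ‖dilation A‖ ^ 2 := by
    refine opNorm_sq_le_of_sum_sq_mulVec_le A (by positivity) fun x => ?_
    have := sum_sq_mulVec_le (dilation A) (Sum.elim 0 x)
    rw [dilation_apply] at this ⊢
    rw [Matrix.fromBlocks_mulVec] at this
    simpa [Fintype.sum_sum_type] using this
  exact le_of_sq_le_sq h (norm_nonneg _)

/-- The second moment of the operator norm of a Gaussian matrix, in terms of bounds `a`, `b` and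
`κ` for `𝔼 XᵀX`, `𝔼 XXᵀ` and the covariance operator. -/
theorem integral_norm_sq_le {m : Type*} [Fintype m] [DecidableEq m] [Nonempty m]
    (hμ : ∫ x, id x ∂μ = 0) (A : V →L[ℝ] Matrix m m ℝ) {a b κ : ℝ} (ha0 : 0 ≤ a) (hb0 : 0 ≤ b)
    (hκ0 : 0 ≤ κ)
    (ha : ∀ x : m → ℝ, ∫ v, ∑ i, (A v *ᵥ x) i ^ 2 ∂μ ≤ a * ∑ i, x i ^ 2)
    (hb : ∀ x : m → ℝ, ∫ v, ∑ i, ((A v)ᵀ *ᵥ x) i ^ 2 ∂μ ≤ b * ∑ i, x i ^ 2)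
    (hκ : ∀ B : Matrix m m ℝ, ∫ v, (A v * B).trace ^ 2 ∂μ ≤ κ * ∑ i, ∑ j, B i j ^ 2)
    (N : ℕ) (hm : 2 * Fintype.card m ≤ 4 ^ 2 ^ N) :
    ∫ v, ‖A v‖ ^ 2 ∂μ ≤ 64 * (a + b) + 8 * (2 ^ (N + 1)) ^ 4 * κ := by
  set L : V →L[ℝ] Matrix (m ⊕ m) (m ⊕ m) ℝ :=
    (LinearMap.toContinuousLinearMap (dilation (m := m))).comp A with hL
  have hLv : ∀ v, L v = Matrix.fromBlocks 0 (A v) (A v)ᵀ 0 := fun v => rfl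
  have pA : PolyGrowth fun v : V => A v := PolyGrowth.clm A
  have pL : PolyGrowth fun v : V => L v := PolyGrowth.clm L
  have pmv : ∀ {f : V → Matrix m m ℝ}, PolyGrowth f → ∀ x : m → ℝ,
      PolyGrowth fun v => ∑ i, (f v *ᵥ x) i ^ 2 := by
    intro f hf x
    refine PolyGrowth.sum _ fun i _ => PolyGrowth.pow ?_ 2
    simp only [Matrix.mulVec, dotProduct]
    exact PolyGrowth.sum _ fun j _ => (hf.matrix_entry i j).mul (PolyGrowth.const _)
  have h : HasSecondMomentBounds μ (fun v => L v) (a + b) (2 * κ) := by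
    refine ⟨fun i j => (pL.matrix_entry i j).memLp_two, fun v => ?_, fun x => ?_, fun B => ?_⟩
    · rw [hLv, Matrix.fromBlocks_transpose]
      simp
    · have e : ∀ v, ∑ i, (L v *ᵥ x) i ^ 2 = ∑ i, (A v *ᵥ (x ∘ Sum.inr)) i ^ 2 +
          ∑ i, ((A v)ᵀ *ᵥ (x ∘ Sum.inl)) i ^ 2 := by
        intro v
        rw [hLv, Matrix.fromBlocks_mulVec]
        simp [Fintype.sum_sum_type]
      simp only [e]
      rw [integral_add (pmv pA _).integrable (pmv pA.transpose _).integrable,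
        Fintype.sum_sum_type]
      have h1 := ha (x ∘ Sum.inr)
      have h2 := hb (x ∘ Sum.inl)
      simp only [Function.comp_apply] at h1 h2
      have h3 : 0 ≤ ∑ i, x (Sum.inl i) ^ 2 := by positivity
      have h4 : 0 ≤ ∑ i, x (Sum.inr i) ^ 2 := by positivity
      nlinarith [mul_nonneg ha0 h3, mul_nonneg hb0 h4]
    · have e : ∀ v, (L v * B).trace = (A v * (B.toBlocks₂₁ + B.toBlocks₁₂ᵀ)).trace := by
        intro v
        conv_lhs => rw [hLv, ← Matrix.fromBlocks_toBlocks B]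
        rw [Matrix.fromBlocks_multiply]
        have htr : ∀ P Q R S : Matrix m m ℝ,
            (Matrix.fromBlocks P Q R S).trace = P.trace + S.trace := fun P Q R S => by
          simp [Matrix.trace, Fintype.sum_sum_type]
        rw [htr]
        simp only [Matrix.zero_mul, zero_add, add_zero]
        rw [mul_add, Matrix.trace_add, ← Matrix.trace_transpose ((A v)ᵀ * B.toBlocks₁₂),
          Matrix.transpose_mul, Matrix.transpose_transpose, Matrix.trace_mul_comm B.toBlocks₁₂ᵀ]
      simp only [e]
      refine (hκ _).trans ?_
      have h1 : ∑ i, ∑ j, (B.toBlocks₂₁ + B.toBlocks₁₂ᵀ) i j ^ 2 ≤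
          2 * (∑ i, ∑ j, B.toBlocks₂₁ i j ^ 2 + ∑ i, ∑ j, B.toBlocks₁₂ i j ^ 2) := by
        rw [Finset.sum_comm (f := fun i j => B.toBlocks₁₂ i j ^ 2), ← Finset.sum_add_distrib,
          Finset.mul_sum]
        refine Finset.sum_le_sum fun i _ => ?_
        rw [← Finset.sum_add_distrib, Finset.mul_sum]
        refine Finset.sum_le_sum fun j _ => ?_
        rw [Matrix.add_apply, Matrix.transpose_apply]
        nlinarith [sq_nonneg (B.toBlocks₂₁ i j - B.toBlocks₁₂ j i)]
      have h2 : ∑ i, ∑ j, B.toBlocks₂₁ i j ^ 2 + ∑ i, ∑ j, B.toBlocks₁₂ i j ^ 2 ≤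
          ∑ i, ∑ j, B i j ^ 2 := by
        simp only [Fintype.sum_sum_type, Matrix.toBlocks₂₁, Matrix.toBlocks₁₂, Matrix.of_apply,
          Finset.sum_add_distrib]
        have h3 : 0 ≤ ∑ i, ∑ j, B (Sum.inl i) (Sum.inl j) ^ 2 := by positivity
        have h4 : 0 ≤ ∑ i, ∑ j, B (Sum.inr i) (Sum.inr j) ^ 2 := by positivity
        linarith
      nlinarith
  have h1 := integral_norm_sq_le_of_symm hμ L h (by positivity) (by positivity) N
    (by rw [Fintype.card_sum]; omega)
  have h2 : ∫ v, ‖A v‖ ^ 2 ∂μ ≤ ∫ v, ‖L v‖ ^ 2 ∂μ :=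
    integral_mono (pA.norm.pow 2).integrable (pL.norm.pow 2).integrable fun v =>
      pow_le_pow_left₀ (norm_nonneg _) (norm_le_norm_dilation (A v)) 2
  linarith

end GaussianNorm

/-! ### Quadratic chaos of uncorrelated Gaussian matrices -/

section Orthogonality

variable {ι V : Type*} [Fintype ι] [MeasurableSpace V] {μ : Measure V}

lemma integral_sq_sum_of_orthogonal {f : ι → V → ℝ} (hf : ∀ r, MemLp (f r) 2 μ)
    (horth : ∀ r s, r ≠ s → ∫ v, f r v * f s v ∂μ = 0) :
    ∫ v, (∑ r, f r v) ^ 2 ∂μ = ∑ r, ∫ v, f r v ^ 2 ∂μ := by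
  have hi : ∀ r s, Integrable (fun v => f r v * f s v) μ := fun r s => (hf r).integrable_mul (hf s)
  simp only [sq, Finset.sum_mul_sum]
  rw [integral_finsetSum _ fun r _ => integrable_finsetSum _ fun s _ => hi r s]
  refine Finset.sum_congr rfl fun r _ => ?_
  rw [integral_finsetSum _ fun s _ => hi r s]
  exact Finset.sum_eq_single r (fun s _ hs => horth r s hs.symm) (by simp)

lemma integral_trace_mul_trace_eq_zero {m : Type*} [Fintype m] {A A' : V → Matrix m m ℝ}
    (hA : ∀ i j, MemLp (fun v => A v i j) 2 μ) (hA' : ∀ i j, MemLp (fun v => A' v i j) 2 μ)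
    (h : ∀ i j k l, ∫ v, A v i j * A' v k l ∂μ = 0) (B B' : Matrix m m ℝ) :
    ∫ v, (A v * B).trace * (A' v * B').trace ∂μ = 0 := by
  have e : ∀ v, (A v * B).trace * (A' v * B').trace =
      ∑ i, ∑ j, ∑ k, ∑ l, (B j i * B' l k) * (A v i j * A' v k l) := by
    intro v
    simp only [Matrix.trace, Matrix.diag_apply, Matrix.mul_apply, Finset.sum_mul]
    refine Finset.sum_congr rfl fun i _ => Finset.sum_congr rfl fun j _ => ?_
    simp only [Finset.mul_sum]
    exact Finset.sum_congr rfl fun k _ => Finset.sum_congr rfl fun l _ => by ring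
  have hi : ∀ i j k l, Integrable (fun v => (B j i * B' l k) * (A v i j * A' v k l)) μ :=
    fun i j k l => ((hA i j).integrable_mul (hA' k l)).const_mul _
  simp only [e]
  rw [integral_finsetSum _ fun i _ => integrable_finsetSum _ fun j _ =>
    integrable_finsetSum _ fun k _ => integrable_finsetSum _ fun l _ => hi i j k l]
  refine Finset.sum_eq_zero fun i _ => ?_
  rw [integral_finsetSum _ fun j _ =>
    integrable_finsetSum _ fun k _ => integrable_finsetSum _ fun l _ => hi i j k l]
  refine Finset.sum_eq_zero fun j _ => ?_
  rw [integral_finsetSum _ fun k _ => integrable_finsetSum _ fun l _ => hi i j k l]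
  refine Finset.sum_eq_zero fun k _ => ?_
  rw [integral_finsetSum _ fun l _ => hi i j k l]
  refine Finset.sum_eq_zero fun l _ => ?_
  rw [integral_const_mul, h, mul_zero]

lemma trace_mul_vecMulVec {m : Type*} [Fintype m] (A : Matrix m m ℝ) (x u : m → ℝ) :
    (A * Matrix.vecMulVec x u).trace = u ⬝ᵥ (A *ᵥ x) := by
  rw [Matrix.mul_vecMulVec, Matrix.trace_vecMulVec, dotProduct_comm]

end Orthogonality

section Chaos

variable {V : Type*} [NormedAddCommGroup V] [NormedSpace ℝ V]
variable {ι m : Type*} [Fintype ι] [Fintype m] [DecidableEq m]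

/-- The map `v ↦ ∑ U_rᵀ A_r(v)`: a sum of linear matrix-valued maps, with the transposes of fixed
matrices as weights. -/
noncomputable def weightedSum (A : ι → V →L[ℝ] Matrix m m ℝ) (U : ι → Matrix m m ℝ) :
    V →L[ℝ] Matrix m m ℝ :=
  ∑ r, (LinearMap.toContinuousLinearMap (LinearMap.mulLeft ℝ (U r)ᵀ)).comp (A r)

lemma weightedSum_apply (A : ι → V →L[ℝ] Matrix m m ℝ) (U : ι → Matrix m m ℝ) (v : V) :
    weightedSum A U v = ∑ r, (U r)ᵀ * A r v := by
  simp [weightedSum]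

lemma l2_opNorm_transpose (A : Matrix m m ℝ) : ‖Aᵀ‖ = ‖A‖ := by
  rw [← Matrix.conjTranspose_eq_transpose_of_trivial, Matrix.l2_opNorm_conjTranspose]

/-- The random matrix `A` satisfies `𝔼 ‖A x‖² ≤ a ‖x‖²` and `𝔼 ‖Aᵀ x‖² ≤ b ‖x‖²` for all vectors
`x`, and its covariance operator for the Frobenius inner product is at most `κ`. -/
structure CovarianceBounds {V : Type*} [MeasurableSpace V] (μ : Measure V)
    (A : V → Matrix m m ℝ) (a b κ : ℝ) : Prop where
  nonneg_left : 0 ≤ a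
  nonneg_right : 0 ≤ b
  nonneg_cov : 0 ≤ κ
  left_le (x : m → ℝ) : ∫ v, ∑ i, (A v *ᵥ x) i ^ 2 ∂μ ≤ a * ∑ i, x i ^ 2
  right_le (x : m → ℝ) : ∫ v, ∑ i, ((A v)ᵀ *ᵥ x) i ^ 2 ∂μ ≤ b * ∑ i, x i ^ 2
  cov_le (B : Matrix m m ℝ) : ∫ v, (A v * B).trace ^ 2 ∂μ ≤ κ * ∑ i, ∑ j, B i j ^ 2

lemma PolyGrowth.mulVec_entry {E : Type*} [NormedAddCommGroup E] {f : E → Matrix m m ℝ}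
    (hf : PolyGrowth f) (x : m → ℝ) (i : m) : PolyGrowth fun v => (f v *ᵥ x) i := by
  simp only [Matrix.mulVec, dotProduct]
  exact PolyGrowth.sum _ fun j _ => (hf.matrix_entry i j).mul (PolyGrowth.const _)

lemma PolyGrowth.trace_mul {E : Type*} [NormedAddCommGroup E] {f : E → Matrix m m ℝ}
    (hf : PolyGrowth f) (B : Matrix m m ℝ) : PolyGrowth fun v => (f v * B).trace := by
  have h : PolyGrowth fun v => f v * B := hf.mul (PolyGrowth.const B)
  exact PolyGrowth.sum _ fun i _ => h.matrix_entry i i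

variable [MeasurableSpace V] [BorelSpace V] [CompleteSpace V]
  [SecondCountableTopology V] {μ : Measure V} [IsGaussian μ]

/-- For fixed `U`, covariance bounds add up over uncorrelated matrices, with the squared norms of the fixed
factors as weights. -/
lemma CovarianceBounds.weightedSum {A : ι → V →L[ℝ] Matrix m m ℝ} {a b κ : ι → ℝ}
    (h : ∀ r, CovarianceBounds μ (fun v => A r v) (a r) (b r) (κ r))
    (horth : ∀ r s, r ≠ s → ∀ i j k l, ∫ v, A r v i j * A s v k l ∂μ = 0)
    (U : ι → Matrix m m ℝ) :
    CovarianceBounds μ (fun v => weightedSum A U v) (∑ r, ‖U r‖ ^ 2 * a r)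
      (∑ r, ‖U r‖ ^ 2 * b r) (∑ r, ‖U r‖ ^ 2 * κ r) := by
  have pA : ∀ r, PolyGrowth fun v : V => A r v := fun r => PolyGrowth.clm (A r)
  have orth : ∀ C : ι → Matrix m m ℝ, ∫ v, (∑ r, (A r v * C r).trace) ^ 2 ∂μ =
      ∑ r, ∫ v, (A r v * C r).trace ^ 2 ∂μ := fun C =>
    integral_sq_sum_of_orthogonal (fun r => ((pA r).trace_mul (C r)).memLp_two) fun r s hrs =>
      integral_trace_mul_trace_eq_zero (fun i j => ((pA r).matrix_entry i j).memLp_two)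
        (fun i j => ((pA s).matrix_entry i j).memLp_two) (horth r s hrs) _ _
  refine ⟨Finset.sum_nonneg fun r _ => mul_nonneg (by positivity) (h r).nonneg_left,
    Finset.sum_nonneg fun r _ => mul_nonneg (by positivity) (h r).nonneg_right,
    Finset.sum_nonneg fun r _ => mul_nonneg (by positivity) (h r).nonneg_cov,
    fun x => ?_, fun x => ?_, fun B => ?_⟩
  · have e : ∀ v i, (_root_.weightedSum A U v *ᵥ x) i =
        ∑ r, (A r v * Matrix.vecMulVec x fun k => U r k i).trace := by
      intro v i
      rw [weightedSum_apply, Matrix.sum_mulVec, Finset.sum_apply]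
      refine Finset.sum_congr rfl fun r _ => ?_
      rw [trace_mul_vecMulVec, ← Matrix.mulVec_mulVec]
      rfl
    have e2 : ∀ r v i, (A r v * Matrix.vecMulVec x fun k => U r k i).trace =
        ((U r)ᵀ *ᵥ (A r v *ᵥ x)) i := by
      intro r v i
      rw [trace_mul_vecMulVec]
      rfl
    have p2 : ∀ (r : ι) (i : m), PolyGrowth fun v : V =>
        (A r v * Matrix.vecMulVec x fun k => U r k i).trace ^ 2 := fun r i =>
      ((pA r).trace_mul _).pow 2
    simp only [e]
    rw [integral_finsetSum _ fun i _ =>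
      ((PolyGrowth.sum _ fun r _ => (pA r).trace_mul _).pow 2).integrable]
    simp only [orth]
    rw [Finset.sum_comm, Finset.sum_mul]
    refine Finset.sum_le_sum fun r _ => ?_
    rw [← integral_finsetSum _ fun i _ => (p2 r i).integrable]
    calc _ ≤ ∫ v, ‖U r‖ ^ 2 * ∑ i, (A r v *ᵥ x) i ^ 2 ∂μ := by
          refine integral_mono (PolyGrowth.sum _ fun i _ => p2 r i).integrable
            ((PolyGrowth.const _).mul (PolyGrowth.sum _ fun i _ =>
              ((pA r).mulVec_entry x i).pow 2)).integrable fun v => ?_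
          simp only [e2]
          rw [← l2_opNorm_transpose]
          exact sum_sq_mulVec_le _ _
      _ ≤ ‖U r‖ ^ 2 * (a r * ∑ i, x i ^ 2) := by
          rw [integral_const_mul]
          exact mul_le_mul_of_nonneg_left ((h r).left_le x) (by positivity)
      _ = _ := by ring
  · have e2 : ∀ r v i, (A r v * Matrix.vecMulVec (Pi.single i 1) (U r *ᵥ x)).trace =
        ((A r v)ᵀ *ᵥ (U r *ᵥ x)) i := by
      intro r v i
      rw [trace_mul_vecMulVec, Matrix.mulVec_single_one, dotProduct_comm]
      rfl
    have e : ∀ v i, ((_root_.weightedSum A U v)ᵀ *ᵥ x) i =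
        ∑ r, (A r v * Matrix.vecMulVec (Pi.single i 1) (U r *ᵥ x)).trace := by
      intro v i
      rw [weightedSum_apply, Matrix.transpose_sum, Matrix.sum_mulVec, Finset.sum_apply]
      refine Finset.sum_congr rfl fun r _ => ?_
      rw [e2, Matrix.transpose_mul, Matrix.transpose_transpose, Matrix.mulVec_mulVec]
    have p2 : ∀ (r : ι) (i : m), PolyGrowth fun v : V =>
        (A r v * Matrix.vecMulVec (Pi.single i 1) (U r *ᵥ x)).trace ^ 2 := fun r i =>
      ((pA r).trace_mul _).pow 2
    simp only [e]
    rw [integral_finsetSum _ fun i _ =>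
      ((PolyGrowth.sum _ fun r _ => (pA r).trace_mul _).pow 2).integrable]
    simp only [orth]
    rw [Finset.sum_comm, Finset.sum_mul]
    refine Finset.sum_le_sum fun r _ => ?_
    rw [← integral_finsetSum _ fun i _ => (p2 r i).integrable]
    simp only [e2]
    refine ((h r).right_le _).trans ?_
    calc _ ≤ b r * (‖U r‖ ^ 2 * ∑ i, x i ^ 2) :=
          mul_le_mul_of_nonneg_left (sum_sq_mulVec_le _ _) (h r).nonneg_right
      _ = _ := by ring
  · have e : ∀ v, (_root_.weightedSum A U v * B).trace = ∑ r, (A r v * (B * (U r)ᵀ)).trace := by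
      intro v
      rw [weightedSum_apply, Finset.sum_mul, Matrix.trace_sum]
      refine Finset.sum_congr rfl fun r _ => ?_
      rw [mul_assoc, Matrix.trace_mul_comm, mul_assoc]
    simp only [e]
    rw [orth, Finset.sum_mul]
    refine Finset.sum_le_sum fun r _ => ((h r).cov_le _).trans ?_
    have h1 : ∑ i, ∑ j, (B * (U r)ᵀ) i j ^ 2 ≤ ‖U r‖ ^ 2 * ∑ i, ∑ j, B i j ^ 2 := by
      rw [Finset.mul_sum]
      refine Finset.sum_le_sum fun i _ => ?_
      have h2 : ∀ j, (B * (U r)ᵀ) i j = (U r *ᵥ B i) j := by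
        intro j
        simp [Matrix.mul_apply, Matrix.mulVec, dotProduct, mul_comm]
      simp only [h2]
      exact sum_sq_mulVec_le _ _
    calc _ ≤ κ r * (‖U r‖ ^ 2 * ∑ i, ∑ j, B i j ^ 2) :=
          mul_le_mul_of_nonneg_left h1 (h r).nonneg_cov
      _ = _ := by ring

/-- The second moment of the decoupled quadratic chaos: conditionally on the first copy it is the
norm of a Gaussian matrix. -/
lemma integral_norm_sq_weightedSum_le [Nonempty m] (hμ : ∫ x, id x ∂μ = 0)
    {A : ι → V →L[ℝ] Matrix m m ℝ} {a b κ : ι → ℝ}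
    (h : ∀ r, CovarianceBounds μ (fun v => A r v) (a r) (b r) (κ r))
    (horth : ∀ r s, r ≠ s → ∀ i j k l, ∫ v, A r v i j * A s v k l ∂μ = 0)
    (N : ℕ) (hm : 2 * Fintype.card m ≤ 4 ^ 2 ^ N) :
    ∫ p : V × V, ‖∑ r, (A r p.1)ᵀ * A r p.2‖ ^ 2 ∂(μ.prod μ) ≤
      ∑ r, (64 * (a r + b r) + 8 * (2 ^ (N + 1)) ^ 4 * κ r) ^ 2 := by
  have pA : ∀ r, PolyGrowth fun v : V => A r v := fun r => PolyGrowth.clm (A r)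
  have pZ : PolyGrowth fun p : V × V => ‖∑ r, (A r p.1)ᵀ * A r p.2‖ ^ 2 :=
    (PolyGrowth.sum _ fun r _ => (((pA r).comp PolyGrowth.fst).transpose.mul
      ((pA r).comp PolyGrowth.snd))).norm.pow 2
  set g : ι → ℝ := fun r => 64 * (a r + b r) + 8 * (2 ^ (N + 1)) ^ 4 * κ r with hg
  have hg0 : ∀ r, 0 ≤ g r := fun r => by
    have h1 := (h r).nonneg_left
    have h2 := (h r).nonneg_right
    have h3 := (h r).nonneg_cov
    simp only [hg]
    positivity
  have single : ∀ r, ∫ v, ‖A r v‖ ^ 2 ∂μ ≤ g r := fun r =>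
    integral_norm_sq_le hμ (A r) (h r).nonneg_left (h r).nonneg_right (h r).nonneg_cov
      (h r).left_le (h r).right_le (h r).cov_le N hm
  have cond : ∀ w, ∫ v, ‖∑ r, (A r w)ᵀ * A r v‖ ^ 2 ∂μ ≤ ∑ r, ‖A r w‖ ^ 2 * g r := by
    intro w
    have hw := CovarianceBounds.weightedSum h horth fun r => A r w
    have h1 := integral_norm_sq_le hμ (weightedSum A fun r => A r w) hw.nonneg_left hw.nonneg_right
      hw.nonneg_cov hw.left_le hw.right_le hw.cov_le N hm
    simp only [weightedSum_apply] at h1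
    refine h1.trans (le_of_eq ?_)
    simp only [hg, ← Finset.sum_add_distrib, Finset.mul_sum]
    exact Finset.sum_congr rfl fun r _ => by ring
  rw [integral_prod _ pZ.integrable]
  calc _ ≤ ∫ w, ∑ r, ‖A r w‖ ^ 2 * g r ∂μ :=
        integral_mono pZ.integrable.integral_prod_left (PolyGrowth.sum _ fun r _ =>
          ((pA r).norm.pow 2).mul (PolyGrowth.const _)).integrable cond
    _ = ∑ r, (∫ w, ‖A r w‖ ^ 2 ∂μ) * g r := by
        rw [integral_finsetSum _ fun r _ => (((pA r).norm.pow 2).mul (PolyGrowth.const _)).integrable]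
        exact Finset.sum_congr rfl fun r _ => integral_mul_const _ _
    _ ≤ ∑ r, g r ^ 2 := Finset.sum_le_sum fun r _ => by
        rw [sq]
        exact mul_le_mul_of_nonneg_right (single r) (hg0 r)

lemma expMatrix_eq_integral {Y : V → Matrix m m ℝ} (hY : PolyGrowth Y) :
    expMatrix μ Y = ∫ v, Y v ∂μ := by
  ext i j
  exact ((LinearMap.toContinuousLinearMap
    (Matrix.entryLinearMap ℝ ℝ i j)).integral_comp_comm hY.integrable)

/-- The quadratic chaos is controlled by its decoupled version: symmetrize with an independent
copy and rotate the pair by the angle `π / 4`. -/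
lemma integral_norm_sub_expMatrix_le (hμ : ∫ x, id x ∂μ = 0) (A : ι → V →L[ℝ] Matrix m m ℝ) :
    ∫ v, ‖∑ r, ((A r v)ᵀ * A r v - expMatrix μ fun w => (A r w)ᵀ * A r w)‖ ∂μ ≤
      2 * ∫ p : V × V, ‖∑ r, (A r p.1)ᵀ * A r p.2‖ ∂(μ.prod μ) := by
  have pA : ∀ r, PolyGrowth fun v : V => A r v := fun r => PolyGrowth.clm (A r)
  have pr : ∀ r, PolyGrowth fun v : V => (A r v)ᵀ * A r v := fun r => (pA r).transpose.mul (pA r)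
  set q : V → Matrix m m ℝ := fun v => ∑ r, (A r v)ᵀ * A r v with hq
  have pq : PolyGrowth q := PolyGrowth.sum _ fun r _ => pr r
  have pneg : PolyGrowth fun v => -q v := pq.of_le pq.1.neg 1 zero_le_one fun v => by simp
  have pd : PolyGrowth fun p : V × V => ‖q p.1 - q p.2‖ := by
    simp only [sub_eq_add_neg]
    exact ((pq.comp PolyGrowth.fst).add (pneg.comp PolyGrowth.snd)).norm
  have pZ : PolyGrowth fun p : V × V => ‖∑ r, (A r p.1)ᵀ * A r p.2‖ :=
    (PolyGrowth.sum _ fun r _ => (((pA r).comp PolyGrowth.fst).transpose.mul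
      ((pA r).comp PolyGrowth.snd))).norm
  have h1 : ∀ v, ∑ r, ((A r v)ᵀ * A r v - expMatrix μ fun w => (A r w)ᵀ * A r w) =
      ∫ w, (q v - q w) ∂μ := by
    intro v
    rw [integral_sub (integrable_const _) pq.integrable, integral_const, probReal_univ, one_smul,
      Finset.sum_sub_distrib, hq, integral_finsetSum _ fun r _ => (pr r).integrable]
    simp only [expMatrix_eq_integral (pr _)]
  have h2 : ∫ v, ‖∫ w, (q v - q w) ∂μ‖ ∂μ ≤ ∫ p : V × V, ‖q p.1 - q p.2‖ ∂(μ.prod μ) := by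
    rw [integral_prod _ pd.integrable]
    refine integral_mono_of_nonneg (Filter.Eventually.of_forall fun v => norm_nonneg _)
      pd.integrable.integral_prod_left
      (Filter.Eventually.of_forall fun v => norm_integral_le_integral_norm _)
  -- at the angle `π / 4` the cosine and the sine agree
  have hrot := integral_rotation hμ (Real.pi / 4) pd.1
  rw [Real.cos_pi_div_four, Real.sin_pi_div_four] at hrot
  have h3 : ∀ x y : V, ‖q ((√2 / 2) • x + (√2 / 2) • y) - q (-(√2 / 2) • x + (√2 / 2) • y)‖ ≤
      2 * ‖∑ r, (A r x)ᵀ * A r y‖ := by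
    intro x y
    -- the diagonal terms cancel, and the mixed terms have the coefficient `2 * (1 / 2)`
    have e : q ((√2 / 2) • x + (√2 / 2) • y) - q (-(√2 / 2) • x + (√2 / 2) • y) =
        (∑ r, (A r x)ᵀ * A r y) + (∑ r, (A r x)ᵀ * A r y)ᵀ := by
      have hc : √2 / 2 * (√2 / 2) = (1 / 2 : ℝ) := by
        have := Real.mul_self_sqrt (show (0 : ℝ) ≤ 2 by norm_num)
        linarith
      simp only [hq]
      rw [Matrix.transpose_sum, ← Finset.sum_sub_distrib, ← Finset.sum_add_distrib]
      refine Finset.sum_congr rfl fun r _ => ?_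
      simp only [map_add, map_smul, Matrix.transpose_add, Matrix.transpose_smul, mul_add, add_mul,
        smul_mul_smul_comm, Matrix.transpose_mul, Matrix.transpose_transpose, neg_mul, mul_neg, hc]
      module
    rw [e, two_mul]
    exact (norm_add_le _ _).trans (by rw [l2_opNorm_transpose])
  simp only [h1]
  refine h2.trans ?_
  rw [← hrot, ← integral_const_mul]
  refine integral_mono_of_nonneg (Filter.Eventually.of_forall fun p => norm_nonneg _)
    ((PolyGrowth.const _).mul pZ).integrable
    (Filter.Eventually.of_forall fun p => h3 p.1 p.2)

/-- The expected norm of a centered quadratic chaos of uncorrelated Gaussian matrices. -/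
theorem integral_norm_chaos_le [Nonempty m] (hμ : ∫ x, id x ∂μ = 0)
    {A : ι → V →L[ℝ] Matrix m m ℝ} {a b κ : ι → ℝ}
    (h : ∀ r, CovarianceBounds μ (fun v => A r v) (a r) (b r) (κ r))
    (horth : ∀ r s, r ≠ s → ∀ i j k l, ∫ v, A r v i j * A s v k l ∂μ = 0)
    (N : ℕ) (hm : 2 * Fintype.card m ≤ 4 ^ 2 ^ N) :
    ∫ v, ‖∑ r, ((A r v)ᵀ * A r v - expMatrix μ fun w => (A r w)ᵀ * A r w)‖ ∂μ ≤
      2 * √(∑ r, (64 * (a r + b r) + 8 * (2 ^ (N + 1)) ^ 4 * κ r) ^ 2) := by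
  have pA : ∀ r, PolyGrowth fun v : V => A r v := fun r => PolyGrowth.clm (A r)
  have pZ : PolyGrowth fun p : V × V => ‖∑ r, (A r p.1)ᵀ * A r p.2‖ :=
    (PolyGrowth.sum _ fun r _ => (((pA r).comp PolyGrowth.fst).transpose.mul
      ((pA r).comp PolyGrowth.snd))).norm
  refine (integral_norm_sub_expMatrix_le hμ A).trans ?_
  refine mul_le_mul_of_nonneg_left (Real.le_sqrt_of_sq_le ?_) zero_le_two
  exact (pow_integral_le_integral_pow (fun p => norm_nonneg _) 2 pZ.integrable
    (pZ.pow 2).integrable).trans (integral_norm_sq_weightedSum_le hμ h horth N hm)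

end Chaos

/-! ### Independent centered Gaussian matrices -/

section Transfer

variable {Ω V : Type*} [MeasurableSpace Ω] [TopologicalSpace V]
  [MeasurableSpace V] [BorelSpace V] {P : Measure Ω} {w : Ω → V}

lemma expMatrix_map {m n : Type*} (hw : AEMeasurable w P) {f : V → Matrix m n ℝ}
    (hf : ∀ i j, Continuous fun v => f v i j) :
    expMatrix (P.map w) f = expMatrix P fun ω => f (w ω) := by
  ext i j
  exact integral_map hw (hf i j).aestronglyMeasurable

lemma tensorSecondMoment_map {d : ℕ} (hw : AEMeasurable w P) {f : V → Matrix (Fin d) (Fin d) ℝ}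
    (hf : ∀ i j, Continuous fun v => f v i j) :
    tensorSecondMoment (P.map w) f = tensorSecondMoment P fun ω => f (w ω) := by
  ext p q
  exact integral_map hw ((hf p.1 p.2).mul (hf q.1 q.2)).aestronglyMeasurable

end Transfer

section TensorNorm

variable {Ω : Type*} [MeasurableSpace Ω] {P : Measure Ω} {d : ℕ}

lemma integral_sum_sq_mulVec_le {m n : Type*} [Fintype m] [Fintype n] [DecidableEq n]
    {Y : Ω → Matrix m n ℝ} (hY : ∀ i j, MemLp (fun ω => Y ω i j) 2 P) (x : n → ℝ) :
    ∫ ω, ∑ i, (Y ω *ᵥ x) i ^ 2 ∂P ≤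
      ‖expMatrix P fun ω => (Y ω)ᵀ * Y ω‖ * ∑ i, x i ^ 2 := by
  have e : ∀ ω, ∑ i, (Y ω *ᵥ x) i ^ 2 = ∑ j, ∑ k, x j * (((Y ω)ᵀ * Y ω) j k * x k) := by
    intro ω
    have h1 : ∑ i, (Y ω *ᵥ x) i ^ 2 = x ⬝ᵥ (((Y ω)ᵀ * Y ω) *ᵥ x) := by
      rw [← Matrix.mulVec_mulVec, Matrix.dotProduct_mulVec, Matrix.vecMul_transpose]
      simp [dotProduct, sq]
    rw [h1]
    simp only [dotProduct, Matrix.mulVec, Finset.mul_sum]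
  have hi : ∀ j k, Integrable (fun ω => ((Y ω)ᵀ * Y ω) j k) P := fun j k => by
    simp only [Matrix.mul_apply, Matrix.transpose_apply]
    exact integrable_finsetSum _ fun i _ => (hY i j).integrable_mul (hY i k)
  have h2 : ∫ ω, ∑ i, (Y ω *ᵥ x) i ^ 2 ∂P =
      x ⬝ᵥ ((expMatrix P fun ω => (Y ω)ᵀ * Y ω) *ᵥ x) := by
    simp only [e]
    rw [integral_finsetSum _ fun j _ => integrable_finsetSum _ fun k _ =>
      ((hi j k).mul_const _).const_mul _]
    simp only [dotProduct, Matrix.mulVec, Finset.mul_sum]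
    refine Finset.sum_congr rfl fun j _ => ?_
    rw [integral_finsetSum _ fun k _ => ((hi j k).mul_const _).const_mul _]
    refine Finset.sum_congr rfl fun k _ => ?_
    rw [integral_const_mul, integral_mul_const]
    rfl
  rw [h2]
  exact dotProduct_mulVec_le _ x

lemma integral_sq_trace_mul_le {Y : Ω → Matrix (Fin d) (Fin d) ℝ}
    (hY : ∀ i j, MemLp (fun ω => Y ω i j) 2 P) (B : Matrix (Fin d) (Fin d) ℝ) :
    ∫ ω, (Y ω * B).trace ^ 2 ∂P ≤ ‖tensorSecondMoment P Y‖ * ∑ i, ∑ j, B i j ^ 2 := by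
  set x : Fin d × Fin d → ℝ := fun p => B p.2 p.1 with hx
  have e : ∀ ω, (Y ω * B).trace ^ 2 =
      ∑ p : Fin d × Fin d, ∑ q : Fin d × Fin d, x p * (Y ω p.1 p.2 * Y ω q.1 q.2 * x q) := by
    intro ω
    have h1 : (Y ω * B).trace = ∑ p : Fin d × Fin d, x p * Y ω p.1 p.2 := by
      rw [Fintype.sum_prod_type]
      simp [Matrix.trace, Matrix.mul_apply, hx, mul_comm]
    rw [h1, sq, Finset.sum_mul_sum]
    exact Finset.sum_congr rfl fun p _ => Finset.sum_congr rfl fun q _ => by ring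
  have hi : ∀ p q : Fin d × Fin d, Integrable (fun ω => Y ω p.1 p.2 * Y ω q.1 q.2) P :=
    fun p q => (hY _ _).integrable_mul (hY _ _)
  have h2 : ∫ ω, (Y ω * B).trace ^ 2 ∂P = x ⬝ᵥ (tensorSecondMoment P Y *ᵥ x) := by
    simp only [e]
    rw [integral_finsetSum _ fun j _ => integrable_finsetSum _ fun k _ =>
      ((hi j k).mul_const _).const_mul _]
    simp only [dotProduct, Matrix.mulVec, Finset.mul_sum]
    refine Finset.sum_congr rfl fun j _ => ?_
    rw [integral_finsetSum _ fun k _ => ((hi j k).mul_const _).const_mul _]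
    refine Finset.sum_congr rfl fun k _ => ?_
    rw [integral_const_mul, integral_mul_const]
    rfl
  have h3 : ∑ p, x p ^ 2 = ∑ i, ∑ j, B i j ^ 2 := by
    rw [Fintype.sum_prod_type, Finset.sum_comm]
  rw [h2, ← h3]
  exact dotProduct_mulVec_le _ x

lemma covarianceBounds {Y : Ω → Matrix (Fin d) (Fin d) ℝ}
    (hY : ∀ i j, MemLp (fun ω => Y ω i j) 2 P) :
    CovarianceBounds P Y ‖expMatrix P fun ω => (Y ω)ᵀ * Y ω‖
      ‖expMatrix P fun ω => Y ω * (Y ω)ᵀ‖ ‖tensorSecondMoment P Y‖ := by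
  refine ⟨norm_nonneg _, norm_nonneg _, norm_nonneg _, integral_sum_sq_mulVec_le hY, fun x => ?_,
    integral_sq_trace_mul_le hY⟩
  have := integral_sum_sq_mulVec_le (Y := fun ω => (Y ω)ᵀ) (fun i j => hY j i) x
  simpa only [Matrix.transpose_transpose] using this

end TensorNorm

section Dimension

/-- A moment of order `2 ^ (N + 1)`, comparable to `log d`, suffices in dimension `d`, and its
powers are absorbed by any positive power of `d`. -/
lemma exists_moment_order (ε : ℝ) (hε : 0 < ε) : ∃ K : ℝ, 1 ≤ K ∧ ∀ d : ℕ, 1 ≤ d →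
    ∃ N : ℕ, 2 * d ≤ 4 ^ 2 ^ N ∧ ((2 : ℝ) ^ (N + 1)) ^ 8 ≤ K * (d : ℝ) ^ ε := by
  have h16 : 0 ≤ 16 / ε := by positivity
  refine ⟨(4 * (16 / ε + 1)) ^ 8, one_le_pow₀ (by linarith), fun d hd => ?_⟩
  set m : ℕ := Nat.log 2 d + 1 with hm
  refine ⟨Nat.clog 2 m, ?_, ?_⟩
  · have h1 : d < 2 ^ m := Nat.lt_pow_succ_log_self one_lt_two d
    have h2 : m ≤ 2 ^ Nat.clog 2 m := Nat.le_pow_clog one_lt_two m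
    have h3 : (4 : ℕ) ^ m = 2 ^ m * 2 ^ m := by rw [← mul_pow]; rfl
    have h4 : 2 ≤ 2 ^ m := by
      calc 2 = 2 ^ 1 := rfl
        _ ≤ 2 ^ m := Nat.pow_le_pow_right (by norm_num) (by omega)
    calc 2 * d ≤ 4 ^ m := by rw [h3]; exact Nat.mul_le_mul h4 h1.le
      _ ≤ _ := Nat.pow_le_pow_right (by norm_num) h2
  · have h1 : 2 ^ Nat.clog 2 m ≤ 2 * m := by
      rcases Nat.lt_or_ge 1 m with h | h
      · have h2 := Nat.pow_pred_clog_lt_self one_lt_two h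
        have h3 : 0 < Nat.clog 2 m := Nat.clog_pos one_lt_two h
        obtain ⟨k, hk⟩ := Nat.exists_eq_succ_of_ne_zero h3.ne'
        rw [hk] at h2 ⊢
        rw [Nat.pow_succ]
        simp only [Nat.succ_eq_add_one, Nat.pred_succ] at h2
        omega
      · have : m = 1 := by omega
        rw [this]
        simp
    have hd1 : (1 : ℝ) ≤ d := by exact_mod_cast hd
    set y : ℝ := (d : ℝ) ^ (ε / 8) with hy
    have hy1 : 1 ≤ y := Real.one_le_rpow hd1 (by positivity)
    have hlog0 : 0 ≤ Real.log d := Real.log_nonneg hd1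
    have h2 : (Nat.log 2 d : ℝ) ≤ 2 * Real.log d := by
      have h := Real.natLog_le_logb d 2
      rw [Real.logb] at h
      refine h.trans ?_
      have hl2 : (0.6931471803 : ℝ) < Real.log 2 := Real.log_two_gt_d9
      push_cast
      rw [div_le_iff₀ (by linarith)]
      nlinarith
    -- the exponent `ε / 8` turns into `ε` in the eighth power
    have h3 : Real.log d ≤ y / (ε / 8) :=
      Real.log_le_rpow_div (by positivity) (by positivity)
    have h4 : (m : ℝ) ≤ (16 / ε + 1) * y := by
      have e : 2 * (y / (ε / 8)) = 16 / ε * y := by field_simp; norm_num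
      rw [hm]
      push_cast
      linarith
    have h5 : (2 : ℝ) ^ (Nat.clog 2 m + 1) ≤ 4 * (16 / ε + 1) * y := by
      have : (2 : ℝ) ^ Nat.clog 2 m ≤ 2 * m := by exact_mod_cast h1
      rw [pow_succ]
      linarith
    have h6 : y ^ 8 = (d : ℝ) ^ ε := by
      rw [hy, ← Real.rpow_natCast, ← Real.rpow_mul (by positivity)]
      congr 1
      push_cast
      ring
    calc _ ≤ (4 * (16 / ε + 1) * y) ^ 8 := pow_le_pow_left₀ (by positivity) h5 8
      _ = _ := by rw [mul_pow, h6]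

end Dimension

section GaussianSum

/-- The `r`-th matrix of a family of `M` matrices given by the vectors of their entries. -/
noncomputable def matrixOfEntries {d M : ℕ} (r : Fin M) :
    (Fin M → Fin d × Fin d → ℝ) →L[ℝ] Matrix (Fin d) (Fin d) ℝ :=
  LinearMap.toContinuousLinearMap
    { toFun := fun v => Matrix.of fun i j => v r (i, j)
      map_add' := fun _ _ => rfl
      map_smul' := fun _ _ => rfl }

variable {d M : ℕ} {Ω : Type*} [MeasurableSpace Ω] {P : Measure Ω}
  {X : Fin M → Ω → Matrix (Fin d) (Fin d) ℝ}

lemma integral_entry_mul_entry_eq_zero (hX : ∀ r, IsCenteredGaussianMatrix P (X r))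
    (hind : iIndepFun (fun r ω => entries (X r ω)) P) {r s : Fin M} (hrs : r ≠ s)
    (i j k l : Fin d) : ∫ ω, X r ω i j * X s ω k l ∂P = 0 := by
  have hm : ∀ r (i j : Fin d), AEStronglyMeasurable (fun ω => X r ω i j) P := fun r i j =>
    ((measurable_pi_apply (i, j)).comp_aemeasurable
      (hX r).jointly_gaussian.aemeasurable).aestronglyMeasurable
  have h : IndepFun (fun ω => X r ω i j) (fun ω => X s ω k l) P :=
    (hind.indepFun hrs).comp (measurable_pi_apply (i, j)) (measurable_pi_apply (k, l))
  have h0 : ∫ ω, X r ω i j ∂P = 0 := congrFun (congrFun (hX r).mean_zero i) j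
  rw [h.integral_fun_mul_eq_mul_integral (hm r i j) (hm s k l), h0, zero_mul]

/-- The bound for independent centered Gaussian matrices, with the moment order as a parameter. -/
theorem integral_norm_sum_le [IsProbabilityMeasure P] [NeZero d]
    (hX : ∀ r, IsCenteredGaussianMatrix P (X r))
    (hind : iIndepFun (fun r ω => entries (X r ω)) P) (N : ℕ) (hN : 2 * d ≤ 4 ^ 2 ^ N) :
    Integrable (fun ω => ‖∑ r, ((X r ω)ᵀ * X r ω
        - expMatrix P (fun ω' => (X r ω')ᵀ * X r ω'))‖) P ∧
    ∫ ω, ‖∑ r, ((X r ω)ᵀ * X r ω - expMatrix P (fun ω' => (X r ω')ᵀ * X r ω'))‖ ∂P ≤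
      2 * √(∑ r, (64 * (‖expMatrix P (fun ω => (X r ω)ᵀ * X r ω)‖
        + ‖expMatrix P (fun ω => X r ω * (X r ω)ᵀ)‖)
        + 8 * (2 ^ (N + 1)) ^ 4 * ‖tensorSecondMoment P (X r)‖) ^ 2) := by
  have hw : HasGaussianLaw (fun ω r => entries (X r ω)) P :=
    hind.hasGaussianLaw fun r => (hX r).jointly_gaussian
  set w : Ω → Fin M → Fin d × Fin d → ℝ := fun ω r => entries (X r ω) with hwdef
  have hwm : AEMeasurable w P := hw.aemeasurable
  have : IsGaussian (P.map w) := hw.isGaussian_map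
  have hAw : ∀ r ω, matrixOfEntries r (w ω) = X r ω := fun r ω => rfl
  have pA : ∀ r, PolyGrowth fun v => matrixOfEntries (d := d) (M := M) r v := fun r =>
    PolyGrowth.clm _
  have hμ : ∫ x, id x ∂(P.map w) = 0 := by
    rw [integral_map hwm (by fun_prop)]
    ext r p
    have hint : Integrable w P := hw.integrable
    simp only [id]
    rw [eval_integral fun r => hint.eval r,
      eval_integral fun p => (hint.eval r).eval p]
    exact congrFun (congrFun (hX r).mean_zero p.1) p.2
  have e1 : ∀ r, expMatrix (P.map w) (fun v => (matrixOfEntries r v)ᵀ * matrixOfEntries r v) =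
      expMatrix P fun ω => (X r ω)ᵀ * X r ω := fun r =>
    expMatrix_map hwm fun i j => (((pA r).transpose.mul (pA r)).matrix_entry i j).1
  have e2 : ∀ r, expMatrix (P.map w) (fun v => matrixOfEntries r v * (matrixOfEntries r v)ᵀ) =
      expMatrix P fun ω => X r ω * (X r ω)ᵀ := fun r =>
    expMatrix_map hwm fun i j => (((pA r).mul (pA r).transpose).matrix_entry i j).1
  have e3 : ∀ r, tensorSecondMoment (P.map w) (fun v => matrixOfEntries r v) =
      tensorSecondMoment P (X r) := fun r =>
    tensorSecondMoment_map hwm fun i j => ((pA r).matrix_entry i j).1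
  have hb : ∀ r, CovarianceBounds (P.map w) (fun v => matrixOfEntries (d := d) r v)
      ‖expMatrix P fun ω => (X r ω)ᵀ * X r ω‖ ‖expMatrix P fun ω => X r ω * (X r ω)ᵀ‖
      ‖tensorSecondMoment P (X r)‖ := fun r => by
    rw [← e1, ← e2, ← e3]
    exact covarianceBounds fun i j => ((pA r).matrix_entry i j).memLp_two
  have horth : ∀ r s, r ≠ s → ∀ i j k l,
      ∫ v, matrixOfEntries r v i j * matrixOfEntries s v k l ∂(P.map w) = 0 := by
    intro r s hrs i j k l
    rw [integral_map hwm (((pA r).matrix_entry i j).mul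
      ((pA s).matrix_entry k l)).1.aestronglyMeasurable]
    exact integral_entry_mul_entry_eq_zero hX hind hrs i j k l
  have hd : Nonempty (Fin d) := ⟨0⟩
  have main := integral_norm_chaos_le hμ hb horth N (by rwa [Fintype.card_fin])
  simp only [e1] at main
  have pF : PolyGrowth fun v : Fin M → Fin d × Fin d → ℝ =>
      ‖∑ r, ((matrixOfEntries r v)ᵀ * matrixOfEntries r v -
        expMatrix P fun ω => (X r ω)ᵀ * X r ω)‖ := by
    simp only [sub_eq_add_neg]
    exact (PolyGrowth.sum _ fun r _ => ((pA r).transpose.mul (pA r)).add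
      (PolyGrowth.const _)).norm
  have hint := (pF.integrable (ν := P.map w)).comp_aemeasurable hwm
  rw [integral_map hwm pF.1.aestronglyMeasurable] at main
  simp only [Function.comp_def, hAw] at hint main
  exact ⟨hint, main⟩

end GaussianSum

theorem theorem3 (ε : ℝ) (hε : 0 < ε) :
    ∃ C : ℝ, 0 < C ∧
      ∀ (d M : ℕ) (Ω : Type*) [MeasurableSpace Ω] (P : Measure Ω) [IsProbabilityMeasure P]
        (X : Fin M → Ω → Matrix (Fin d) (Fin d) ℝ),
        (∀ r, IsCenteredGaussianMatrix P (X r)) →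
        iIndepFun (fun r ω => entries (X r ω)) P →
        Integrable (fun ω => ‖∑ r, ((X r ω)ᵀ * X r ω
            - expMatrix P (fun ω' => (X r ω')ᵀ * X r ω'))‖) P ∧
        ∫ ω, ‖∑ r, ((X r ω)ᵀ * X r ω - expMatrix P (fun ω' => (X r ω')ᵀ * X r ω'))‖ ∂P
          ≤ C * √(∑ r, (‖expMatrix P (fun ω => (X r ω)ᵀ * X r ω)‖ ^ 2
              + ‖expMatrix P (fun ω => X r ω * (X r ω)ᵀ)‖ ^ 2
              + (d : ℝ) ^ ε * ‖tensorSecondMoment P (X r)‖ ^ 2)) := by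
  obtain ⟨K, hK1, hK⟩ := exists_moment_order ε hε
  refine ⟨2 * √(12288 * K), by positivity, fun d M Ω _ P _ X hX hind => ?_⟩
  -- in dimension `0` all norms vanish
  rcases Nat.eq_zero_or_pos d with rfl | hd
  · have h0 : ∀ A : Matrix (Fin 0) (Fin 0) ℝ, ‖A‖ = 0 := fun A => by
      rw [Subsingleton.elim A 0, norm_zero]
    simp only [h0, integral_zero]
    exact ⟨integrable_zero _ _ _, by positivity⟩
  · have : NeZero d := ⟨hd.ne'⟩
    obtain ⟨N, hN, hNK⟩ := hK d hd
    obtain ⟨hint, hle⟩ := integral_norm_sum_le hX hind N hN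
    refine ⟨hint, hle.trans ?_⟩
    rw [mul_assoc, ← Real.sqrt_mul (by positivity), Finset.mul_sum]
    refine mul_le_mul_of_nonneg_left (Real.sqrt_le_sqrt (Finset.sum_le_sum fun r _ => ?_))
      zero_le_two
    generalize ‖expMatrix P fun ω => (X r ω)ᵀ * X r ω‖ = a
    generalize ‖expMatrix P fun ω => X r ω * (X r ω)ᵀ‖ = b
    generalize ‖tensorSecondMoment P (X r)‖ = κ
    set Q : ℝ := 2 ^ (N + 1)
    have hdε : 0 ≤ (d : ℝ) ^ ε := by positivity
    -- `12288 = 3 * 64 ^ 2`, from `(x + y + z) ^ 2 ≤ 3 * (x ^ 2 + y ^ 2 + z ^ 2)`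
    calc (64 * (a + b) + 8 * Q ^ 4 * κ) ^ 2
        ≤ 12288 * a ^ 2 + 12288 * b ^ 2 + 192 * (Q ^ 8 * κ ^ 2) := by
          nlinarith [sq_nonneg (64 * a - 64 * b), sq_nonneg (64 * a - 8 * Q ^ 4 * κ),
            sq_nonneg (64 * b - 8 * Q ^ 4 * κ)]
      _ ≤ 12288 * K * a ^ 2 + 12288 * K * b ^ 2 + 12288 * (K * d ^ ε * κ ^ 2) := by
          have h1 := mul_le_mul_of_nonneg_right hNK (sq_nonneg κ)
          have h2 : 0 ≤ K * d ^ ε * κ ^ 2 := by positivity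
          nlinarith [mul_nonneg (sub_nonneg.2 hK1) (sq_nonneg a),
            mul_nonneg (sub_nonneg.2 hK1) (sq_nonneg b)]
      _ = 12288 * K * (a ^ 2 + b ^ 2 + d ^ ε * κ ^ 2) := by ring
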